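/- A partial matching is a graph with vertex set $\{1,\dots,m\}$ all of whose vertices have degree $0$ or $1$; its edges are called arcs. Its lattice presentation is the set of all points $(x,y)\in\mathbb{Z}^2$ such that $x$ and $y$ are joined by an arc; it is symmetric under $v=(x,y)\mapsto v^*=(y,x)$. For points $v,w$ let $R(v,w)$ be the closed axis-parallel rectangle with diagonal vertices $v,w$, and let $\tilde v,\tilde w$ be its other two vertices. For a finite set $V$ of points and distinct $v,w\in V$, the transformation of $V$ by $R(v,w)$ replaces $v,w$ by $\tilde v,\tilde w$. For a lattice presentation $\Delta$ and $v,w\in\Delta$ giving two different arcs, the transformation of $\Delta$ by $R(v,w)\cup(-R(v,w)^*)$ replaces $v,w,v^*,w^*$ by $\tilde v,\tilde w,\tilde v^*,\tilde w^*$. A transformation $\Delta\to\Delta'$ is a finite sequence of such steps from $\Delta$ to $\Delta'$; if it uses the rectangles $R_1,\dots,R_k$ (together with the $-R_j^*$), its area is $\sum_{j=1}^k\mathrm{Area}(R_j)$. It has minimal area if no transformation $\Delta\to\Delta'$ has smaller area. A lattice polytope $P$ is given by two finite sets $\mathrm{Ver}_0(P),\mathrm{Ver}_1(P)\subset\mathbb{Z}^2$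 (initial and terminal vertices), in each of which the $x$-coordinates are pairwise distinct and the $y$-coordinates are pairwise distinct, and which have the same set of $x$-coordinates and the same set of $y$-coordinates. The points common to both sets are the isolated vertices. An edge joins an initial to a different terminal vertex with the same $y$-coordinate (oriented from the initial to the terminal vertex) or with the same $x$-coordinate (oriented from the terminal to the initial vertex). The boundary $\partial P$ is the union of the edges, a union of oriented closed curves, and the face of $P$ is the closure of the set of points outside $\partial P$ about which $\partial P$ has non-zero rotation number. Let $-P^*$ be the lattice polytope with vertex sets $\mathrm{Ver}_i(P)^*$. We say that $P$ is associated with lattice presentations $\Delta,\Delta'$ if $\Delta$ is the disjoint union of $\mathrm{Ver}_0(P)$ and $\mathrm{Ver}_0(P)^*$, and $\Delta'$ is the disjoint union of $\mathrm{Ver}_1(P)$ and $\mathrm{Ver}_1(P)^*$. We say that $P$ is a simple lattice polygon if its edges form a single closed oriented path, all rotation numbers are $0$ or $\varepsilon$ for one $\varepsilon\in\{1,-1\}$, and its face is homeomorphic to a closed $2$-disk; isolated vertices are allowed in addition. A division of $P$ is a family of rectangles $R_1,\dots,R_k$ with pairwise disjoint interiors whose union is the face of $P$; it induces a transformation of $P$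 if $R_1,\dots,R_k$, in this order, are the rectangles of a sequence of transformations from $\mathrm{Ver}_0(P)$ to $\mathrm{Ver}_1(P)$ (each $R_j$ having as diagonal vertices two points of the current set). **Theorem.** Let $\Delta,\Delta'$ be lattice presentations of partial matchings and let $P$ be a lattice polytope associated with them which is a simple lattice polygon with $2n$ non-isolated vertices. 1. There is a division of $P$ into $n-1$ rectangles that induces a transformation of $P$, and every division of $P$ into $n-1$ rectangles $R_1,\dots,R_{n-1}$ that induces a transformation of $P$ gives a transformation $\Delta\to\Delta'$, by $R_1\cup(-R_1^*),\dots,R_{n-1}\cup(-R_{n-1}^*)$, of minimal area. 2. Suppose that $P$ and $-P^*$ (each with its face, edges and vertices) are disjoint. Then every transformation $\Delta\to\Delta'$ of minimal area arises in this way: after replacing, for some $j$, the rectangle $R_j$ by $-R_j^*$, its rectangles form, in the given order, a division of $P$ that induces a transformation of $P$. If no isolated vertex of $P$ lies in the face of $P$ (in particular if $P$ has no isolated vertices), then the number of these rectangles is $n-1$. Moreover each step of the transformation replaces two nesting arcs by two crossing arcs, or two crossing arcs by two nesting arcs. -/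

import Mathlib

/-- Lattice points. The `x`-component is the first entry, the `y`-component the second. -/
abbrev LatticePoint : Type := ℤ × ℤ

/-- A lattice point as a point of the plane `ℝ²`, which is identified with `ℂ`
(`x` is the real part, `y` the imaginary part). -/
def LatticePoint.toPlane (v : LatticePoint) : ℂ := ⟨(v.1 : ℝ), (v.2 : ℝ)⟩

/-- The mirror image `v*` of `v` with respect to the line `x = y`. -/
def LatticePoint.star (v : LatticePoint) : LatticePoint := (v.2, v.1)

/-- A partial matching (chord diagram): a graph with vertex set `{1, …, m}` all of whose vertices
have degree zero or one. -/
structure PartialMatching (m : ℕ) where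
  graph : SimpleGraph (Finset.Icc 1 m)
  degree_le_one : ∀ a b c, graph.Adj a b → graph.Adj a c → b = c

open Classical in
/-- The lattice presentation of a partial matching: the points `(x, y)` and `(y, x)` for each arc
joining the vertices `x` and `y`. -/
noncomputable def PartialMatching.latticePresentation {m : ℕ} (δ : PartialMatching m) :
    Finset LatticePoint :=
  (Finset.univ.filter (fun e : Finset.Icc 1 m × Finset.Icc 1 m => δ.graph.Adj e.1 e.2)).image
    (fun e => (((e.1 : ℕ) : ℤ), ((e.2 : ℕ) : ℤ)))

/-! Rectangles and transformations -/

/-- The rectangle `R(v, w)`, given by the pair `e = (v, w)` of its diagonal vertices. -/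
def rectangle (e : LatticePoint × LatticePoint) : Set ℂ :=
  Set.uIcc (e.1.1 : ℝ) (e.2.1 : ℝ) ×ℂ Set.uIcc (e.1.2 : ℝ) (e.2.2 : ℝ)

/-- The area of the rectangle `R(v, w)`. -/
def rectangleArea (e : LatticePoint × LatticePoint) : ℝ :=
  |(e.2.1 : ℝ) - (e.1.1 : ℝ)| * |(e.2.2 : ℝ) - (e.1.2 : ℝ)|

/-- For `corner v w = (x(w), y(v))`, the points `corner v w` and `corner w v` are the other two
vertices of `R(v, w)`. -/
def corner (v w : LatticePoint) : LatticePoint := (w.1, v.2)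

/-- The result `t(V, R(v, w))` of the transformation of `V` by the rectangle `R(v, w)`. -/
def rectTransform (V : Finset LatticePoint) (v w : LatticePoint) : Finset LatticePoint :=
  (V \ {v, w}) ∪ {corner v w, corner w v}

/-- `V = V₀ → V₁ → ⋯ → Vₖ = V'` is a transformation by the rectangles `R(vⱼ, wⱼ)`, where
`(vⱼ, wⱼ)` are the successive entries of the list, and `vⱼ`, `wⱼ` are distinct points of
`Vⱼ₋₁`. -/
def IsRectTransformation :
    Finset LatticePoint → List (LatticePoint × LatticePoint) → Finset LatticePoint → Prop
  | V, [], V' => V = V'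
  | V, (v, w) :: l, V' =>
      v ∈ V ∧ w ∈ V ∧ v ≠ w ∧ IsRectTransformation (rectTransform V v w) l V'

/-- The result `t(Δ, R ∪ (-R*))` for `R = R(v, w)`: the arcs given by `v` and `w` are exchanged
for those given by the other two vertices of `R`. -/
def matchingTransform (Δ : Finset LatticePoint) (v w : LatticePoint) : Finset LatticePoint :=
  (Δ \ {v, w, v.star, w.star}) ∪
    {corner v w, corner w v, (corner v w).star, (corner w v).star}

/-- `Δ = Δ₀ → Δ₁ → ⋯ → Δₖ = Δ'` is a transformation of lattice presentations of partial
matchings, with `Δⱼ = t(Δⱼ₋₁, Rⱼ ∪ (-Rⱼ*))` and `Rⱼ = R(vⱼ, wⱼ)`, where `vⱼ` and `wⱼ` give two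
different arcs of `Δⱼ₋₁`. -/
def IsMatchingTransformation :
    Finset LatticePoint → List (LatticePoint × LatticePoint) → Finset LatticePoint → Prop
  | Δ, [], Δ' => Δ = Δ'
  | Δ, (v, w) :: l, Δ' =>
      v ∈ Δ ∧ w ∈ Δ ∧ v ≠ w ∧ v.star ≠ w ∧ IsMatchingTransformation (matchingTransform Δ v w) l Δ'

/-- The area of the transformation by the rectangles in the list. -/
def transformationArea (l : List (LatticePoint × LatticePoint)) : ℝ :=
  (l.map rectangleArea).sum

/-- The list is a transformation `Δ → Δ'` whose area is minimal among all transformations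
`Δ → Δ'`. -/
def IsMinimalTransformation (Δ : Finset LatticePoint) (l : List (LatticePoint × LatticePoint))
    (Δ' : Finset LatticePoint) : Prop :=
  IsMatchingTransformation Δ l Δ' ∧
    ∀ l', IsMatchingTransformation Δ l' Δ' → transformationArea l ≤ transformationArea l'

/-- The two pairs of diagonal vertices give the same pair of rectangles `R ∪ (-R*)`. -/
def SameStep (e f : LatticePoint × LatticePoint) : Prop :=
  f = e ∨ f = (e.1.star, e.2.star)

/-! Nesting and crossing arcs -/

/-- The left endpoint of the arc presented by `v`. -/
def LatticePoint.left (v : LatticePoint) : ℤ := min v.1 v.2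

/-- The right endpoint of the arc presented by `v`. -/
def LatticePoint.right (v : LatticePoint) : ℤ := max v.1 v.2

/-- The arcs presented by `v` and `w` are nesting. -/
def NestingArcs (v w : LatticePoint) : Prop :=
  (v.left < w.left ∧ w.left < w.right ∧ w.right < v.right) ∨
    (w.left < v.left ∧ v.left < v.right ∧ v.right < w.right)

/-- The arcs presented by `v` and `w` are crossing. -/
def CrossingArcs (v w : LatticePoint) : Prop :=
  (v.left < w.left ∧ w.left < v.right ∧ v.right < w.right) ∨
    (w.left < v.left ∧ v.left < w.right ∧ w.right < v.right)

/-- The step by `R(v, w) ∪ (-R(v, w)*)` changes nesting arcs to crossing arcs or crossing arcs to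
nesting arcs. -/
def SwapsNestingCrossing (e : LatticePoint × LatticePoint) : Prop :=
  (NestingArcs e.1 e.2 ∧ CrossingArcs (corner e.1 e.2) (corner e.2 e.1)) ∨
    (CrossingArcs e.1 e.2 ∧ NestingArcs (corner e.1 e.2) (corner e.2 e.1))

/-! Lattice polytopes -/

/-- A lattice polytope, given by its initial vertices `ver0` and its terminal vertices `ver1`.
Points common to both are the isolated vertices. Each other vertex lies on one edge in the
`x`-direction and one edge in the `y`-direction, each joining it to a vertex of the other kind;
different edges in the same direction, and isolated vertices, lie on different lines. -/
structure LatticePolytope where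
  ver0 : Finset LatticePoint
  ver1 : Finset LatticePoint
  fst_injOn0 : Set.InjOn Prod.fst (ver0 : Set LatticePoint)
  fst_injOn1 : Set.InjOn Prod.fst (ver1 : Set LatticePoint)
  snd_injOn0 : Set.InjOn Prod.snd (ver0 : Set LatticePoint)
  snd_injOn1 : Set.InjOn Prod.snd (ver1 : Set LatticePoint)
  fst_image : ver0.image Prod.fst = ver1.image Prod.fst
  snd_image : ver0.image Prod.snd = ver1.image Prod.snd

namespace LatticePolytope

/-- The orientation-reversed mirror reflection `-P*` of `P` with respect to the line `x = y`. -/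
def mirror (P : LatticePolytope) : LatticePolytope where
  ver0 := P.ver0.image LatticePoint.star
  ver1 := P.ver1.image LatticePoint.star
  fst_injOn0 := by
    intro a ha b hb h
    simp only [Finset.coe_image, Set.mem_image] at ha hb
    obtain ⟨a, ha, rfl⟩ := ha
    obtain ⟨b, hb, rfl⟩ := hb
    exact congrArg _ (P.snd_injOn0 ha hb h)
  fst_injOn1 := by
    intro a ha b hb h
    simp only [Finset.coe_image, Set.mem_image] at ha hb
    obtain ⟨a, ha, rfl⟩ := ha
    obtain ⟨b, hb, rfl⟩ := hb
    exact congrArg _ (P.snd_injOn1 ha hb h)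
  snd_injOn0 := by
    intro a ha b hb h
    simp only [Finset.coe_image, Set.mem_image] at ha hb
    obtain ⟨a, ha, rfl⟩ := ha
    obtain ⟨b, hb, rfl⟩ := hb
    exact congrArg _ (P.fst_injOn0 ha hb h)
  snd_injOn1 := by
    intro a ha b hb h
    simp only [Finset.coe_image, Set.mem_image] at ha hb
    obtain ⟨a, ha, rfl⟩ := ha
    obtain ⟨b, hb, rfl⟩ := hb
    exact congrArg _ (P.fst_injOn1 ha hb h)
  fst_image := by
    rw [Finset.image_image, Finset.image_image]
    exact P.snd_image
  snd_image := by
    rw [Finset.image_image, Finset.image_image]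
    exact P.fst_image

/-- `P` is a lattice polytope associated with `Δ` and `Δ'`: the initial vertices of `P` and `-P*`
make up `Δ`, each of the two contributing one half, and the terminal vertices make up `Δ'` in the
same way. -/
def IsAssociated (P : LatticePolytope) (Δ Δ' : Finset LatticePoint) : Prop :=
  P.ver0 ∪ P.mirror.ver0 = Δ ∧ Disjoint P.ver0 P.mirror.ver0 ∧
    P.ver1 ∪ P.mirror.ver1 = Δ' ∧ Disjoint P.ver1 P.mirror.ver1

/-- The isolated vertices. -/
def isolated (P : LatticePolytope) : Finset LatticePoint := P.ver0 ∩ P.ver1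

/-- The non-isolated vertices. -/
def nonIsolated (P : LatticePolytope) : Finset LatticePoint := (P.ver0 ∪ P.ver1) \ P.isolated

/-- The oriented edges: an edge in the `x`-direction goes from an initial to a terminal vertex, an
edge in the `y`-direction from a terminal to an initial vertex. -/
def edges (P : LatticePolytope) : Finset (LatticePoint × LatticePoint) :=
  (P.ver0 ×ˢ P.ver1).filter (fun e => e.1.2 = e.2.2 ∧ e.1 ≠ e.2) ∪
    (P.ver1 ×ˢ P.ver0).filter (fun e => e.1.1 = e.2.1 ∧ e.1 ≠ e.2)

/-- The boundary `∂P`, the union of the edges. -/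
def boundary (P : LatticePolytope) : Set ℂ :=
  ⋃ e ∈ P.edges, segment ℝ e.1.toPlane e.2.toPlane

/-- The rotation number of `P` with respect to a point `p` outside `∂P`, that is the total change
of the argument of `z - p` as `z` runs through the oriented boundary, divided by `2π`. (Along an
edge from `a` to `b` which avoids `p`, the change is the argument of `(b - p) / (a - p)`
in `(-π, π)`.) -/
noncomputable def rotationNumber (P : LatticePolytope) (p : ℂ) : ℝ :=
  (∑ e ∈ P.edges, Complex.arg ((e.2.toPlane - p) / (e.1.toPlane - p))) / (2 * Real.pi)

/-- The face (region) of `P`: the union of the closures of the regions of the complement of `∂P`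
whose rotation number is not zero. -/
def face (P : LatticePolytope) : Set ℂ :=
  closure {p | p ∉ P.boundary ∧ P.rotationNumber p ≠ 0}

/-- All points of the plane which belong to `P`: its face, its edges and its vertices. -/
def carrier (P : LatticePolytope) : Set ℂ :=
  P.face ∪ P.boundary ∪ LatticePoint.toPlane '' ((P.ver0 ∪ P.ver1 : Finset LatticePoint) : Set _)

/-- Up to isolated vertices, `P` consists of one component: there are edges, and they form a single
closed oriented path. -/
def IsConnected (P : LatticePolytope) : Prop :=
  P.nonIsolated.Nonempty ∧
    ∀ u ∈ P.nonIsolated, ∀ v ∈ P.nonIsolated,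
      Relation.ReflTransGen (fun a b => (a, b) ∈ P.edges) u v

/-- `P` is a simple lattice polygon (possibly together with isolated vertices): it has one
component, and its region, which is taken with the multiplicities and signs given by the rotation
numbers, is a single copy of a 2-disk with one of its two orientations. -/
def IsSimplePolygon (P : LatticePolytope) : Prop :=
  P.IsConnected ∧
    (∃ ε : ℝ, (ε = 1 ∨ ε = -1) ∧
      ∀ p, p ∉ P.boundary → P.rotationNumber p = 0 ∨ P.rotationNumber p = ε) ∧
    Nonempty (P.face ≃ₜ Metric.closedBall (0 : ℂ) 1)

/-- The rectangles in the list form a division of the polygon `P`: they cover exactly the face of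
`P` and do not overlap. -/
def IsDivision (P : LatticePolytope) (l : List (LatticePoint × LatticePoint)) : Prop :=
  (⋃ e ∈ l, rectangle e) = P.face ∧
    l.Pairwise (fun e f => Disjoint (interior (rectangle e)) (interior (rectangle f)))

/-- The rectangles in the list, in this order, induce a transformation of `P` to the polytope that
consists of the terminal vertices of `P` only. -/
def InducesTransformation (P : LatticePolytope) (l : List (LatticePoint × LatticePoint)) : Prop :=
  IsRectTransformation P.ver0 l P.ver1

end LatticePolytope

/-! Everything is counted on unit cells. The rotation number of `P` about a cell is the difference
of the numbers of initial and terminal vertices to the lower left of it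
(`rotationNumber_eq_winding`). A move by a rectangle changes this winding by the signed indicator of
the rectangle, so the signed indicators of a transformation add up to the winding
(`winding_eq_sum`).

Minimality: a transformation of matchings, together with the mirror images of its rectangles, is a
transformation by single rectangles. Each cell is therefore covered at least as often as the
absolute winding of `P` and `-P*` there. The windings all have one sign, so nothing cancels between
`P` and `-P*`, and summing over the cells gives the area of the face of `P` as a lower bound
(`area_ge`). A division attains it.

Existence: while the winding is non-negative and the vertex sets differ, some rectangle on two
current vertices has positive winding throughout (`exists_positive_rectangle`); removing such
rectangles one by one ends at the terminal vertices.

Number of rectangles: count the pairs of vertices one of which lies strictly to the lower left of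
the other. A positive rectangle with no current vertex inside lowers this number by exactly one.
Between initial and terminal vertices it drops by half the sum, over all vertices, of the windings
of the two diagonally adjacent cells (`two_mul_lessCount_sub`). For a polygon with `2n` vertices
this sum is `n` plus the number of reflex corners. Convex corners outnumber reflex ones by four, by
a discrete form of Hopf's theorem on turning tangents (`turning_sum_eq`), so there are `n - 2`
reflex corners and the drop is `n - 1`.

Converse: a minimal transformation attains the lower bound in every cell, so its rectangles lie in
the union of `P` and `-P*`. These are disjoint and a rectangle is connected, so each rectangle lies
in one of them and can be reflected into `P` (`of_minimal`). A rectangle meeting the line `x = y`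
would give a common point of `P` and `-P*`; away from this line a move exchanges nesting and
crossing. -/

/-! Quadrant counts, windings and signed rectangles -/

/-- The indicator of `a ≤ t`. -/
def step (a t : ℤ) : ℤ := if a ≤ t then 1 else 0

/-- The number of points of `V` to the lower left of the unit cell with lower left corner `z`. -/
def quadrantCount (V : Finset LatticePoint) (z : LatticePoint) : ℤ :=
  ∑ v ∈ V, step v.1 z.1 * step v.2 z.2

/-- The multiplicity of the cell `z` in the domain bounded by `V` and `V'`. -/
def winding (V V' : Finset LatticePoint) (z : LatticePoint) : ℤ :=
  quadrantCount V z - quadrantCount V' z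

/-- The signed indicator function of the cells in the rectangle `R(v, w)`, `e = (v, w)`. -/
def signedCell (e : LatticePoint × LatticePoint) (z : LatticePoint) : ℤ :=
  (step e.1.1 z.1 - step e.2.1 z.1) * (step e.1.2 z.2 - step e.2.2 z.2)

/-- Two sets of lattice points in general position with the same coordinates. -/
structure IsGridPair (V V' : Finset LatticePoint) : Prop where
  fst_injOn0 : Set.InjOn Prod.fst (V : Set LatticePoint)
  fst_injOn1 : Set.InjOn Prod.fst (V' : Set LatticePoint)
  snd_injOn0 : Set.InjOn Prod.snd (V : Set LatticePoint)
  snd_injOn1 : Set.InjOn Prod.snd (V' : Set LatticePoint)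
  fst_image : V.image Prod.fst = V'.image Prod.fst
  snd_image : V.image Prod.snd = V'.image Prod.snd

theorem LatticePolytope.isGridPair (P : LatticePolytope) : IsGridPair P.ver0 P.ver1 :=
  ⟨P.fst_injOn0, P.fst_injOn1, P.snd_injOn0, P.snd_injOn1, P.fst_image, P.snd_image⟩

namespace IsGridPair

variable {V V' V'' : Finset LatticePoint}

theorem symm (h : IsGridPair V V') : IsGridPair V' V :=
  ⟨h.2, h.1, h.4, h.3, h.5.symm, h.6.symm⟩

theorem left (h : IsGridPair V V') : IsGridPair V V := ⟨h.1, h.1, h.3, h.3, rfl, rfl⟩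

theorem trans (h : IsGridPair V V') (h' : IsGridPair V' V'') : IsGridPair V V'' :=
  ⟨h.1, h'.2, h.3, h'.4, h.5.trans h'.5, h.6.trans h'.6⟩

theorem eq_of_fst (h : IsGridPair V V') {u v : LatticePoint} (hu : u ∈ V) (hv : v ∈ V)
    (e : u.1 = v.1) : u = v := h.fst_injOn0 hu hv e

theorem eq_of_snd (h : IsGridPair V V') {u v : LatticePoint} (hu : u ∈ V) (hv : v ∈ V)
    (e : u.2 = v.2) : u = v := h.snd_injOn0 hu hv e

theorem exists_fst (h : IsGridPair V V') {u : LatticePoint} (hu : u ∈ V) :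
    ∃ v ∈ V', v.1 = u.1 := by
  have : u.1 ∈ V'.image Prod.fst := h.fst_image ▸ Finset.mem_image_of_mem _ hu
  simpa using this

theorem exists_snd (h : IsGridPair V V') {u : LatticePoint} (hu : u ∈ V) :
    ∃ v ∈ V', v.2 = u.2 := by
  have : u.2 ∈ V'.image Prod.snd := h.snd_image ▸ Finset.mem_image_of_mem _ hu
  simpa using this

theorem sum_fst {M : Type*} [AddCommMonoid M] (h : IsGridPair V V') (g : ℤ → M) :
    ∑ v ∈ V, g v.1 = ∑ v ∈ V', g v.1 := by
  rw [← Finset.sum_image (f := g) h.fst_injOn0, ← Finset.sum_image (f := g) h.fst_injOn1,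
    h.fst_image]

theorem sum_snd {M : Type*} [AddCommMonoid M] (h : IsGridPair V V') (g : ℤ → M) :
    ∑ v ∈ V, g v.2 = ∑ v ∈ V', g v.2 := by
  rw [← Finset.sum_image (f := g) h.snd_injOn0, ← Finset.sum_image (f := g) h.snd_injOn1,
    h.snd_image]

theorem card_eq (h : IsGridPair V V') : V.card = V'.card := by
  simpa using h.sum_fst (fun _ => (1 : ℕ))

end IsGridPair

/-! ### The effect of a single rectangle move. -/

section RectTransform

variable {V : Finset LatticePoint} {v w : LatticePoint}

theorem mem_rectTransform {u : LatticePoint} :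
    u ∈ rectTransform V v w ↔ (u ∈ V ∧ u ≠ v ∧ u ≠ w) ∨ u = corner v w ∨ u = corner w v := by
  simp only [rectTransform, Finset.mem_union, Finset.mem_sdiff, Finset.mem_insert,
    Finset.mem_singleton, not_or]

theorem corner_notMem (h : IsGridPair V V) (hv : v ∈ V) (hw : w ∈ V) (hvw : v ≠ w) :
    corner v w ∉ V := fun hc =>
  hvw ((h.eq_of_snd hv hc rfl).trans (h.eq_of_fst hc hw rfl))

theorem fst_ne (h : IsGridPair V V) (hv : v ∈ V) (hw : w ∈ V) (hvw : v ≠ w) : v.1 ≠ w.1 :=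
  fun e => hvw (h.eq_of_fst hv hw e)

theorem snd_ne (h : IsGridPair V V) (hv : v ∈ V) (hw : w ∈ V) (hvw : v ≠ w) : v.2 ≠ w.2 :=
  fun e => hvw (h.eq_of_snd hv hw e)

theorem corner_ne_corner (h : IsGridPair V V) (hv : v ∈ V) (hw : w ∈ V) (hvw : v ≠ w) :
    corner v w ≠ corner w v := fun e =>
  fst_ne h hw hv hvw.symm (congrArg Prod.fst e : (corner v w).1 = (corner w v).1)

theorem sum_rectTransform (h : IsGridPair V V) (hv : v ∈ V) (hw : w ∈ V) (hvw : v ≠ w)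
    (g : LatticePoint → ℤ) :
    ∑ u ∈ rectTransform V v w, g u =
      ∑ u ∈ V, g u - g v - g w + g (corner v w) + g (corner w v) := by
  have h1 := corner_notMem h hv hw hvw
  have h2 := corner_notMem h hw hv hvw.symm
  rw [rectTransform, Finset.sum_union, Finset.sum_pair (corner_ne_corner h hv hw hvw),
    ← Finset.sum_sdiff (s₁ := {v, w}) (s₂ := V), Finset.sum_pair hvw]
  · ring
  · intro u hu
    simp only [Finset.mem_insert, Finset.mem_singleton] at hu
    rcases hu with rfl | rfl <;> assumption
  · rw [Finset.disjoint_right]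
    intro u hu
    simp only [Finset.mem_insert, Finset.mem_singleton] at hu
    rcases hu with rfl | rfl <;> simp [h1, h2]

theorem isGridPair_rectTransform (h : IsGridPair V V) (hv : v ∈ V) (hw : w ∈ V) (hvw : v ≠ w) :
    IsGridPair V (rectTransform V v w) := by
  have f1 : ∀ a ∈ V, ∀ b ∈ V, a.1 = b.1 → a = b := fun a ha b hb => h.eq_of_fst ha hb
  have f2 : ∀ a ∈ V, ∀ b ∈ V, a.2 = b.2 → a = b := fun a ha b hb => h.eq_of_snd ha hb
  have c1 : (corner v w).1 = w.1 := rfl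
  have c2 : (corner v w).2 = v.2 := rfl
  have c3 : (corner w v).1 = v.1 := rfl
  have c4 : (corner w v).2 = w.2 := rfl
  refine ⟨h.1, ?_, h.3, ?_, ?_, ?_⟩
  · intro a ha b hb e
    rw [Finset.mem_coe, mem_rectTransform] at ha hb
    grind
  · intro a ha b hb e
    rw [Finset.mem_coe, mem_rectTransform] at ha hb
    grind
  · ext x
    simp only [Finset.mem_image, mem_rectTransform]
    constructor
    · rintro ⟨u, hu, rfl⟩
      by_cases h1 : u = v
      · exact ⟨corner w v, by simp, by rw [c3, h1]⟩
      by_cases h2 : u = w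
      · exact ⟨corner v w, by simp, by rw [c1, h2]⟩
      exact ⟨u, Or.inl ⟨hu, h1, h2⟩, rfl⟩
    · rintro ⟨u, ⟨hu, -⟩ | rfl | rfl, rfl⟩
      exacts [⟨u, hu, rfl⟩, ⟨w, hw, rfl⟩, ⟨v, hv, rfl⟩]
  · ext x
    simp only [Finset.mem_image, mem_rectTransform]
    constructor
    · rintro ⟨u, hu, rfl⟩
      by_cases h1 : u = v
      · exact ⟨corner v w, by simp, by rw [c2, h1]⟩
      by_cases h2 : u = w
      · exact ⟨corner w v, by simp, by rw [c4, h2]⟩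
      exact ⟨u, Or.inl ⟨hu, h1, h2⟩, rfl⟩
    · rintro ⟨u, ⟨hu, -⟩ | rfl | rfl, rfl⟩
      exacts [⟨u, hu, rfl⟩, ⟨v, hv, rfl⟩, ⟨w, hw, rfl⟩]

theorem quadrantCount_rectTransform (h : IsGridPair V V) (hv : v ∈ V) (hw : w ∈ V) (hvw : v ≠ w)
    (z : LatticePoint) :
    quadrantCount (rectTransform V v w) z = quadrantCount V z - signedCell (v, w) z := by
  rw [quadrantCount, sum_rectTransform h hv hw hvw]
  simp only [quadrantCount, signedCell, corner]
  ring

theorem winding_rectTransform (h : IsGridPair V V) (hv : v ∈ V) (hw : w ∈ V) (hvw : v ≠ w)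
    (V' : Finset LatticePoint) (z : LatticePoint) :
    winding (rectTransform V v w) V' z = winding V V' z - signedCell (v, w) z := by
  rw [winding, quadrantCount_rectTransform h hv hw hvw, winding]
  ring

end RectTransform

/-- Each move subtracts its signed indicator, and the winding of `V'` against itself is zero, so the
sum telescopes. All area estimates rest on this. -/
theorem winding_eq_sum {V V' : Finset LatticePoint} {l : List (LatticePoint × LatticePoint)}
    (hV : IsGridPair V V) (h : IsRectTransformation V l V') (z : LatticePoint) :
    winding V V' z = (l.map (fun e => signedCell e z)).sum := by
  induction l generalizing V with
  | nil => rw [show V = V' from h]; simp [winding]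
  | cons e l ih =>
    obtain ⟨hv, hw, hvw, h⟩ := h
    have := ih (isGridPair_rectTransform hV hv hw hvw).symm.left h
    rw [winding_rectTransform hV hv hw hvw] at this
    rw [List.map_cons, List.sum_cons, ← this]
    ring

/-- The rectangles of a transformation are non-degenerate, with coordinates occurring in the
initial set. -/
theorem mem_coordinates_of_isRectTransformation {V V' : Finset LatticePoint}
    {l : List (LatticePoint × LatticePoint)} (hV : IsGridPair V V)
    (h : IsRectTransformation V l V') {e : LatticePoint × LatticePoint} (he : e ∈ l) :
    e.1.1 ≠ e.2.1 ∧ e.1.2 ≠ e.2.2 ∧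
      (e.1.1 ∈ V.image Prod.fst ∧ e.2.1 ∈ V.image Prod.fst) ∧
      (e.1.2 ∈ V.image Prod.snd ∧ e.2.2 ∈ V.image Prod.snd) := by
  induction l generalizing V with
  | nil => simp at he
  | cons f l ih =>
    obtain ⟨hv, hw, hvw, h⟩ := h
    rcases List.mem_cons.1 he with rfl | he
    · exact ⟨fst_ne hV hv hw hvw, snd_ne hV hv hw hvw,
        ⟨Finset.mem_image_of_mem _ hv, Finset.mem_image_of_mem _ hw⟩,
        Finset.mem_image_of_mem _ hv, Finset.mem_image_of_mem _ hw⟩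
    · have hp := isGridPair_rectTransform hV hv hw hvw
      have := ih hp.symm.left h he
      rwa [← hp.fst_image, ← hp.snd_image] at this

theorem isRectTransformation_append {V V' V'' : Finset LatticePoint}
    {l l' : List (LatticePoint × LatticePoint)} (h : IsRectTransformation V l V')
    (h' : IsRectTransformation V' l' V'') : IsRectTransformation V (l ++ l') V'' := by
  induction l generalizing V with
  | nil => rw [show V = V' from h]; exact h'
  | cons e l ih => exact ⟨h.1, h.2.1, h.2.2.1, ih h.2.2.2⟩

/-! ### Reversing transformations and carrying additional points along. -/

/-- The other pair of diagonal vertices. -/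
def otherDiagonal (e : LatticePoint × LatticePoint) : LatticePoint × LatticePoint :=
  (corner e.1 e.2, corner e.2 e.1)

theorem signedCell_otherDiagonal (e : LatticePoint × LatticePoint) (z : LatticePoint) :
    signedCell (otherDiagonal e) z = -signedCell e z := by
  simp only [signedCell, otherDiagonal, corner]
  ring

theorem rectTransform_rectTransform {V : Finset LatticePoint} {v w : LatticePoint}
    (h : IsGridPair V V) (hv : v ∈ V) (hw : w ∈ V) (hvw : v ≠ w) :
    rectTransform (rectTransform V v w) (corner v w) (corner w v) = V := by
  have h1 := corner_notMem h hv hw hvw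
  have h2 := corner_notMem h hw hv hvw.symm
  have c1 : corner (corner v w) (corner w v) = v := rfl
  have c2 : corner (corner w v) (corner v w) = w := rfl
  ext u
  simp only [mem_rectTransform, c1, c2]
  grind

/-- A move is undone by the other diagonal of the same rectangle. This reduces negatively oriented
polygons to positively oriented ones. -/
theorem isRectTransformation_reverse {V V' : Finset LatticePoint}
    {l : List (LatticePoint × LatticePoint)} (hV : IsGridPair V V)
    (h : IsRectTransformation V l V') :
    IsRectTransformation V' (l.reverse.map otherDiagonal) V := by
  induction l generalizing V with
  | nil => exact h.symm
  | cons e l ih =>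
    obtain ⟨v, w⟩ := e
    obtain ⟨hv, hw, hvw, h⟩ := h
    have hp := isGridPair_rectTransform hV hv hw hvw
    rw [List.reverse_cons, List.map_append]
    refine isRectTransformation_append (ih hp.symm.left h) ⟨?_, ?_, ?_, ?_⟩
    · rw [mem_rectTransform]; exact Or.inr (Or.inl rfl)
    · rw [mem_rectTransform]; exact Or.inr (Or.inr rfl)
    · exact corner_ne_corner hV hv hw hvw
    · exact rectTransform_rectTransform hV hv hw hvw

/-- Points in columns that the moves never use are left alone. Isolated vertices are restored in
this way. -/
theorem isRectTransformation_union {V V' S : Finset LatticePoint}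
    {l : List (LatticePoint × LatticePoint)} (hV : IsGridPair V V)
    (hS : ∀ u ∈ S, u.1 ∉ V.image Prod.fst)
    (h : IsRectTransformation V l V') : IsRectTransformation (V ∪ S) l (V' ∪ S) := by
  induction l generalizing V with
  | nil => exact congrArg (· ∪ S) h
  | cons e l ih =>
    obtain ⟨v, w⟩ := e
    obtain ⟨hv, hw, hvw, h⟩ := h
    have hp := isGridPair_rectTransform hV hv hw hvw
    refine ⟨Finset.mem_union_left _ hv, Finset.mem_union_left _ hw, hvw, ?_⟩
    have hvS : v ∉ S := fun hs => hS v hs (Finset.mem_image_of_mem _ hv)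
    have hwS : w ∉ S := fun hs => hS w hs (Finset.mem_image_of_mem _ hw)
    have : rectTransform (V ∪ S) v w = rectTransform V v w ∪ S := by
      ext u
      simp only [mem_rectTransform, Finset.mem_union]
      grind
    rw [this]
    exact ih hp.symm.left (by rwa [← hp.fst_image]) h

/-! Existence of a transformation through a non-negative domain -/

theorem quadrantCount_eq_card (V : Finset LatticePoint) (z : LatticePoint) :
    quadrantCount V z = ((V.filter (fun u => u.1 ≤ z.1 ∧ u.2 ≤ z.2)).card : ℤ) := by
  rw [quadrantCount, Finset.card_filter, Nat.cast_sum]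
  refine Finset.sum_congr rfl fun u _ => ?_
  simp only [step]
  by_cases h1 : u.1 ≤ z.1 <;> by_cases h2 : u.2 ≤ z.2 <;> simp [h1, h2]

/-- A leftmost point `v` of `V` which is not in `V'` starts a rectangle on which the winding is
positive. -/
theorem exists_leftmost {V V' : Finset LatticePoint} (h : IsGridPair V V')
    (hw : ∀ z, 0 ≤ winding V V' z) (hne : V ≠ V') :
    ∃ v ∈ V, ∃ b ∈ V', b.1 = v.1 ∧ v.2 < b.2 ∧ v ∉ V' ∧
      (∀ u ∈ V, u.1 < v.1 → u ∈ V') ∧ (∀ u ∈ V', u.1 < v.1 → u ∈ V) := by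
  have hS : (V \ V').Nonempty := by
    rw [Finset.nonempty_iff_ne_empty, Ne, Finset.sdiff_eq_empty_iff_subset]
    exact fun hs => hne (Finset.eq_of_subset_of_card_le hs h.card_eq.ge)
  obtain ⟨v, hvS, hmin⟩ := Finset.exists_min_image _ Prod.fst hS
  obtain ⟨hv, hv'⟩ := Finset.mem_sdiff.1 hvS
  obtain ⟨b, hb, hb1⟩ := h.exists_fst hv
  have l1 : ∀ u ∈ V, u.1 < v.1 → u ∈ V' := by
    intro u hu hlt
    by_contra hu'
    exact absurd (hmin u (Finset.mem_sdiff.2 ⟨hu, hu'⟩)) (not_le.2 hlt)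
  have l2 : ∀ u ∈ V', u.1 < v.1 → u ∈ V := by
    intro u hu hlt
    obtain ⟨c, hc, hc1⟩ := h.symm.exists_fst hu
    rwa [← h.symm.eq_of_fst (l1 c hc (hc1 ▸ hlt)) hu hc1]
  refine ⟨v, hv, b, hb, hb1, ?_, hv', l1, l2⟩
  have hne2 : v.2 ≠ b.2 := fun e => hv' (by rwa [show v = b from Prod.ext hb1.symm e])
  by_contra hlt
  have hlt : b.2 < v.2 := by omega
  -- If `b` lay below `v`, the quadrant of this cell would contain `b` but not `v`, while everything
  -- to the left agrees in `V` and `V'`; the winding would be negative.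
  have := hw (v.1, b.2)
  rw [winding, quadrantCount_eq_card, quadrantCount_eq_card] at this
  have hlt' : (V.filter (fun u => u.1 ≤ v.1 ∧ u.2 ≤ b.2)) ⊂
      (V'.filter (fun u => u.1 ≤ v.1 ∧ u.2 ≤ b.2)) := by
    rw [Finset.ssubset_iff_of_subset]
    · refine ⟨b, by simp [hb, hb1], ?_⟩
      simp only [Finset.mem_filter, not_and]
      intro hbV
      have := h.eq_of_fst hbV hv hb1
      exact absurd this (fun e => hne2 (by rw [e]))
    · intro u hu
      simp only [Finset.mem_filter] at hu ⊢
      refine ⟨l1 u hu.1 ?_, hu.2⟩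
      rcases hu.2.1.lt_or_eq with h1 | h1
      · exact h1
      · rw [h.eq_of_fst hu.1 hv h1] at hu
        omega
  have := Finset.card_lt_card hlt'
  simp only at *
  omega

/-- Take `v` and `b` from `exists_leftmost`, and for `w` the leftmost point of `V` to the right of
`v` with height above `v` and at most that of `b`. For a cell of the rectangle, compare its winding
with the one at the height of `b` in the same column of cells. In the strip between the two heights,
`V` has only points left of `v`, which also belong to `V'`, while `V'` has `b` in addition. So the
winding of the cell is at least one more than a non-negative number. -/
theorem exists_positive_rectangle {V V' : Finset LatticePoint} (h : IsGridPair V V')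
    (hw : ∀ z, 0 ≤ winding V V' z) (hne : V ≠ V') :
    ∃ v ∈ V, ∃ w ∈ V, v.1 < w.1 ∧ v.2 < w.2 ∧
      ∀ z, signedCell (v, w) z ≤ winding V V' z := by
  obtain ⟨v, hv, b, hb, hb1, hvb, hv', l1, l2⟩ := exists_leftmost h hw hne
  have hT : (V.filter (fun u => v.1 < u.1 ∧ v.2 < u.2 ∧ u.2 ≤ b.2)).Nonempty := by
    obtain ⟨u, hu, hu2⟩ := h.symm.exists_snd hb
    refine ⟨u, Finset.mem_filter.2 ⟨hu, ?_, by omega, by omega⟩⟩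
    rcases lt_trichotomy u.1 v.1 with h1 | h1 | h1
    · have := h.symm.eq_of_snd (l1 u hu h1) hb hu2
      subst this
      omega
    · have := h.eq_of_fst hu hv h1
      subst this
      omega
    · exact h1
  obtain ⟨w, hwT, hmin⟩ := Finset.exists_min_image _ Prod.fst hT
  simp only [Finset.mem_filter] at hwT hmin
  obtain ⟨hwV, h1, h2, h3⟩ := hwT
  refine ⟨v, hv, w, hwV, h1, h2, fun z => ?_⟩
  by_cases hz : v.1 ≤ z.1 ∧ z.1 < w.1 ∧ v.2 ≤ z.2 ∧ z.2 < w.2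
  · obtain ⟨z1, z2, z3, z4⟩ := hz
    have e1 : signedCell (v, w) z = 1 := by
      simp [signedCell, step, z1, z3, not_le.2 z2, not_le.2 z4]
    rw [e1]
    have hz' := hw (z.1, b.2)
    have split : ∀ U : Finset LatticePoint, quadrantCount U (z.1, b.2) = quadrantCount U z +
        ((U.filter (fun u => u.1 ≤ z.1 ∧ z.2 < u.2 ∧ u.2 ≤ b.2)).card : ℤ) := by
      intro U
      rw [quadrantCount, quadrantCount, Finset.card_filter, Nat.cast_sum, ← Finset.sum_add_distrib]
      refine Finset.sum_congr rfl fun u _ => ?_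
      simp only [step]
      split_ifs <;> first | rfl | omega
    have hlt : (V.filter (fun u => u.1 ≤ z.1 ∧ z.2 < u.2 ∧ u.2 ≤ b.2)) ⊂
        (V'.filter (fun u => u.1 ≤ z.1 ∧ z.2 < u.2 ∧ u.2 ≤ b.2)) := by
      have key : ∀ u ∈ V, u.1 ≤ z.1 → z.2 < u.2 → u.2 ≤ b.2 → u.1 < v.1 := by
        intro u hu hu1 hu2 hu3
        rcases lt_trichotomy u.1 v.1 with h4 | h4 | h4
        · exact h4
        · have := h.eq_of_fst hu hv h4
          subst this
          omega
        · have := hmin u ⟨hu, h4, by omega, hu3⟩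
          omega
      rw [Finset.ssubset_iff_of_subset]
      · refine ⟨b, Finset.mem_filter.2 ⟨hb, by omega, by omega, le_rfl⟩, ?_⟩
        rw [Finset.mem_filter]
        rintro ⟨hbV, k1, k2, k3⟩
        have := key b hbV k1 k2 k3
        omega
      · intro u hu
        rw [Finset.mem_filter] at hu ⊢
        exact ⟨l1 u hu.1 (key u hu.1 hu.2.1 hu.2.2.1 hu.2.2.2), hu.2⟩
    have := Finset.card_lt_card hlt
    rw [winding, split, split] at hz'
    rw [winding]
    omega
  · have e0 : signedCell (v, w) z ≤ 0 := by
      simp only [signedCell, step]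
      split_ifs <;> simp <;> omega
    exact e0.trans (hw z)

theorem signedCell_nonneg {v w : LatticePoint} (h1 : v.1 < w.1) (h2 : v.2 < w.2)
    (z : LatticePoint) : 0 ≤ signedCell (v, w) z := by
  simp only [signedCell, step]
  split_ifs <;> simp <;> omega

/-- A non-negative domain is the sum of the rectangles of a transformation. -/
theorem exists_positive_transformation {V V' : Finset LatticePoint} (h : IsGridPair V V')
    (hw : ∀ z, 0 ≤ winding V V' z) :
    ∃ l, IsRectTransformation V l V' ∧ ∀ e ∈ l, ∀ z, 0 ≤ signedCell e z := by
  obtain ⟨a, ha⟩ : ∃ a : ℤ, ∀ v ∈ V, a ≤ v.1 ∧ a ≤ v.2 := by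
    obtain ⟨a, ha⟩ := (V.image Prod.fst ∪ V.image Prod.snd).bddBelow
    refine ⟨a, fun v hv => ⟨ha ?_, ha ?_⟩⟩ <;> simp only [Finset.coe_union, Finset.coe_image]
    exacts [Or.inl ⟨v, hv, rfl⟩, Or.inr ⟨v, hv, rfl⟩]
  -- A positive move lowers this sum by the area of its rectangle. All coordinates stay at least
  -- `a`, so the sum stays non-negative and serves as induction measure.
  obtain ⟨N, hN⟩ : ∃ N : ℕ, N = (∑ v ∈ V, (v.1 - a) * (v.2 - a)).toNat := ⟨_, rfl⟩
  induction N using Nat.strong_induction_on generalizing V with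
  | _ N ih =>
    by_cases hne : V = V'
    · exact ⟨[], hne, by simp⟩
    obtain ⟨v, hv, w, hwV, h1, h2, hle⟩ := exists_positive_rectangle h hw hne
    have hvw : v ≠ w := by rintro rfl; omega
    have hp := isGridPair_rectTransform h.left hv hwV hvw
    have hpos : ∀ u ∈ rectTransform V v w, a ≤ u.1 ∧ a ≤ u.2 := by
      intro u hu
      have := ha v hv
      have := ha w hwV
      rcases mem_rectTransform.1 hu with hu | rfl | rfl
      · exact ha u hu.1
      · simp only [corner]; omega
      · simp only [corner]; omega
    have hlt : ∑ u ∈ rectTransform V v w, (u.1 - a) * (u.2 - a) <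
        ∑ u ∈ V, (u.1 - a) * (u.2 - a) := by
      rw [sum_rectTransform h.left hv hwV hvw]
      simp only [corner]
      nlinarith [mul_pos (sub_pos.2 h1) (sub_pos.2 h2)]
    have h0 : 0 ≤ ∑ u ∈ rectTransform V v w, (u.1 - a) * (u.2 - a) :=
      Finset.sum_nonneg fun u hu =>
        mul_nonneg (sub_nonneg.2 (hpos u hu).1) (sub_nonneg.2 (hpos u hu).2)
    obtain ⟨l, hl, hl'⟩ := ih _ (by omega) (hp.symm.trans h)
      (fun z => by
        rw [winding_rectTransform h.left hv hwV hvw]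
        exact sub_nonneg.2 (hle z)) hpos rfl
    refine ⟨(v, w) :: l, ⟨hv, hwV, hvw, hl⟩, ?_⟩
    intro e he
    rcases List.mem_cons.1 he with rfl | he
    · exact signedCell_nonneg h1 h2
    · exact hl' e he

/-! The number of rectangles of a transformation through a domain without multiplicities -/

/-- The indicator of `a` lying strictly to the lower left of `b`. -/
def strictlyBelow (a b : LatticePoint) : ℤ := (1 - step b.1 a.1) * (1 - step b.2 a.2)

/-- The number of pairs of a point of `A` and a point of `B` to the upper right of it. -/
def lessCount (A B : Finset LatticePoint) : ℤ := ∑ a ∈ A, ∑ b ∈ B, strictlyBelow a b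

/-- The sum of a function over the two cells to the upper right and to the lower left of `p`. -/
def diagonalSum (f : LatticePoint → ℤ) (p : LatticePoint) : ℤ := f p + f (p.1 - 1, p.2 - 1)

theorem step_sub_one (a t : ℤ) : step a (t - 1) = 1 - step t a := by
  simp only [step]
  split_ifs <;> omega

theorem step_sub_step (a t : ℤ) : step a t - step a (t - 1) = if a = t then 1 else 0 := by
  simp only [step]
  split_ifs <;> omega

theorem winding_lowerLeft (V V' : Finset LatticePoint) (p : LatticePoint) :
    winding V V' (p.1 - 1, p.2 - 1) =
      ∑ a ∈ V, strictlyBelow a p - ∑ a ∈ V', strictlyBelow a p := by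
  simp only [winding, quadrantCount, step_sub_one, strictlyBelow]

/-- Since `V` and `V'` occupy the same rows and columns, inclusion-exclusion replaces the lower left
quadrant by the upper right one. -/
theorem IsGridPair.winding_eq {V V' : Finset LatticePoint} (h : IsGridPair V V')
    (p : LatticePoint) :
    winding V V' p = ∑ a ∈ V, strictlyBelow p a - ∑ a ∈ V', strictlyBelow p a := by
  have e : ∀ U : Finset LatticePoint, ∑ a ∈ U, strictlyBelow p a =
      ∑ a ∈ U, (1 - step a.1 p.1) - ∑ a ∈ U, step a.2 p.2 + quadrantCount U p := by
    intro U
    rw [quadrantCount, ← Finset.sum_sub_distrib, ← Finset.sum_add_distrib]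
    refine Finset.sum_congr rfl fun a _ => ?_
    simp only [strictlyBelow]
    ring
  rw [e, e, h.sum_fst (fun t => 1 - step t p.1), h.sum_snd (fun t => step t p.2), winding]
  ring

/-- At a point, one diagonal cell counts the points strictly below it and the other those strictly
above it. After summing over `V` and over `V'`, the mixed counts between `V` and `V'` cancel. The
formula resembles the index formula for domains in grid diagrams. -/
theorem IsGridPair.two_mul_lessCount_sub {V V' : Finset LatticePoint} (h : IsGridPair V V') :
    2 * (lessCount V V - lessCount V' V') =
      ∑ p ∈ V, diagonalSum (winding V V') p + ∑ p ∈ V', diagonalSum (winding V V') p := by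
  have e : ∀ U : Finset LatticePoint, ∑ p ∈ U, diagonalSum (winding V V') p =
      lessCount U V - lessCount U V' + (lessCount V U - lessCount V' U) := by
    intro U
    simp only [diagonalSum, winding_lowerLeft]
    simp only [h.winding_eq, Finset.sum_add_distrib, Finset.sum_sub_distrib, lessCount]
    rw [Finset.sum_comm (s := V) (t := U), Finset.sum_comm (s := V') (t := U)]
  rw [e, e]
  ring

/-- The mixed difference of the winding detects the vertices. -/
theorem winding_mixed_difference (V V' : Finset LatticePoint) (p : LatticePoint) :
    winding V V' p + winding V V' (p.1 - 1, p.2 - 1) - winding V V' (p.1 - 1, p.2) -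
      winding V V' (p.1, p.2 - 1) =
      (if p ∈ V then 1 else 0) - (if p ∈ V' then 1 else 0) := by
  have e : ∀ U : Finset LatticePoint, quadrantCount U p + quadrantCount U (p.1 - 1, p.2 - 1) -
      quadrantCount U (p.1 - 1, p.2) - quadrantCount U (p.1, p.2 - 1) =
      if p ∈ U then 1 else 0 := by
    intro U
    rw [← Finset.sum_ite_eq' U p (fun _ => (1 : ℤ))]
    simp only [quadrantCount]
    rw [← Finset.sum_add_distrib, ← Finset.sum_sub_distrib, ← Finset.sum_sub_distrib]
    refine Finset.sum_congr rfl fun a _ => ?_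
    have : (if a = p then (1 : ℤ) else 0) =
        (if a.1 = p.1 then 1 else 0) * (if a.2 = p.2 then 1 else 0) := by
      simp only [Prod.ext_iff, ite_and]
      split_ifs <;> rfl
    rw [this, ← step_sub_step, ← step_sub_step]
    ring
  rw [← e V, ← e V']
  simp only [winding]
  ring

theorem signedCell_eq_ite {v w z : LatticePoint} (h1 : v.1 < w.1) (h2 : v.2 < w.2) :
    signedCell (v, w) z = if v.1 ≤ z.1 ∧ z.1 < w.1 ∧ v.2 ≤ z.2 ∧ z.2 < w.2 then 1 else 0 := by
  simp only [signedCell, step]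
  split_ifs <;> simp <;> omega

theorem rectTransform_swap (V : Finset LatticePoint) (v w : LatticePoint) :
    rectTransform V w v = rectTransform V v w := by
  rw [rectTransform, rectTransform, Finset.pair_comm, Finset.pair_comm (corner w v)]

/-- Non-negative rectangles have lower left and upper right corners as diagonal. -/
theorem lt_or_gt_of_signedCell_nonneg {v w : LatticePoint} (h1 : v.1 ≠ w.1) (h2 : v.2 ≠ w.2)
    (h : ∀ z, 0 ≤ signedCell (v, w) z) : (v.1 < w.1 ∧ v.2 < w.2) ∨ (w.1 < v.1 ∧ w.2 < v.2) := by
  have := h (min v.1 w.1, min v.2 w.2)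
  simp only [signedCell, step] at this
  split_ifs at this <;> simp at this <;> omega

/-- By `two_mul_lessCount_sub` for `V` and its transform, whose winding is the indicator of the
rectangle: only `v` and `w` have a diagonal cell inside it, the new corners touch it by an
off-diagonal cell, and other points do not touch it because none lies in its interior. -/
theorem lessCount_rectTransform {V : Finset LatticePoint} {v w : LatticePoint}
    (h : IsGridPair V V) (hv : v ∈ V) (hw : w ∈ V) (h1 : v.1 < w.1) (h2 : v.2 < w.2)
    (hempty : ∀ u ∈ V, ¬ (v.1 < u.1 ∧ u.1 < w.1 ∧ v.2 < u.2 ∧ u.2 < w.2)) :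
    lessCount V V - lessCount (rectTransform V v w) (rectTransform V v w) = 1 := by
  have hvw : v ≠ w := by rintro rfl; omega
  have hp := isGridPair_rectTransform h hv hw hvw
  have hwd : winding V (rectTransform V v w) = signedCell (v, w) := by
    funext z
    rw [winding, quadrantCount_rectTransform h hv hw hvw]
    ring
  have key := hp.two_mul_lessCount_sub
  rw [sum_rectTransform h hv hw hvw, hwd] at key
  have hsum : ∑ u ∈ V, diagonalSum (signedCell (v, w)) u =
      diagonalSum (signedCell (v, w)) v + diagonalSum (signedCell (v, w)) w := by
    rw [← Finset.sum_pair hvw]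
    symm
    refine Finset.sum_subset ?_ fun u hu hu' => ?_
    · intro u hu
      simp only [Finset.mem_insert, Finset.mem_singleton] at hu
      rcases hu with rfl | rfl <;> assumption
    · simp only [Finset.mem_insert, Finset.mem_singleton, not_or] at hu'
      have a1 := fst_ne h hu hv hu'.1
      have a2 := fst_ne h hu hw hu'.2
      have a3 := snd_ne h hu hv hu'.1
      have a4 := snd_ne h hu hw hu'.2
      have := hempty u hu
      rw [diagonalSum, signedCell_eq_ite h1 h2, signedCell_eq_ite h1 h2, if_neg, if_neg]
      · rfl
      · simp only; omega
      · omega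
  rw [hsum] at key
  have d1 : diagonalSum (signedCell (v, w)) v = 1 := by
    rw [diagonalSum, signedCell_eq_ite h1 h2, signedCell_eq_ite h1 h2, if_pos, if_neg]
    · rfl
    · simp only; omega
    · omega
  have d2 : diagonalSum (signedCell (v, w)) w = 1 := by
    rw [diagonalSum, signedCell_eq_ite h1 h2, signedCell_eq_ite h1 h2, if_neg, if_pos]
    · rfl
    · simp only; omega
    · omega
  have d3 : diagonalSum (signedCell (v, w)) (corner v w) = 0 := by
    rw [diagonalSum, signedCell_eq_ite h1 h2, signedCell_eq_ite h1 h2, if_neg, if_neg]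
    · rfl
    · simp only [corner]; omega
    · simp only [corner]; omega
  have d4 : diagonalSum (signedCell (v, w)) (corner w v) = 0 := by
    rw [diagonalSum, signedCell_eq_ite h1 h2, signedCell_eq_ite h1 h2, if_neg, if_neg]
    · rfl
    · simp only [corner]; omega
    · simp only [corner]; omega
  rw [d1, d2, d3, d4] at key
  omega

/-- All four cells around `p` have non-zero multiplicity. -/
def IsInner (f : LatticePoint → ℤ) (p : LatticePoint) : Prop :=
  f p ≠ 0 ∧ f (p.1 - 1, p.2 - 1) ≠ 0 ∧ f (p.1 - 1, p.2) ≠ 0 ∧ f (p.1, p.2 - 1) ≠ 0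

/-- With windings at most one before and non-negative after the move, the rectangle consists of
cells of winding one which become zero. A point of `V` inside it would have four surrounding cells
of winding one, hence belong to `V'` by `winding_mixed_difference` and be an inner common point,
which is excluded. -/
theorem lessCount_sub_and_invariants_of_step {V V' : Finset LatticePoint} {v w : LatticePoint}
    (hV : IsGridPair V V) (hv : v ∈ V) (hw : w ∈ V) (h1 : v.1 < w.1) (h2 : v.2 < w.2)
    (hrest : ∀ z, 0 ≤ winding (rectTransform V v w) V' z)
    (hle : ∀ z, winding V V' z ≤ 1) (hiso : ∀ u ∈ V, u ∈ V' → ¬ IsInner (winding V V') u) :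
    lessCount V V - lessCount (rectTransform V v w) (rectTransform V v w) = 1 ∧
      (∀ z, winding (rectTransform V v w) V' z ≤ 1) ∧
      ∀ u ∈ rectTransform V v w, u ∈ V' → ¬ IsInner (winding (rectTransform V v w) V') u := by
  have hvw : v ≠ w := by rintro rfl; omega
  have hwd := winding_rectTransform hV hv hw hvw V'
  have hs := fun z => signedCell_eq_ite (z := z) h1 h2
  refine ⟨lessCount_rectTransform hV hv hw h1 h2 ?_, ?_, ?_⟩
  · intro u hu hin
    have cell : ∀ z, v.1 ≤ z.1 ∧ z.1 < w.1 ∧ v.2 ≤ z.2 ∧ z.2 < w.2 → winding V V' z = 1 := by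
      intro z hz
      have a1 := hrest z
      have a2 := hle z
      rw [hwd, hs, if_pos hz] at a1
      omega
    have c1 := cell u (by omega)
    have c2 := cell (u.1 - 1, u.2 - 1) (by simp only; omega)
    have c3 := cell (u.1 - 1, u.2) (by simp only; omega)
    have c4 := cell (u.1, u.2 - 1) (by simp only; omega)
    have hm := winding_mixed_difference V V' u
    rw [c1, c2, c3, c4, if_pos hu] at hm
    refine hiso u hu ?_ ⟨?_, ?_, ?_, ?_⟩
    · by_contra hn
      rw [if_neg hn] at hm
      omega
    all_goals omega
  · intro z
    have := hle z
    rw [hwd, hs]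
    split_ifs <;> omega
  · rintro u hu hu' ⟨i1, i2, i3, i4⟩
    have mono : ∀ z, winding (rectTransform V v w) V' z ≠ 0 → winding V V' z ≠ 0 := by
      intro z hz
      have a1 := hrest z
      have a2 := hwd z
      rw [hs] at a2
      split_ifs at a2 <;> omega
    have zero : ∀ z, v.1 ≤ z.1 ∧ z.1 < w.1 ∧ v.2 ≤ z.2 ∧ z.2 < w.2 →
        winding (rectTransform V v w) V' z = 0 := by
      intro z hz
      have a1 := hrest z
      have a2 := hwd z
      have a3 := hle z
      rw [hs, if_pos hz] at a2
      omega
    rcases mem_rectTransform.1 hu with ⟨hu, -⟩ | rfl | rfl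
    -- An old point that is inner now was inner before; a new corner touches a cell of the
    -- rectangle, whose winding is now zero.
    · exact hiso u hu hu' ⟨mono _ i1, mono _ i2, mono _ i3, mono _ i4⟩
    · exact i3 (zero _ (by simp only [corner]; omega))
    · exact i4 (zero _ (by simp only [corner]; omega))

theorem length_eq_lessCount_sub {V V' : Finset LatticePoint}
    {l : List (LatticePoint × LatticePoint)} (hV : IsGridPair V V)
    (h : IsRectTransformation V l V') (hpos : ∀ e ∈ l, ∀ z, 0 ≤ signedCell e z)
    (hle : ∀ z, winding V V' z ≤ 1) (hiso : ∀ u ∈ V, u ∈ V' → ¬ IsInner (winding V V') u) :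
    (l.length : ℤ) = lessCount V V - lessCount V' V' := by
  induction l generalizing V with
  | nil => rw [show V = V' from h]; simp
  | cons e l ih =>
    obtain ⟨v, w⟩ := e
    obtain ⟨hv, hw, hvw, h⟩ := h
    have hp := (isGridPair_rectTransform hV hv hw hvw).symm.left
    have hrest : ∀ z, 0 ≤ winding (rectTransform V v w) V' z := by
      intro z
      rw [winding_eq_sum hp h]
      refine List.sum_nonneg ?_
      intro x hx
      obtain ⟨f, hf, rfl⟩ := List.mem_map.1 hx
      exact hpos f (List.mem_cons_of_mem _ hf) z
    have key : lessCount V V - lessCount (rectTransform V v w) (rectTransform V v w) = 1 ∧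
        (∀ z, winding (rectTransform V v w) V' z ≤ 1) ∧
        ∀ u ∈ rectTransform V v w, u ∈ V' → ¬ IsInner (winding (rectTransform V v w) V') u := by
      rcases lt_or_gt_of_signedCell_nonneg (fst_ne hV hv hw hvw) (snd_ne hV hv hw hvw)
        (hpos _ List.mem_cons_self) with ⟨h1, h2⟩ | ⟨h1, h2⟩
      · exact lessCount_sub_and_invariants_of_step hV hv hw h1 h2 hrest hle hiso
      · rw [← rectTransform_swap] at hrest ⊢
        exact lessCount_sub_and_invariants_of_step hV hw hv h1 h2 hrest hle hiso
    have := ih hp h (fun f hf => hpos f (List.mem_cons_of_mem _ hf)) key.2.1 key.2.2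
    rw [List.length_cons]
    push_cast
    omega

/-! The turning number of a closed path without crossings -/

/-- The discrete version of Hopf's secant argument: `s i j` and `t i j` are the signs of the
horizontal and vertical components of the secant from the `i`-th to the `j`-th vertex. -/
theorem turning_sum_eq (N : ℕ) (s t : ℕ → ℕ → ℤ) (hN : 1 ≤ N)
    (hs : ∀ i j, s j i = -s i j) (ht : ∀ i j, t j i = -t i j)
    (he : ∀ i ≤ N, ∀ j ≤ N, j + 1 ≠ i → j ≠ i →
      (s i (j + 1) - s (i + 1) (j + 1)) * (t i j - t i (j + 1)) = if i = 0 ∧ j = N then 1 else 0)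
    (hs0 : ∀ j, 0 < j → j ≤ N → s 0 j = 1) (hsn : s 0 (N + 1) = 0)
    (hsN : ∀ j, 0 < j → j ≤ N → s j (N + 1) = -1) (hs1 : s (N + 1) (N + 2) = 1)
    (ht0 : t 0 N = 1) (htn : t 0 (N + 1) = 0) (htN : t N (N + 1) = -1)
    (ht1 : t (N + 1) (N + 2) = t 0 1) :
    ∑ i ∈ Finset.range (N + 1), s (i + 1) (i + 2) * (t i (i + 1) - t (i + 1) (i + 2)) = -4 := by
  -- The sums discretize the integral of `-s dt` over paths in the triangle of index pairs `i < j`: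
  -- `stair k` follows the pairs `(i, i + 1)` up to `(k, k + 1)`, and `row i d` runs from `(i, i +
  -- 1)` to `(i, i + 1 + d)`. The total turning, `stair (N + 1)`, is moved to the two outer sides of
  -- the triangle, where `s` is constant.
  obtain ⟨stair, hstair⟩ : ∃ F : ℕ → ℤ, F = fun k => ∑ i ∈ Finset.range k,
    s (i + 1) (i + 2) * (t i (i + 1) - t (i + 1) (i + 2)) := ⟨_, rfl⟩
  obtain ⟨row, hrow⟩ : ∃ F : ℕ → ℕ → ℤ, F = fun i d => ∑ k ∈ Finset.range d,
    s i (i + 2 + k) * (t i (i + 1 + k) - t i (i + 2 + k)) := ⟨_, rfl⟩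
  have stair_succ : ∀ k, stair (k + 1) =
      stair k + s (k + 1) (k + 2) * (t k (k + 1) - t (k + 1) (k + 2)) := by
    intro k
    simp only [hstair]
    rw [Finset.sum_range_succ]
  have row_succ : ∀ i d, row i (d + 1) =
      row i d + s i (i + 2 + d) * (t i (i + 1 + d) - t i (i + 2 + d)) := by
    intro i d
    simp only [hrow]
    rw [Finset.sum_range_succ]
  have row_zero : ∀ i, row i 0 = 0 := by
    intro i
    simp [hrow]
  -- Path independence across one unit square. The defect of a square is a difference of two terms
  -- of the form in `he`: the horizontal edge of one index against the vertical edge of the other,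
  -- and with the indices exchanged.
  have path : ∀ i d, i + 1 + d ≤ N →
      stair i + row i (d + 1) + s (i + 1) (i + 2 + d) * (t i (i + 2 + d) - t (i + 1) (i + 2 + d)) =
      stair (i + 1) + row (i + 1) d + if i = 0 ∧ i + 1 + d = N then 1 else 0 := by
    intro i d
    induction d with
    | zero =>
      intro hd
      rw [← he i (by omega) (i + 1 + 0) hd (by omega) (by omega), row_succ, row_zero, row_zero,
        stair_succ]
      simp only [add_zero]
      ring
    | succ d ih =>
      intro hd
      have h0 := ih (by omega)
      rw [if_neg (by omega)] at h0
      have e1 := he i (by omega) (i + 1 + (d + 1)) hd (by omega) (by omega)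
      have e2 := he (i + 2 + d) (by omega) i (by omega) (by omega) (by omega)
      rw [if_neg (by omega)] at e2
      rw [← e1, row_succ i (d + 1), row_succ (i + 1) d]
      rw [hs (i + 1) (i + 2 + d), hs (i + 1) (i + 2 + d + 1), ht (i) (i + 2 + d),
        ht (i + 1) (i + 2 + d)] at e2
      have r1 : i + 1 + (d + 1) = i + 2 + d := by ring
      have r2 : i + 2 + (d + 1) = i + 2 + d + 1 := by ring
      have r3 : i + 1 + 2 + d = i + 2 + d + 1 := by ring
      have r4 : i + 1 + 1 + d = i + 2 + d := by ring
      rw [r1, r2, r3, r4]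
      linear_combination h0 - e2
  -- In the last column, formed by the secants to the final vertex, `s = -1` and the sum telescopes.
  have last : ∀ k, k + 1 ≤ N → stair (k + 1) + row (k + 1) (N - (k + 1)) - t (k + 1) (N + 1) =
      stair 1 + row 1 (N - 1) - t 1 (N + 1) := by
    intro k
    induction k with
    | zero => intro _; rfl
    | succ k ih =>
      intro hk
      rw [← ih (by omega)]
      obtain ⟨d, rfl⟩ : ∃ d, N = k + 1 + 1 + d := ⟨N - (k + 2), by omega⟩
      have := path (k + 1) d (by omega)
      rw [if_neg (by omega), show k + 1 + 2 + d = k + 1 + 1 + d + 1 by ring,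
        hsN (k + 1 + 1) (by omega) (by omega)] at this
      rw [show k + 1 + 1 + d - (k + 1 + 1) = d by omega,
        show k + 1 + 1 + d - (k + 1) = d + 1 by omega]
      linear_combination -this
  -- In row `0`, formed by the secants from the initial vertex, `s = 1` and the sum telescopes.
  have first : ∀ k, k + 1 ≤ N → row 0 k = t 0 1 - t 0 (k + 1) := by
    intro k
    induction k with
    | zero => intro _; rw [row_zero]; simp
    | succ k ih =>
      intro hk
      rw [row_succ, ih (by omega), hs0 _ (by omega) (by omega),
        show 0 + 1 + k = k + 1 by ring, show 0 + 2 + k = k + 1 + 1 by ring]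
      ring
  obtain ⟨M, rfl⟩ : ∃ M, N = M + 1 := ⟨N - 1, by omega⟩
  have f1 := first M le_rfl
  have f2 := row_succ 0 M
  have f3 := path 0 M (by omega)
  have f4 := last M le_rfl
  have f5 := stair_succ (M + 1)
  rw [show 0 + 2 + M = M + 1 + 1 by ring, hsn] at f2
  rw [if_pos (by omega), show 0 + 2 + M = M + 1 + 1 by ring, hsN (0 + 1) (by omega) (by omega),
    htn] at f3
  rw [hs1, htN, ht1] at f5
  rw [htN, Nat.sub_self, row_zero, Nat.add_sub_cancel] at f4
  have f6 : stair 0 = 0 := by simp [hstair]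
  rw [f6] at f3
  simp only [zero_add] at f3
  have : stair (M + 1 + 1) = -4 := by
    rw [ht0] at f1
    linarith
  rw [hstair] at this
  exact this

/-- The jump of the winding across the edge from `a` to `b`. -/
theorem IsGridPair.winding_row {A B : Finset LatticePoint} (h : IsGridPair A B)
    {a b : LatticePoint} (ha : a ∈ A) (hb : b ∈ B) (hab : a.2 = b.2) (q : ℤ) :
    winding A B (q, a.2) - winding A B (q, a.2 - 1) = step a.1 q - step b.1 q := by
  have e : ∀ {U : Finset LatticePoint} {c : LatticePoint}, IsGridPair U U → c ∈ U →
      quadrantCount U (q, c.2) - quadrantCount U (q, c.2 - 1) = step c.1 q := by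
    intro U c hU hc
    rw [quadrantCount, quadrantCount, ← Finset.sum_sub_distrib, Finset.sum_eq_single c]
    · have := step_sub_step c.2 c.2
      simp only [if_true] at this
      simp only
      linear_combination step c.1 q * this
    · intro u hu huc
      have := step_sub_step u.2 c.2
      rw [if_neg (snd_ne hU hu hc huc)] at this
      simp only
      linear_combination step u.1 q * this
    · exact fun hc' => absurd hc hc'
  have e1 := e h.left ha
  have e2 := e h.symm.left hb
  rw [← hab] at e2
  simp only [winding]
  linear_combination e1 - e2

theorem IsGridPair.winding_column {A B : Finset LatticePoint} (h : IsGridPair A B)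
    {a b : LatticePoint} (ha : a ∈ A) (hb : b ∈ B) (hab : a.1 = b.1) (q : ℤ) :
    winding A B (a.1, q) - winding A B (a.1 - 1, q) = step a.2 q - step b.2 q := by
  have e : ∀ {U : Finset LatticePoint} {c : LatticePoint}, IsGridPair U U → c ∈ U →
      quadrantCount U (c.1, q) - quadrantCount U (c.1 - 1, q) = step c.2 q := by
    intro U c hU hc
    rw [quadrantCount, quadrantCount, ← Finset.sum_sub_distrib, Finset.sum_eq_single c]
    · have := step_sub_step c.1 c.1
      simp only [if_true] at this
      simp only
      linear_combination step c.2 q * this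
    · intro u hu huc
      have := step_sub_step u.1 c.1
      rw [if_neg (fst_ne hU hu hc huc)] at this
      simp only
      linear_combination step u.2 q * this
    · exact fun hc' => absurd hc hc'
  have e1 := e h.left ha
  have e2 := e h.symm.left hb
  rw [← hab] at e2
  simp only [winding]
  linear_combination e1 - e2

theorem sign_sub_eq {a q : ℤ} (h : a ≠ q) : Int.sign (q - a) = 2 * step a q - 1 := by
  rcases lt_or_gt_of_ne h with h | h
  · rw [Int.sign_eq_one_of_pos (by omega), step, if_pos h.le]; rfl
  · rw [Int.sign_eq_neg_one_of_neg (by omega), step, if_neg (by omega)]; rfl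

/-- Edges do not cross if the windings take the values `0` and `1` only. -/
theorem IsGridPair.no_crossing {A B : Finset LatticePoint} (h : IsGridPair A B)
    (hw : ∀ z, winding A B z = 0 ∨ winding A B z = 1) {a b a' b' : LatticePoint}
    (ha : a ∈ A) (hb : b ∈ B) (hab : a.2 = b.2) (ha' : a' ∈ A) (hb' : b' ∈ B)
    (hab' : a'.1 = b'.1) (n1 : a.1 ≠ a'.1) (n2 : b.1 ≠ a'.1) :
    (step a.1 a'.1 - step b.1 a'.1) * (step a'.2 a.2 - step b'.2 a.2) = 0 := by
  have r1 := h.winding_row ha hb hab a'.1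
  have r2 := h.winding_row ha hb hab (a'.1 - 1)
  have c1 := h.winding_column ha' hb' hab' a.2
  have c2 := h.winding_column ha' hb' hab' (a.2 - 1)
  have s1 := step_sub_step a.1 a'.1
  have s2 := step_sub_step b.1 a'.1
  have w1 := hw (a'.1, a.2)
  have w2 := hw (a'.1 - 1, a.2)
  have w3 := hw (a'.1, a.2 - 1)
  have w4 := hw (a'.1 - 1, a.2 - 1)
  rw [if_neg n1] at s1
  rw [if_neg n2] at s2
  -- At a crossing the four surrounding windings would be of the form `k - 1, k, k, k + 1`, three
  -- different values.
  rw [mul_eq_zero]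
  by_contra hne
  push Not at hne
  omega

/-- At a vertex in `A` the mixed difference of the winding is `1`. A convex corner has one diagonal
cell in the domain and a reflex corner has both, so the sum is `1` or `2`; the product of signs is
`-1` in the first case and `1` in the second. -/
theorem IsGridPair.two_mul_diagonalSum_left {A B : Finset LatticePoint} (h : IsGridPair A B)
    (hw : ∀ z, winding A B z = 0 ∨ winding A B z = 1) {a b b' : LatticePoint}
    (ha : a ∈ A) (hb : b ∈ B) (hab : a.2 = b.2) (hb' : b' ∈ B) (hab' : a.1 = b'.1)
    (n1 : b.1 ≠ a.1) (n2 : b'.2 ≠ a.2) :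
    2 * diagonalSum (winding A B) a = 3 + Int.sign (a.2 - b'.2) * Int.sign (b.1 - a.1) := by
  have r1 := h.winding_row ha hb hab a.1
  have r2 := h.winding_row ha hb hab (a.1 - 1)
  have c1 := h.winding_column ha hb' hab' a.2
  have c2 := h.winding_column ha hb' hab' (a.2 - 1)
  have w1 := hw (a.1, a.2)
  have w2 := hw (a.1 - 1, a.2)
  have w3 := hw (a.1, a.2 - 1)
  have w4 := hw (a.1 - 1, a.2 - 1)
  simp only [step_sub_one] at r2 c2
  have d : diagonalSum (winding A B) a = winding A B (a.1, a.2) + winding A B (a.1 - 1, a.2 - 1) :=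
    rfl
  rw [d]
  rcases lt_or_gt_of_ne n1 with n1 | n1 <;> rcases lt_or_gt_of_ne n2 with n2 | n2
  · rw [Int.sign_eq_one_of_pos (by omega), Int.sign_eq_neg_one_of_neg (by omega)]
    simp only [step] at r1 r2 c1 c2
    split_ifs at r1 r2 c1 c2 <;> omega
  · rw [Int.sign_eq_neg_one_of_neg (by omega), Int.sign_eq_neg_one_of_neg (by omega)]
    simp only [step] at r1 r2 c1 c2
    split_ifs at r1 r2 c1 c2 <;> omega
  · rw [Int.sign_eq_one_of_pos (by omega), Int.sign_eq_one_of_pos (by omega)]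
    simp only [step] at r1 r2 c1 c2
    split_ifs at r1 r2 c1 c2 <;> omega
  · rw [Int.sign_eq_neg_one_of_neg (by omega), Int.sign_eq_one_of_pos (by omega)]
    simp only [step] at r1 r2 c1 c2
    split_ifs at r1 r2 c1 c2 <;> omega

/-- At a vertex in `B` the mixed difference is `-1`, so the diagonal sum is `0` at convex and `1` at
reflex corners. -/
theorem IsGridPair.two_mul_diagonalSum_right {A B : Finset LatticePoint} (h : IsGridPair A B)
    (hw : ∀ z, winding A B z = 0 ∨ winding A B z = 1) {a a' b : LatticePoint}
    (hb : b ∈ B) (ha : a ∈ A) (hab : a.2 = b.2) (ha' : a' ∈ A) (hab' : a'.1 = b.1)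
    (n1 : a.1 ≠ b.1) (n2 : a'.2 ≠ b.2) :
    2 * diagonalSum (winding A B) b = 1 - Int.sign (b.1 - a.1) * Int.sign (a'.2 - b.2) := by
  have r1 := h.winding_row ha hb hab b.1
  have r2 := h.winding_row ha hb hab (b.1 - 1)
  have c1 := h.winding_column ha' hb hab' b.2
  have c2 := h.winding_column ha' hb hab' (b.2 - 1)
  rw [hab] at r1 r2
  rw [hab'] at c1 c2
  have w1 := hw (b.1, b.2)
  have w2 := hw (b.1 - 1, b.2)
  have w3 := hw (b.1, b.2 - 1)
  have w4 := hw (b.1 - 1, b.2 - 1)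
  simp only [step_sub_one] at r2 c2
  have d : diagonalSum (winding A B) b = winding A B (b.1, b.2) + winding A B (b.1 - 1, b.2 - 1) :=
    rfl
  rw [d]
  rcases lt_or_gt_of_ne n1 with n1 | n1 <;> rcases lt_or_gt_of_ne n2 with n2 | n2
  · rw [Int.sign_eq_one_of_pos (by omega), Int.sign_eq_neg_one_of_neg (by omega)]
    simp only [step] at r1 r2 c1 c2
    split_ifs at r1 r2 c1 c2 <;> omega
  · rw [Int.sign_eq_one_of_pos (by omega), Int.sign_eq_one_of_pos (by omega)]
    simp only [step] at r1 r2 c1 c2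
    split_ifs at r1 r2 c1 c2 <;> omega
  · rw [Int.sign_eq_neg_one_of_neg (by omega), Int.sign_eq_neg_one_of_neg (by omega)]
    simp only [step] at r1 r2 c1 c2
    split_ifs at r1 r2 c1 c2 <;> omega
  · rw [Int.sign_eq_neg_one_of_neg (by omega), Int.sign_eq_one_of_pos (by omega)]
    simp only [step] at r1 r2 c1 c2
    split_ifs at r1 r2 c1 c2 <;> omega

/-! The diagonal sum of a connected polytope without isolated vertices -/

/-- The oriented edges between disjoint sets `A` and `B`. -/
def EdgeRel (A B : Finset LatticePoint) (u v : LatticePoint) : Prop :=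
  (u ∈ A ∧ v ∈ B ∧ u.2 = v.2) ∨ (u ∈ B ∧ v ∈ A ∧ u.1 = v.1)

/-- The vertices in `A`, numbered along the boundary. -/
theorem exists_cyclic_numbering {A B : Finset LatticePoint} (h : IsGridPair A B)
    (hd : Disjoint A B)
    (hc : ∀ u ∈ A, ∀ v ∈ A, Relation.ReflTransGen (EdgeRel A B) u v) {a₀ : LatticePoint}
    (h₀ : a₀ ∈ A) :
    ∃ a : ℕ → LatticePoint, a 0 = a₀ ∧ (∀ i, a i ∈ A) ∧ (∀ i, ((a (i + 1)).1, (a i).2) ∈ B) ∧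
      (∀ i, a (i + A.card) = a i) ∧ A = (Finset.range A.card).image a := by
  have ex : ∀ u : {u // u ∈ A}, ∃ v : {u // u ∈ A}, (v.1.1, u.1.2) ∈ B := by
    intro u
    obtain ⟨b, hb, e1⟩ := h.exists_snd u.2
    obtain ⟨v, hv, e2⟩ := h.symm.exists_fst hb
    exact ⟨⟨v, hv⟩, by rw [← e1, e2]; exact hb⟩
  choose f hf using ex
  have inj : Function.Injective f := by
    intro u v huv
    have e := h.symm.eq_of_fst (hf u) (hf v) (by rw [huv])
    exact Subtype.ext (h.eq_of_snd u.2 v.2 (congrArg Prod.snd e : _))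
  let σ : Equiv.Perm {u // u ∈ A} := Equiv.ofBijective f (Finite.injective_iff_bijective.1 inj)
  have hσ : ∀ u, σ u = f u := fun _ => rfl
  have reach : ∀ u : LatticePoint, Relation.ReflTransGen (EdgeRel A B) a₀ u →
      ∃ k : ℕ, u = ((σ ^ k) ⟨a₀, h₀⟩).1 ∨
        u = (((σ ^ (k + 1)) ⟨a₀, h₀⟩).1.1, ((σ ^ k) ⟨a₀, h₀⟩).1.2) := by
    intro u hu
    induction hu with
    | refl => exact ⟨0, Or.inl rfl⟩
    | tail _ hr ih =>
      rename_i x y _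
      obtain ⟨k, hk⟩ := ih
      have hB : (((σ ^ (k + 1)) ⟨a₀, h₀⟩).1.1, ((σ ^ k) ⟨a₀, h₀⟩).1.2) ∈ B := by
        rw [pow_succ', Equiv.Perm.mul_apply, hσ]
        exact hf _
      rcases hr with ⟨hx, hy, e⟩ | ⟨hx, hy, e⟩
      · rcases hk with hk | hk
        · exact ⟨k, Or.inr (h.symm.eq_of_snd hy hB (by rw [← e, hk]))⟩
        · exact absurd (hk ▸ hB : x ∈ B) (Finset.disjoint_left.1 hd hx)
      · rcases hk with hk | hk
        · exact absurd hx (Finset.disjoint_left.1 hd (hk ▸ ((σ ^ k) ⟨a₀, h₀⟩).2))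
        · exact ⟨k + 1, Or.inl (h.eq_of_fst hy ((σ ^ (k + 1)) ⟨a₀, h₀⟩).2 (by rw [← e, hk]))⟩
  have hreach : ∀ u : {u // u ∈ A}, ∃ k : ℕ, (σ ^ k) ⟨a₀, h₀⟩ = u := by
    intro u
    obtain ⟨k, hk | hk⟩ := reach u.1 (hc a₀ h₀ u.1 u.2)
    · exact ⟨k, Subtype.ext hk.symm⟩
    · refine absurd ?_ (Finset.disjoint_left.1 hd u.2)
      rw [hk, pow_succ', Equiv.Perm.mul_apply, hσ]
      exact hf _
  have hcyc : σ.IsCycleOn ((Finset.univ : Finset {u // u ∈ A}) : Set {u // u ∈ A}) := by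
    refine ⟨by simpa using Set.bijOn_univ.2 σ.bijective, ?_⟩
    have : ∀ u, σ.SameCycle ⟨a₀, h₀⟩ u := by
      intro u
      obtain ⟨k, hk⟩ := hreach u
      exact ⟨k, by simpa using hk⟩
    exact fun u _ v _ => (this u).symm.trans (this v)
  have hcard : (Finset.univ : Finset {u // u ∈ A}).card = A.card := by simp
  refine ⟨fun k => ((σ ^ k) ⟨a₀, h₀⟩).1, rfl, fun i => ((σ ^ i) ⟨a₀, h₀⟩).2, fun i => ?_,
    fun i => ?_, ?_⟩
  · simp only
    rw [pow_succ', Equiv.Perm.mul_apply, hσ]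
    exact hf _
  · have := hcyc.pow_card_apply (Finset.mem_univ ⟨a₀, h₀⟩)
    rw [hcard] at this
    simp only
    rw [pow_add, Equiv.Perm.mul_apply, this]
  · ext u
    rw [Finset.mem_image]
    constructor
    · intro hu
      obtain ⟨k, hk, e⟩ := hcyc.exists_pow_eq (Finset.mem_univ ⟨a₀, h₀⟩) (Finset.mem_univ ⟨u, hu⟩)
      exact ⟨k, by rwa [hcard, ← Finset.mem_range] at hk, by rw [e]⟩
    · rintro ⟨k, -, rfl⟩
      exact ((σ ^ k) ⟨a₀, h₀⟩).2

/-- The corner values in `A` and `B` turn the sum into `A.card` plus the number of reflex corners,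
and the turning number determines the latter. The numbering begins at a leftmost vertex, so that all
secants from it point to the right, as Hopf's argument requires. -/
theorem diagonalSum_eq_of_connected {A B : Finset LatticePoint} (h : IsGridPair A B)
    (hd : Disjoint A B) (hne : A.Nonempty)
    (hc : ∀ u ∈ A, ∀ v ∈ A, Relation.ReflTransGen (EdgeRel A B) u v)
    (hw : ∀ z, winding A B z = 0 ∨ winding A B z = 1) :
    ∑ p ∈ A, diagonalSum (winding A B) p + ∑ p ∈ B, diagonalSum (winding A B) p =
      2 * ((A.card : ℤ) - 1) := by
  have hAB : A ≠ B := by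
    rintro rfl
    exact hne.ne_empty (disjoint_self.1 hd)
  obtain ⟨a₀, h₀, b₀, hb₀, hb1, hb2, -, l1, l2⟩ :=
    exists_leftmost h (fun z => by rcases hw z with e | e <;> omega) hAB
  obtain ⟨a, ha0, haA, haB, hper, himg⟩ := exists_cyclic_numbering h hd hc h₀
  obtain ⟨n, hn⟩ : ∃ n, n = A.card := ⟨_, rfl⟩
  rw [← hn] at hper himg ⊢
  have hinj : Set.InjOn a (Finset.range n : Set ℕ) := by
    rw [← Finset.card_image_iff, ← himg, Finset.card_range, hn]
  have hinj' : ∀ i < n, ∀ j < n, a i = a j → i = j := fun i hi j hj e =>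
    hinj (by simpa using hi) (by simpa using hj) e
  have an : a n = a 0 := by simpa using hper 0
  have an1 : a (n + 1) = a 1 := by simpa [add_comm] using hper 1
  have hx : ∀ i < n, ∀ j < n, i ≠ j → (a i).1 ≠ (a j).1 := fun i hi j hj hij e =>
    hij (hinj' i hi j hj (h.eq_of_fst (haA i) (haA j) e))
  have hy : ∀ i < n, ∀ j < n, i ≠ j → (a i).2 ≠ (a j).2 := fun i hi j hj hij e =>
    hij (hinj' i hi j hj (h.eq_of_snd (haA i) (haA j) e))
  have hsucc : ∀ i, a (i + 1) ≠ a i := by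
    intro i e
    have := haB i
    rw [e] at this
    exact Finset.disjoint_left.1 hd (haA i) this
  have hx1 : ∀ i, (a (i + 1)).1 ≠ (a i).1 := fun i e =>
    hsucc i (h.eq_of_fst (haA _) (haA _) e)
  have hy1 : ∀ i, (a (i + 1)).2 ≠ (a i).2 := fun i e =>
    hsucc i (h.eq_of_snd (haA _) (haA _) e)
  have hn2 : 2 ≤ n := by
    have : 0 < n := by rw [hn]; exact hne.card_pos
    have : n ≠ 1 := fun e => hsucc 0 (by rw [← an, e])
    omega
  have hmin : ∀ j, 0 < j → j < n → (a 0).1 < (a j).1 := by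
    intro j hj hjn
    rcases lt_or_ge (a j).1 (a 0).1 with hlt | hge
    · rw [ha0] at hlt
      exact absurd (l1 _ (haA j) hlt) (Finset.disjoint_left.1 hd (haA j))
    · exact lt_of_le_of_ne hge (hx 0 (by omega) j hjn (by omega))
  obtain ⟨N, rfl⟩ : ∃ N, n = N + 1 := ⟨n - 1, by omega⟩
  have hbN : b₀ = ((a (N + 1)).1, (a N).2) :=
    h.symm.eq_of_fst hb₀ (haB N) (by rw [hb1, an, ha0])
  have hyN : (a 0).2 < (a N).2 := by
    rw [hbN] at hb2
    rwa [ha0]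
  have turn := turning_sum_eq N (fun i j => Int.sign ((a j).1 - (a i).1))
    (fun i j => Int.sign ((a j).2 - (a i).2)) (by omega)
    (fun i j => by rw [← Int.sign_neg, neg_sub]) (fun i j => by rw [← Int.sign_neg, neg_sub])
    (by
      intro i hi j hj h1 h2
      split_ifs with h3
      -- The exceptional pair: vertical edge `N` ends where horizontal edge `0` begins, at `a 0`.
      -- For every other admissible pair `no_crossing` applies.
      · obtain ⟨rfl, rfl⟩ := h3
        simp only [an, sub_self]
        have := hmin 1 (by omega) (by omega)
        rw [Int.sign_eq_neg_one_of_neg (a := (a 0).1 - (a (0 + 1)).1)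
            (by simp only [zero_add]; omega),
          Int.sign_eq_one_of_pos (a := (a j).2 - (a 0).2) (by omega)]
        rfl
      · have m1 : (a i).1 ≠ (a (j + 1)).1 := by
          rcases Nat.lt_or_ge j N with hj' | hj'
          · exact hx i (by omega) (j + 1) (by omega) (by omega)
          · obtain rfl : j = N := by omega
            rw [an]
            exact hx i (by omega) 0 (by omega) (by omega)
        have m2 : (a (i + 1)).1 ≠ (a (j + 1)).1 := by
          rcases Nat.lt_or_ge j N with hj' | hj'
          · rcases Nat.lt_or_ge i N with hi' | hi'
            · exact hx _ (by omega) (j + 1) (by omega) (by omega)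
            · obtain rfl : i = N := by omega
              rw [an]
              exact hx 0 (by omega) (j + 1) (by omega) (by omega)
          · obtain rfl : j = N := by omega
            rw [an]
            exact hx (i + 1) (by omega) 0 (by omega) (by omega)
        have m3 : (a i).2 ≠ (a j).2 := hy i (by omega) j (by omega) (by omega)
        have m4 : (a i).2 ≠ (a (j + 1)).2 := by
          rcases Nat.lt_or_ge j N with hj' | hj'
          · exact hy i (by omega) (j + 1) (by omega) (by omega)
          · obtain rfl : j = N := by omega
            rw [an]
            exact hy i (by omega) 0 (by omega) (by omega)
        have := h.no_crossing hw (haA i) (haB i) rfl (haA (j + 1)) (haB j) rfl m1 m2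
        simp only at this ⊢
        rw [sign_sub_eq m1, sign_sub_eq m2, ← neg_sub (a i).2 (a j).2,
          ← neg_sub (a i).2 (a (j + 1)).2, Int.sign_neg, Int.sign_neg, sign_sub_eq m3.symm,
          sign_sub_eq m4.symm]
        linear_combination 4 * this)
    (fun j hj hjN => Int.sign_eq_one_of_pos (sub_pos.2 (hmin j hj (by omega))))
    (by simp only [an, sub_self, Int.sign_zero])
    (fun j hj hjN => by
      simp only [an]
      exact Int.sign_eq_neg_one_of_neg (sub_neg.2 (hmin j hj (by omega))))
    (by
      simp only [an, an1]
      exact Int.sign_eq_one_of_pos (sub_pos.2 (hmin 1 (by omega) (by omega))))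
    (Int.sign_eq_one_of_pos (sub_pos.2 hyN))
    (by simp only [an, sub_self, Int.sign_zero])
    (by
      simp only [an]
      exact Int.sign_eq_neg_one_of_neg (sub_neg.2 hyN))
    (by simp only [an, an1])
  have sumA : ∑ p ∈ A, diagonalSum (winding A B) p =
      ∑ i ∈ Finset.range (N + 1), diagonalSum (winding A B) (a (i + 1)) := by
    have reindex : ∀ g : LatticePoint → ℤ,
        ∑ p ∈ A, g p = ∑ i ∈ Finset.range (N + 1), g (a i) := by
      intro g
      rw [himg, Finset.sum_image hinj]
    rw [reindex, Finset.sum_range_succ' (fun i => diagonalSum (winding A B) (a i)),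
      Finset.sum_range_succ, an]
  have sumB : ∑ p ∈ B, diagonalSum (winding A B) p =
      ∑ i ∈ Finset.range (N + 1), diagonalSum (winding A B) ((a (i + 1)).1, (a i).2) := by
    have injB : Set.InjOn (fun i => ((a (i + 1)).1, (a i).2)) (Finset.range (N + 1) : Set ℕ) := by
      intro i hi j hj e
      exact hinj hi hj (h.eq_of_snd (haA i) (haA j) (congrArg Prod.snd e : _))
    have : (Finset.range (N + 1)).image (fun i => ((a (i + 1)).1, (a i).2)) = B := by
      refine Finset.eq_of_subset_of_card_le ?_ ?_
      · intro b hb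
        obtain ⟨i, -, rfl⟩ := Finset.mem_image.1 hb
        exact haB i
      · rw [Finset.card_image_of_injOn injB, Finset.card_range, hn, h.card_eq]
    rw [← Finset.sum_image (f := diagonalSum (winding A B)) injB, this]
  have dA : ∀ i, 2 * diagonalSum (winding A B) (a (i + 1)) =
      3 + Int.sign ((a (i + 1)).2 - (a i).2) * Int.sign ((a (i + 2)).1 - (a (i + 1)).1) :=
    fun i => h.two_mul_diagonalSum_left (b := ((a (i + 2)).1, (a (i + 1)).2))
      (b' := ((a (i + 1)).1, (a i).2)) hw (haA (i + 1)) (haB (i + 1)) rfl (haB i) rfl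
      (hx1 (i + 1)) (hy1 i).symm
  have dB : ∀ i, 2 * diagonalSum (winding A B) ((a (i + 1)).1, (a i).2) =
      1 - Int.sign ((a (i + 1)).1 - (a i).1) * Int.sign ((a (i + 1)).2 - (a i).2) :=
    fun i => h.two_mul_diagonalSum_right hw (haB i) (haA i) rfl (haA (i + 1)) rfl
      (hx1 i).symm (hy1 i)
  have shift : ∑ i ∈ Finset.range (N + 1),
        Int.sign ((a (i + 1)).1 - (a i).1) * Int.sign ((a (i + 1)).2 - (a i).2) =
      ∑ i ∈ Finset.range (N + 1),
        Int.sign ((a (i + 2)).1 - (a (i + 1)).1) * Int.sign ((a (i + 2)).2 - (a (i + 1)).2) := by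
    rw [Finset.sum_range_succ', Finset.sum_range_succ _ N, an, an1]
  -- The constants `3` and `1` of the two corner formulas add up to `4` per index. After the cyclic
  -- shift of the `B` terms, the sign products form the turning sum, which is `-4`.
  have e1 : 2 * (∑ p ∈ A, diagonalSum (winding A B) p + ∑ p ∈ B, diagonalSum (winding A B) p) =
      4 * ((N + 1 : ℕ) : ℤ) + ∑ i ∈ Finset.range (N + 1),
        Int.sign ((a (i + 2)).1 - (a (i + 1)).1) * (Int.sign ((a (i + 1)).2 - (a i).2) -
          Int.sign ((a (i + 2)).2 - (a (i + 1)).2)) := by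
    rw [sumA, sumB, mul_add, Finset.mul_sum, Finset.mul_sum]
    simp only [dA, dB, mul_sub, Finset.sum_add_distrib, Finset.sum_sub_distrib, shift,
      Finset.sum_const, Finset.card_range, nsmul_eq_mul]
    simp only [mul_comm (Int.sign ((a (_ + 1)).2 - (a _).2))]
    ring
  rw [turn] at e1
  linarith

/-! Positive polygons -/

/-- A polytope with a single closed oriented path as boundary and windings `0` and `1`. -/
structure IsPositivePolygon (V V' : Finset LatticePoint) : Prop where
  pair : IsGridPair V V'
  nonempty : (V \ V').Nonempty
  connected : ∀ u ∈ V \ V', ∀ v ∈ V \ V',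
    Relation.ReflTransGen (EdgeRel (V \ V') (V' \ V)) u v
  winding_eq : ∀ z, winding V V' z = 0 ∨ winding V V' z = 1

theorem IsGridPair.sdiff {V V' : Finset LatticePoint} (h : IsGridPair V V') :
    IsGridPair (V \ V') (V' \ V) := by
  have key1 : ∀ {U U' : Finset LatticePoint}, IsGridPair U U' →
      (U \ U').image Prod.fst ⊆ (U' \ U).image Prod.fst := by
    intro U U' h x hx
    obtain ⟨u, hu, rfl⟩ := Finset.mem_image.1 hx
    obtain ⟨hu, hu'⟩ := Finset.mem_sdiff.1 hu
    obtain ⟨b, hb, e⟩ := h.exists_fst hu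
    refine Finset.mem_image.2 ⟨b, Finset.mem_sdiff.2 ⟨hb, fun hbU => hu' ?_⟩, e⟩
    rwa [← h.eq_of_fst hbU hu e]
  have key2 : ∀ {U U' : Finset LatticePoint}, IsGridPair U U' →
      (U \ U').image Prod.snd ⊆ (U' \ U).image Prod.snd := by
    intro U U' h x hx
    obtain ⟨u, hu, rfl⟩ := Finset.mem_image.1 hx
    obtain ⟨hu, hu'⟩ := Finset.mem_sdiff.1 hu
    obtain ⟨b, hb, e⟩ := h.exists_snd hu
    refine Finset.mem_image.2 ⟨b, Finset.mem_sdiff.2 ⟨hb, fun hbU => hu' ?_⟩, e⟩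
    rwa [← h.eq_of_snd hbU hu e]
  have s0 : ((V \ V' : Finset LatticePoint) : Set LatticePoint) ⊆ V := by simp
  have s1 : ((V' \ V : Finset LatticePoint) : Set LatticePoint) ⊆ V' := by simp
  exact ⟨h.1.mono s0, h.2.mono s1, h.3.mono s0, h.4.mono s1,
    (key1 h).antisymm (key1 h.symm), (key2 h).antisymm (key2 h.symm)⟩

theorem sum_sub_sum_sdiff (V V' : Finset LatticePoint) (g : LatticePoint → ℤ) :
    ∑ u ∈ V \ V', g u - ∑ u ∈ V' \ V, g u = ∑ u ∈ V, g u - ∑ u ∈ V', g u := by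
  have e1 := Finset.sum_inter_add_sum_sdiff V V' g
  have e2 := Finset.sum_inter_add_sum_sdiff V' V g
  rw [Finset.inter_comm] at e2
  linarith

theorem winding_sdiff (V V' : Finset LatticePoint) : winding (V \ V') (V' \ V) = winding V V' :=
  funext fun _ => sum_sub_sum_sdiff V V' _

namespace IsPositivePolygon

variable {V V' : Finset LatticePoint}

theorem diagonalSum_sdiff (h : IsPositivePolygon V V') :
    ∑ p ∈ V \ V', diagonalSum (winding V V') p + ∑ p ∈ V' \ V, diagonalSum (winding V V') p =
      2 * (((V \ V').card : ℤ) - 1) := by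
  have := diagonalSum_eq_of_connected h.pair.sdiff disjoint_sdiff_sdiff h.nonempty h.connected
    (by rw [winding_sdiff]; exact h.winding_eq)
  rwa [winding_sdiff] at this

theorem lessCount_sub (h : IsPositivePolygon V V')
    (hiso : ∀ u ∈ V, u ∈ V' → diagonalSum (winding V V') u = 0) :
    lessCount V V - lessCount V' V' = ((V \ V').card : ℤ) - 1 := by
  have e1 := h.pair.two_mul_lessCount_sub
  have e2 := h.diagonalSum_sdiff
  have e3 := Finset.sum_inter_add_sum_sdiff V V' (diagonalSum (winding V V'))
  have e4 := Finset.sum_inter_add_sum_sdiff V' V (diagonalSum (winding V V'))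
  rw [Finset.inter_comm] at e4
  have e5 : ∑ p ∈ V ∩ V', diagonalSum (winding V V') p = 0 :=
    Finset.sum_eq_zero fun u hu =>
      hiso u (Finset.mem_inter.1 hu).1 (Finset.mem_inter.1 hu).2
  linarith

theorem length_add_one (h : IsPositivePolygon V V') {l : List (LatticePoint × LatticePoint)}
    (hl : IsRectTransformation V l V') (hpos : ∀ e ∈ l, ∀ z, 0 ≤ signedCell e z)
    (hiso : ∀ u ∈ V, u ∈ V' →
      winding V V' u = 0 ∧ winding V V' (u.1 - 1, u.2 - 1) = 0) :
    l.length + 1 = (V \ V').card := by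
  have e1 := length_eq_lessCount_sub h.pair.left hl hpos
    (fun z => by rcases h.winding_eq z with e | e <;> omega)
    (fun u hu hu' hin => hin.1 (hiso u hu hu').1)
  have e2 := h.lessCount_sub fun u hu hu' => by
    rw [diagonalSum, (hiso u hu hu').1, (hiso u hu hu').2, add_zero]
  omega

/-- Isolated vertices may lie in the face and would then increase the number of rectangles if they
took part. The transformation is constructed without them, and they are added back unchanged. -/
theorem exists_transformation (h : IsPositivePolygon V V') :
    ∃ l, l.length + 1 = (V \ V').card ∧ IsRectTransformation V l V' ∧
      ∀ e ∈ l, ∀ z, 0 ≤ signedCell e z := by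
  have hp := h.pair.sdiff
  have h' : IsPositivePolygon (V \ V') (V' \ V) := by
    have e1 : (V \ V') \ (V' \ V) = V \ V' := disjoint_sdiff_sdiff.sdiff_eq_left
    have e2 : (V' \ V) \ (V \ V') = V' \ V := disjoint_sdiff_sdiff.sdiff_eq_left
    refine ⟨hp, ?_, ?_, ?_⟩
    · rw [e1]; exact h.nonempty
    · rw [e1, e2]; exact h.connected
    · rw [winding_sdiff]; exact h.winding_eq
  obtain ⟨l, hl, hpos⟩ := exists_positive_transformation hp fun z => by
    rcases h'.winding_eq z with e | e <;> omega
  have hlen := h'.length_add_one hl hpos fun u hu hu' =>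
    absurd hu' (Finset.disjoint_left.1 disjoint_sdiff_sdiff hu)
  refine ⟨l, ?_, ?_, hpos⟩
  · rw [hlen, disjoint_sdiff_sdiff.sdiff_eq_left]
  · have := isRectTransformation_union (S := V ∩ V') hp.left ?_ hl
    · rwa [Finset.sdiff_union_inter, Finset.inter_comm, Finset.sdiff_union_inter] at this
    · intro u hu hx
      obtain ⟨v, hv, e⟩ := Finset.mem_image.1 hx
      obtain ⟨hu, hu'⟩ := Finset.mem_inter.1 hu
      obtain ⟨hv, hv'⟩ := Finset.mem_sdiff.1 hv
      rw [h.pair.eq_of_fst hv hu e] at hv'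
      exact hv' hu'

end IsPositivePolygon

/-! ### Cover counts, and polygons of either orientation. -/

/-- The number of rectangles in the list which contain the cell `z`. -/
def coverCount (l : List (LatticePoint × LatticePoint)) (z : LatticePoint) : ℤ :=
  (l.map (fun e => |signedCell e z|)).sum

theorem coverCount_cons (e : LatticePoint × LatticePoint) (l : List (LatticePoint × LatticePoint))
    (z : LatticePoint) : coverCount (e :: l) z = |signedCell e z| + coverCount l z := by
  rw [coverCount, List.map_cons, List.sum_cons, coverCount]

theorem coverCount_nonneg (l : List (LatticePoint × LatticePoint)) (z : LatticePoint) :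
    0 ≤ coverCount l z := by
  refine List.sum_nonneg fun x hx => ?_
  obtain ⟨e, -, rfl⟩ := List.mem_map.1 hx
  exact abs_nonneg _

theorem abs_signedCell_le_coverCount {l : List (LatticePoint × LatticePoint)}
    {e : LatticePoint × LatticePoint} (he : e ∈ l) (z : LatticePoint) :
    |signedCell e z| ≤ coverCount l z := by
  refine List.single_le_sum (fun x hx => ?_) _ (List.mem_map.2 ⟨e, he, rfl⟩)
  obtain ⟨e, -, rfl⟩ := List.mem_map.1 hx
  exact abs_nonneg _

theorem coverCount_eq_sum_of_nonneg {l : List (LatticePoint × LatticePoint)}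
    (h : ∀ e ∈ l, ∀ z, 0 ≤ signedCell e z) (z : LatticePoint) :
    coverCount l z = (l.map (fun e => signedCell e z)).sum := by
  rw [coverCount]
  congr 1
  exact List.map_congr_left fun e he => abs_of_nonneg (h e he z)

theorem coverCount_reverse (l : List (LatticePoint × LatticePoint)) (z : LatticePoint) :
    coverCount (l.reverse.map otherDiagonal) z = coverCount l z := by
  rw [coverCount, List.map_map]
  simp only [Function.comp_def, signedCell_otherDiagonal, abs_neg]
  rw [List.map_reverse, List.sum_reverse, coverCount]

/-- Equality in the triangle inequality: a domain covered without cancellation uses rectangles of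
one sign only, so the count for positive rectangles applies. -/
theorem nonneg_of_coverCount_eq_sum {l : List (LatticePoint × LatticePoint)} {z : LatticePoint}
    (h : coverCount l z = (l.map (fun e => signedCell e z)).sum) :
    ∀ e ∈ l, 0 ≤ signedCell e z := by
  induction l with
  | nil => simp
  | cons f l ih =>
    have hle : (l.map (fun e => signedCell e z)).sum ≤ coverCount l z :=
      List.sum_le_sum fun e _ => le_abs_self _
    rw [coverCount_cons, List.map_cons, List.sum_cons] at h
    have := le_abs_self (signedCell f z)
    intro e he
    rcases List.mem_cons.1 he with rfl | he
    · exact abs_eq_self.1 (by omega)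
    · exact ih (by omega) e he

/-- A polytope with a single closed oriented path as boundary, with windings all of one sign. -/
def IsPolygon (V V' : Finset LatticePoint) : Prop :=
  IsPositivePolygon V V' ∨ IsPositivePolygon V' V

theorem winding_symm (V V' : Finset LatticePoint) (z : LatticePoint) :
    winding V' V z = -winding V V' z := by
  rw [winding, winding]
  ring

namespace IsPolygon

variable {V V' : Finset LatticePoint}

theorem pair (h : IsPolygon V V') : IsGridPair V V' := by
  rcases h with h | h
  exacts [h.pair, h.pair.symm]

theorem card_sdiff_comm (h : IsGridPair V V') : (V' \ V).card = (V \ V').card :=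
  h.symm.sdiff.card_eq

theorem exists_transformation (h : IsPolygon V V') :
    ∃ l, l.length + 1 = (V \ V').card ∧ IsRectTransformation V l V' ∧
      ∀ z, coverCount l z = |winding V V' z| := by
  rcases h with h | h
  · obtain ⟨l, h1, h2, h3⟩ := h.exists_transformation
    refine ⟨l, h1, h2, fun z => ?_⟩
    rw [coverCount_eq_sum_of_nonneg h3, ← winding_eq_sum h.pair.left h2, abs_of_nonneg]
    rcases h.winding_eq z with e | e <;> omega
  · obtain ⟨l, h1, h2, h3⟩ := h.exists_transformation
    refine ⟨l.reverse.map otherDiagonal, ?_, isRectTransformation_reverse h.pair.left h2,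
      fun z => ?_⟩
    · rw [List.length_map, List.length_reverse, h1, card_sdiff_comm h.pair.symm]
    · rw [coverCount_reverse, coverCount_eq_sum_of_nonneg h3, ← winding_eq_sum h.pair.left h2,
        winding_symm V' V, abs_neg, abs_of_nonneg]
      rcases h.winding_eq z with e | e <;> omega

theorem length_add_one (h : IsPolygon V V') {l : List (LatticePoint × LatticePoint)}
    (hl : IsRectTransformation V l V') (hcov : ∀ z, coverCount l z = |winding V V' z|)
    (hiso : ∀ u ∈ V, u ∈ V' →
      winding V V' u = 0 ∧ winding V V' (u.1 - 1, u.2 - 1) = 0) :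
    l.length + 1 = (V \ V').card := by
  rcases h with h | h
  · refine h.length_add_one hl (fun e he z => ?_) hiso
    refine nonneg_of_coverCount_eq_sum ?_ e he
    rw [hcov, ← winding_eq_sum h.pair.left hl, abs_of_nonneg]
    rcases h.winding_eq z with e | e <;> omega
  · have hl' := isRectTransformation_reverse h.pair.symm.left hl
    have := h.length_add_one hl' (fun e he z => ?_) fun u hu hu' => ?_
    · rwa [List.length_map, List.length_reverse, card_sdiff_comm h.pair.symm] at this
    · refine nonneg_of_coverCount_eq_sum ?_ e he
      rw [coverCount_reverse, hcov, ← winding_eq_sum h.pair.left hl', winding_symm V' V, abs_neg,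
        abs_of_nonneg]
      rcases h.winding_eq z with e | e <;> omega
    · rw [winding_symm V V', winding_symm V V', (hiso u hu' hu).1, (hiso u hu' hu).2]
      simp

/-- The windings have the same sign. -/
theorem abs_winding_add (h : IsPolygon V V') (z z' : LatticePoint) :
    |winding V V' z + winding V V' z'| = |winding V V' z| + |winding V V' z'| := by
  rcases h with h | h
  · rw [abs_add_eq_add_abs_iff]
    rcases h.winding_eq z with e | e <;> rcases h.winding_eq z' with e' | e' <;> omega
  · rw [abs_add_eq_add_abs_iff, winding_symm V' V, winding_symm V' V]
    rcases h.winding_eq z with e | e <;> rcases h.winding_eq z' with e' | e' <;> omega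

theorem abs_winding_le_one (h : IsPolygon V V') (z : LatticePoint) : |winding V V' z| ≤ 1 := by
  rcases h with h | h
  · rcases h.winding_eq z with e | e <;> simp [e]
  · rw [winding_symm V' V]
    rcases h.winding_eq z with e | e <;> simp [e]

end IsPolygon

/-! Rotation numbers and faces -/

/-- Both arguments lie in `(0, π)` or both in `(-π, 0)`, so their difference needs no correction by
a multiple of `2π`. -/
theorem arg_div_eq_sub {a b : ℂ} (h : 0 < a.im * b.im) :
    Complex.arg (b / a) = Complex.arg b - Complex.arg a := by
  have ha : a.im ≠ 0 := fun e => by simp [e] at h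
  have hb : b.im ≠ 0 := fun e => by simp [e] at h
  have ha0 : a ≠ 0 := fun e => ha (by simp [e])
  have hb0 : b ≠ 0 := fun e => hb (by simp [e])
  have e := Complex.arg_div_coe_angle hb0 ha0
  rw [← Real.Angle.coe_sub] at e
  rw [← Complex.arg_coe_angle_toReal_eq_arg, e, Real.Angle.toReal_coe_eq_self_iff]
  have a1 := Complex.neg_pi_lt_arg a
  have b1 := Complex.neg_pi_lt_arg b
  have a2 := Complex.arg_lt_pi_iff.2 (Or.inr ha)
  have b2 := Complex.arg_lt_pi_iff.2 (Or.inr hb)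
  rcases lt_or_gt_of_ne ha with ha | ha
  · have hb : b.im < 0 := by
      by_contra hb
      exact absurd h (not_lt.2 (mul_nonpos_of_nonpos_of_nonneg ha.le (not_lt.1 hb)))
    have := Complex.arg_neg_iff.2 ha
    have := Complex.arg_neg_iff.2 hb
    constructor <;> linarith
  · have hb : 0 < b.im := pos_of_mul_pos_right h ha.le
    have := Complex.arg_nonneg_iff.2 ha.le
    have := Complex.arg_nonneg_iff.2 hb.le
    constructor <;> linarith

/-- A quarter turn crosses the branch cut of `arg` exactly when it starts in the open second
quadrant. -/
theorem arg_I_mul {z : ℂ} (h1 : z.re ≠ 0) (h2 : z.im ≠ 0) :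
    Complex.arg (Complex.I * z) = Complex.arg z + Real.pi / 2 -
      2 * Real.pi * (if z.re < 0 ∧ 0 < z.im then 1 else 0) := by
  have hz : z ≠ 0 := fun e => h1 (by simp [e])
  have e := Complex.arg_mul_coe_angle Complex.I_ne_zero hz
  rw [← Complex.arg_coe_angle_toReal_eq_arg, e, Complex.arg_I, ← Real.Angle.coe_add]
  have hpi := Real.pi_pos
  have a1 := Complex.neg_pi_lt_arg z
  have a2 := Complex.arg_lt_pi_iff.2 (Or.inr h2)
  split_ifs with h
  · have e2 : ((Real.pi / 2 + Complex.arg z : ℝ) : Real.Angle) =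
        ((Complex.arg z + Real.pi / 2 - 2 * Real.pi * 1 : ℝ) : Real.Angle) := by
      rw [mul_one, Real.Angle.coe_sub, Real.Angle.coe_two_pi, sub_zero, add_comm]
    rw [e2, Real.Angle.toReal_coe_eq_self_iff]
    have : ¬ Complex.arg z ≤ Real.pi / 2 := by
      rw [Complex.arg_le_pi_div_two_iff]
      rintro (h3 | h3) <;> linarith [h.1, h.2]
    constructor <;> linarith
  · rw [mul_zero, sub_zero, add_comm, Real.Angle.toReal_coe_eq_self_iff]
    have : Complex.arg z ≤ Real.pi / 2 := by
      rw [Complex.arg_le_pi_div_two_iff]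
      by_contra h3
      push Not at h3
      exact h ⟨h3.1, lt_of_le_of_ne h3.2 (Ne.symm h2)⟩
    constructor <;> linarith

/-- A point of the plane which lies on no line of the lattice. -/
def IsGeneric (p : ℂ) : Prop := ∀ n : ℤ, p.re ≠ n ∧ p.im ≠ n

/-- The lower left corner of the unit cell containing `p`. -/
noncomputable def cellOf (p : ℂ) : LatticePoint := (⌊p.re⌋, ⌊p.im⌋)

theorem IsGridPair.sum_ite_snd {V V' : Finset LatticePoint} (h : IsGridPair V V')
    {b : LatticePoint} (hb : b ∈ V') (c : ℝ) :
    ∑ a ∈ V, (if a.2 = b.2 then c else 0) = c := by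
  obtain ⟨a, ha, e⟩ := h.symm.exists_snd hb
  rw [Finset.sum_eq_single a]
  · rw [if_pos e]
  · intro u hu hua
    rw [if_neg]
    rw [← e]
    exact snd_ne h.left hu ha hua
  · exact fun h' => absurd ha h'

theorem IsGridPair.sum_ite_fst {V V' : Finset LatticePoint} (h : IsGridPair V V')
    {b : LatticePoint} (hb : b ∈ V') (c : ℝ) :
    ∑ a ∈ V, (if a.1 = b.1 then c else 0) = c := by
  obtain ⟨a, ha, e⟩ := h.symm.exists_fst hb
  rw [Finset.sum_eq_single a]
  · rw [if_pos e]
  · intro u hu hua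
    rw [if_neg]
    rw [← e]
    exact fst_ne h.left hu ha hua
  · exact fun h' => absurd ha h'

namespace LatticePolytope

variable (P : LatticePolytope)

/-- Each vertex lies on one line in each direction, so the edge differences regroup by vertices. An
isolated vertex is no edge, but contributes zero to both sides. -/
theorem sum_edges (g : LatticePoint × LatticePoint → ℝ) (h k : LatticePoint → ℝ)
    (hh : ∀ a ∈ P.ver0, ∀ b ∈ P.ver1, a.2 = b.2 → a ≠ b → g (a, b) = h b - h a)
    (hk : ∀ b ∈ P.ver1, ∀ a ∈ P.ver0, b.1 = a.1 → b ≠ a → g (b, a) = k a - k b) :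
    ∑ e ∈ P.edges, g e =
      ∑ b ∈ P.ver1, h b - ∑ a ∈ P.ver0, h a + (∑ a ∈ P.ver0, k a - ∑ b ∈ P.ver1, k b) := by
  have hp := P.isGridPair
  rw [edges, Finset.sum_union]
  · congr 1
    · rw [Finset.sum_filter, Finset.sum_product]
      have : ∀ a ∈ P.ver0, ∀ b ∈ P.ver1, (if a.2 = b.2 ∧ a ≠ b then g (a, b) else 0) =
          (if a.2 = b.2 then h b else 0) - (if b.2 = a.2 then h a else 0) := by
        intro a ha b hb
        by_cases e : a.2 = b.2
        · by_cases hab : a = b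
          · subst hab; simp
          · rw [if_pos ⟨e, hab⟩, if_pos e, if_pos e.symm, hh a ha b hb e hab]
        · rw [if_neg (fun h => e h.1), if_neg e, if_neg (fun h => e h.symm), sub_zero]
      rw [Finset.sum_congr rfl fun a ha => Finset.sum_congr rfl (this a ha)]
      simp only [Finset.sum_sub_distrib]
      congr 1
      · rw [Finset.sum_comm]
        exact Finset.sum_congr rfl fun b hb => hp.sum_ite_snd hb _
      · exact Finset.sum_congr rfl fun a ha => hp.symm.sum_ite_snd ha _
    · rw [Finset.sum_filter, Finset.sum_product]
      have : ∀ b ∈ P.ver1, ∀ a ∈ P.ver0, (if b.1 = a.1 ∧ b ≠ a then g (b, a) else 0) =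
          (if b.1 = a.1 then k a else 0) - (if a.1 = b.1 then k b else 0) := by
        intro b hb a ha
        by_cases e : b.1 = a.1
        · by_cases hab : b = a
          · subst hab; simp
          · rw [if_pos ⟨e, hab⟩, if_pos e, if_pos e.symm, hk b hb a ha e hab]
        · rw [if_neg (fun h => e h.1), if_neg e, if_neg (fun h => e h.symm), sub_zero]
      rw [Finset.sum_congr rfl fun b hb => Finset.sum_congr rfl (this b hb)]
      simp only [Finset.sum_sub_distrib]
      congr 1
      · rw [Finset.sum_comm]
        exact Finset.sum_congr rfl fun a ha => hp.symm.sum_ite_fst ha _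
      · exact Finset.sum_congr rfl fun b hb => hp.sum_ite_fst hb _
  · rw [Finset.disjoint_left]
    rintro ⟨a, b⟩ h1 h2
    simp only [Finset.mem_filter, Finset.mem_product] at h1 h2
    exact h1.2.2 (Prod.ext h2.2.1 h1.2.1)

/-- The rotation number at a generic point is the winding of its cell. -/
theorem rotationNumber_eq_winding {p : ℂ} (hp : IsGeneric p) :
    P.rotationNumber p = (winding P.ver0 P.ver1 (cellOf p) : ℝ) := by
  have re_sub : ∀ v : LatticePoint, (v.toPlane - p).re = v.1 - p.re := fun _ => rfl
  have im_sub : ∀ v : LatticePoint, (v.toPlane - p).im = v.2 - p.im := fun _ => rfl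
  have hre : ∀ v : LatticePoint, (v.toPlane - p).re ≠ 0 := fun v => by
    rw [re_sub, sub_ne_zero]; exact (hp v.1).1.symm
  have him : ∀ v : LatticePoint, (v.toPlane - p).im ≠ 0 := fun v => by
    rw [im_sub, sub_ne_zero]; exact (hp v.2).2.symm
  have hI : ∀ v : LatticePoint, Complex.arg (Complex.I * (v.toPlane - p)) =
      Complex.arg (v.toPlane - p) + Real.pi / 2 - 2 * Real.pi *
        ((step v.1 (cellOf p).1 * (1 - step v.2 (cellOf p).2) : ℤ) : ℝ) := by
    intro v
    rw [arg_I_mul (hre v) (him v)]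
    congr 2
    have i1 : (v.toPlane - p).re < 0 ↔ v.1 ≤ ⌊p.re⌋ := by
      rw [re_sub, sub_neg, Int.le_floor]
      exact ⟨le_of_lt, fun h => lt_of_le_of_ne h (hp v.1).1.symm⟩
    have i2 : 0 < (v.toPlane - p).im ↔ ¬ v.2 ≤ ⌊p.im⌋ := by
      rw [im_sub, sub_pos, Int.le_floor, not_le]
    simp only [i1, i2, step, cellOf]
    by_cases j1 : v.1 ≤ ⌊p.re⌋ <;> by_cases j2 : v.2 ≤ ⌊p.im⌋ <;> simp [j1, j2]
  -- Along a horizontal edge the imaginary part of `z - p` is constant, along a vertical one that of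
  -- `I * (z - p)`, so either change of argument is a difference of vertex terms. Per vertex there
  -- remain `π / 2`, which cancels between `ver0` and `ver1`, and `2π` for each vertex to the upper
  -- left of `p`.
  have key := P.sum_edges (fun e => Complex.arg ((e.2.toPlane - p) / (e.1.toPlane - p)))
    (fun v => Complex.arg (v.toPlane - p)) (fun v => Complex.arg (Complex.I * (v.toPlane - p)))
    (fun a _ b _ e _ => by
      refine arg_div_eq_sub ?_
      rw [im_sub b, ← e, ← im_sub a]
      exact mul_self_pos.2 (him a))
    (fun b _ a _ e _ => by
      simp only
      rw [← mul_div_mul_left _ _ Complex.I_ne_zero]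
      refine arg_div_eq_sub ?_
      rw [Complex.I_mul_im, Complex.I_mul_im, re_sub a, ← e, ← re_sub b]
      exact mul_self_pos.2 (hre b))
  rw [rotationNumber, div_eq_iff (by positivity), key]
  have hg := P.isGridPair
  have count : ∑ v ∈ P.ver0, step v.1 (cellOf p).1 * (1 - step v.2 (cellOf p).2) -
      ∑ v ∈ P.ver1, step v.1 (cellOf p).1 * (1 - step v.2 (cellOf p).2) =
      -winding P.ver0 P.ver1 (cellOf p) := by
    have := hg.sum_fst (fun t => step t (cellOf p).1)
    simp only [mul_sub, mul_one, Finset.sum_sub_distrib, winding, quadrantCount]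
    linarith
  have count' := congrArg (Int.cast : ℤ → ℝ) count
  push_cast at count'
  have card : ∑ v ∈ P.ver0, Real.pi / 2 = ∑ v ∈ P.ver1, Real.pi / 2 := by
    simp [hg.card_eq]
  simp only [hI, Finset.sum_sub_distrib, Finset.sum_add_distrib, ← Finset.mul_sum, card]
  push_cast
  linear_combination (-2 * Real.pi) * count'

theorem notMem_boundary {p : ℂ} (hp : IsGeneric p) : p ∉ P.boundary := by
  simp only [boundary, Set.mem_iUnion, not_exists]
  rintro ⟨a, b⟩ he hs
  obtain ⟨s, t, -, -, hst, rfl⟩ := hs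
  have hcase : a.2 = b.2 ∨ a.1 = b.1 := by
    simp only [edges, Finset.mem_union, Finset.mem_filter] at he
    rcases he with he | he
    exacts [Or.inl he.2.1, Or.inr he.2.1]
  rcases hcase with e | e
  · refine (hp a.2).2 ?_
    simp only [LatticePoint.toPlane, Complex.add_im, Complex.smul_im, smul_eq_mul, ← e]
    rw [← add_mul, hst, one_mul]
  · refine (hp a.1).1 ?_
    simp only [LatticePoint.toPlane, Complex.add_re, Complex.smul_re, smul_eq_mul, ← e]
    rw [← add_mul, hst, one_mul]

/-- The quotient under `arg` meets the branch cut only when `p` lies on the segment: if it equals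
`-r` with `r ≥ 0`, then `p` is the convex combination of the endpoints with weights `r / (1 + r)`
and `1 / (1 + r)`. -/
theorem continuousAt_rotationNumber {p : ℂ} (hp : p ∉ P.boundary) :
    ContinuousAt P.rotationNumber p := by
  unfold rotationNumber
  refine ContinuousAt.div_const (tendsto_finsetSum _ fun e he => ?_) _
  have hs : p ∉ segment ℝ e.1.toPlane e.2.toPlane := fun h => hp (Set.mem_biUnion he h)
  have hne : e.1.toPlane - p ≠ 0 := fun h => hs (by
    rw [← sub_eq_zero.1 h]; exact left_mem_segment _ _ _)
  have hc : ContinuousAt (fun p => (e.2.toPlane - p) / (e.1.toPlane - p)) p :=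
    (continuousAt_const.sub continuousAt_id).div (continuousAt_const.sub continuousAt_id) hne
  refine ContinuousAt.comp (f := fun p => (e.2.toPlane - p) / (e.1.toPlane - p))
    (g := Complex.arg) (Complex.continuousAt_arg ?_) hc
  rw [Complex.mem_slitPlane_iff_not_le_zero]
  intro hle
  obtain ⟨r, hr, hr'⟩ : ∃ r : ℝ, 0 ≤ r ∧ (e.2.toPlane - p) / (e.1.toPlane - p) = -(r : ℂ) := by
    rw [Complex.le_def] at hle
    refine ⟨-((e.2.toPlane - p) / (e.1.toPlane - p)).re, neg_nonneg.2 hle.1, ?_⟩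
    apply Complex.ext
    · simp
    · simpa using hle.2
  rw [div_eq_iff hne] at hr'
  refine hs ⟨r / (1 + r), 1 / (1 + r), by positivity, by positivity, by field_simp; ring, ?_⟩
  have h1 : (1 + r : ℂ) ≠ 0 := by
    have : (1 + r : ℝ) ≠ 0 := by positivity
    exact_mod_cast this
  simp only [Complex.real_smul]
  push_cast
  field_simp
  linear_combination hr'

end LatticePolytope

/-! Faces and rectangles as unions of unit cells -/

/-- The closed unit cell with lower left corner `z`. -/
def closedCell (z : LatticePoint) : Set ℂ :=
  Set.Icc (z.1 : ℝ) (z.1 + 1) ×ℂ Set.Icc (z.2 : ℝ) (z.2 + 1)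

theorem mem_closedCell {z : LatticePoint} {p : ℂ} :
    p ∈ closedCell z ↔
      ((z.1 : ℝ) ≤ p.re ∧ p.re ≤ z.1 + 1) ∧ (z.2 : ℝ) ≤ p.im ∧ p.im ≤ z.2 + 1 := Iff.rfl

theorem mem_closedCell_cellOf (p : ℂ) : p ∈ closedCell (cellOf p) :=
  ⟨⟨Int.floor_le _, (Int.lt_floor_add_one _).le⟩, Int.floor_le _, (Int.lt_floor_add_one _).le⟩

theorem generic_of_mem_Ioo {z : LatticePoint} {p : ℂ}
    (h1 : p.re ∈ Set.Ioo (z.1 : ℝ) (z.1 + 1)) (h2 : p.im ∈ Set.Ioo (z.2 : ℝ) (z.2 + 1)) :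
    IsGeneric p ∧ cellOf p = z := by
  refine ⟨fun n => ⟨fun e => ?_, fun e => ?_⟩, Prod.ext ?_ ?_⟩
  · rw [e] at h1
    have a1 : z.1 < n := by exact_mod_cast h1.1
    have a2 : n < z.1 + 1 := by exact_mod_cast h1.2
    omega
  · rw [e] at h2
    have a1 : z.2 < n := by exact_mod_cast h2.1
    have a2 : n < z.2 + 1 := by exact_mod_cast h2.2
    omega
  · exact Int.floor_eq_iff.2 ⟨h1.1.le, h1.2⟩
  · exact Int.floor_eq_iff.2 ⟨h2.1.le, h2.2⟩

theorem isClosed_closedCell (z : LatticePoint) : IsClosed (closedCell z) :=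
  isClosed_Icc.reProdIm isClosed_Icc

theorem IsGridPair.finite_support {V V' : Finset LatticePoint} (h : IsGridPair V V') :
    {z | winding V V' z ≠ 0}.Finite := by
  obtain ⟨a, ha⟩ := (V.image Prod.fst ∪ V.image Prod.snd ∪
    (V'.image Prod.fst ∪ V'.image Prod.snd)).bddBelow
  obtain ⟨b, hb⟩ := (V.image Prod.fst ∪ V.image Prod.snd ∪
    (V'.image Prod.fst ∪ V'.image Prod.snd)).bddAbove
  have key : ∀ v : LatticePoint, v ∈ V ∨ v ∈ V' →
      (a ≤ v.1 ∧ v.1 ≤ b) ∧ a ≤ v.2 ∧ v.2 ≤ b := by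
    intro v hv
    have m1 : v.1 ∈ (V.image Prod.fst ∪ V.image Prod.snd ∪
        (V'.image Prod.fst ∪ V'.image Prod.snd)) := by
      simp only [Finset.mem_union, Finset.mem_image]
      rcases hv with hv | hv
      exacts [Or.inl (Or.inl ⟨v, hv, rfl⟩), Or.inr (Or.inl ⟨v, hv, rfl⟩)]
    have m2 : v.2 ∈ (V.image Prod.fst ∪ V.image Prod.snd ∪
        (V'.image Prod.fst ∪ V'.image Prod.snd)) := by
      simp only [Finset.mem_union, Finset.mem_image]
      rcases hv with hv | hv
      exacts [Or.inl (Or.inr ⟨v, hv, rfl⟩), Or.inr (Or.inr ⟨v, hv, rfl⟩)]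
    exact ⟨⟨ha m1, hb m1⟩, ha m2, hb m2⟩
  refine (Set.finite_Icc ((a, a) : ℤ × ℤ) (b, b)).subset fun z hz => ?_
  by_contra hz'
  apply hz
  rw [Set.mem_Icc, Prod.le_def, Prod.le_def] at hz'
  simp only at hz'
  have hz' : z.1 < a ∨ z.2 < a ∨ b < z.1 ∨ b < z.2 := by omega
  rw [winding, sub_eq_zero, quadrantCount, quadrantCount]
  rcases hz' with h1 | h1 | h1 | h1
  · rw [Finset.sum_eq_zero, Finset.sum_eq_zero]
    · intro v hv
      have := key v (Or.inr hv)
      rw [step, if_neg (by omega), zero_mul]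
    · intro v hv
      have := key v (Or.inl hv)
      rw [step, if_neg (by omega), zero_mul]
  · rw [Finset.sum_eq_zero, Finset.sum_eq_zero]
    · intro v hv
      have := key v (Or.inr hv)
      rw [mul_comm, step, if_neg (by omega), zero_mul]
    · intro v hv
      have := key v (Or.inl hv)
      rw [mul_comm, step, if_neg (by omega), zero_mul]
  · have e : ∀ v : LatticePoint, v ∈ V ∨ v ∈ V' →
        step v.1 z.1 * step v.2 z.2 = step v.2 z.2 := by
      intro v hv
      have := key v hv
      rw [step, if_pos (by omega), one_mul]
    rw [Finset.sum_congr rfl fun v hv => e v (Or.inl hv),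
      Finset.sum_congr rfl fun v hv => e v (Or.inr hv)]
    exact h.sum_snd (fun t => step t z.2)
  · have e : ∀ v : LatticePoint, v ∈ V ∨ v ∈ V' →
        step v.1 z.1 * step v.2 z.2 = step v.1 z.1 := by
      intro v hv
      have := key v hv
      rw [mul_comm, step, if_pos (by omega), one_mul]
    rw [Finset.sum_congr rfl fun v hv => e v (Or.inl hv),
      Finset.sum_congr rfl fun v hv => e v (Or.inr hv)]
    exact h.sum_fst (fun t => step t z.1)

namespace LatticePolytope

variable (P : LatticePolytope)

/-- A point off the boundary may lie on lattice lines. A small shift to the upper right moves it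
into the open cell given by the floors of its coordinates, and by continuity the rotation number
stays non-zero. Finiteness of the set of cells makes the union closed. -/
theorem face_eq : P.face = ⋃ z ∈ {z | winding P.ver0 P.ver1 z ≠ 0}, closedCell z := by
  apply Set.Subset.antisymm
  · refine closure_minimal ?_
      (P.isGridPair.finite_support.isClosed_biUnion fun z _ => isClosed_closedCell z)
    rintro p ⟨hp, hrot⟩
    refine Set.mem_biUnion (x := cellOf p) ?_ (mem_closedCell_cellOf p)
    have hshift : ContinuousAt (fun δ : ℝ => p + δ * (1 + Complex.I)) 0 := by fun_prop
    have hev : ∀ᶠ δ : ℝ in nhds 0, P.rotationNumber (p + δ * (1 + Complex.I)) ≠ 0 := by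
      have hc : ContinuousAt (fun δ : ℝ => P.rotationNumber (p + δ * (1 + Complex.I))) 0 := by
        refine ContinuousAt.comp (f := fun δ : ℝ => p + δ * (1 + Complex.I))
          (g := P.rotationNumber) ?_ hshift
        simpa using P.continuousAt_rotationNumber hp
      exact hc.eventually_ne (by simpa using hrot)
    have r1 : p.re < ⌊p.re⌋ + 1 := Int.lt_floor_add_one _
    have r2 : p.im < ⌊p.im⌋ + 1 := Int.lt_floor_add_one _
    have r3 := Int.floor_le p.re
    have r4 := Int.floor_le p.im
    have h1 : ∀ᶠ δ : ℝ in nhds 0, δ < ⌊p.re⌋ + 1 - p.re := eventually_lt_nhds (by linarith)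
    have h2 : ∀ᶠ δ : ℝ in nhds 0, δ < ⌊p.im⌋ + 1 - p.im := eventually_lt_nhds (by linarith)
    obtain ⟨δ, ⟨⟨hδ, hδ1⟩, hδ2⟩, hδ0⟩ :=
      ((((hev.and h1).and h2).filter_mono nhdsWithin_le_nhds).and
        (self_mem_nhdsWithin : Set.Ioi (0 : ℝ) ∈ nhdsWithin 0 (Set.Ioi 0))).exists
    obtain ⟨g, hg⟩ := generic_of_mem_Ioo (z := cellOf p) (p := p + δ * (1 + Complex.I))
      (by simp [cellOf]; constructor <;> linarith) (by simp [cellOf]; constructor <;> linarith)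
    rw [P.rotationNumber_eq_winding g, hg] at hδ
    exact_mod_cast hδ
  · refine Set.iUnion₂_subset fun z hz => ?_
    have : closedCell z = closure (Set.Ioo (z.1 : ℝ) (z.1 + 1) ×ℂ Set.Ioo (z.2 : ℝ) (z.2 + 1)) := by
      rw [Complex.closure_reProdIm, closure_Ioo (by linarith), closure_Ioo (by linarith)]
      rfl
    rw [this]
    refine closure_mono fun p hp => ?_
    obtain ⟨g, hg⟩ := generic_of_mem_Ioo hp.1 hp.2
    refine ⟨P.notMem_boundary g, ?_⟩
    rw [P.rotationNumber_eq_winding g, hg]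
    exact_mod_cast hz

theorem closedCell_subset_face {z : LatticePoint} (hz : winding P.ver0 P.ver1 z ≠ 0) :
    closedCell z ⊆ P.face := by
  rw [face_eq]
  exact Set.subset_biUnion_of_mem (u := fun z => closedCell z) hz

end LatticePolytope

/-! ### Rectangles and divisions in terms of unit cells. -/

theorem step_ne_iff {a b n : ℤ} : step a n ≠ step b n ↔ min a b ≤ n ∧ n < max a b := by
  simp only [step]
  split_ifs <;> simp <;> omega

theorem signedCell_ne_zero_iff {e : LatticePoint × LatticePoint} {z : LatticePoint} :
    signedCell e z ≠ 0 ↔ (min e.1.1 e.2.1 ≤ z.1 ∧ z.1 < max e.1.1 e.2.1) ∧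
      min e.1.2 e.2.2 ≤ z.2 ∧ z.2 < max e.1.2 e.2.2 := by
  rw [signedCell, mul_ne_zero_iff, sub_ne_zero, sub_ne_zero, step_ne_iff, step_ne_iff]

theorem mem_uIcc_iff_exists {a b : ℤ} (hab : a ≠ b) {x : ℝ} :
    x ∈ Set.uIcc (a : ℝ) b ↔
      ∃ n : ℤ, (min a b ≤ n ∧ n < max a b) ∧ (n : ℝ) ≤ x ∧ x ≤ n + 1 := by
  rw [Set.uIcc, Set.mem_Icc, ← Int.cast_min, ← Int.cast_max]
  have hlt : min a b < max a b := min_lt_max.2 hab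
  constructor
  · rintro ⟨h1, h2⟩
    rcases h2.lt_or_eq with h | h
    · exact ⟨⌊x⌋, ⟨Int.le_floor.2 h1, Int.floor_lt.2 h⟩, Int.floor_le _,
        (Int.lt_floor_add_one _).le⟩
    -- The right end of the interval belongs to the unit interval ending there, not to the one given
    -- by its floor.
    · refine ⟨max a b - 1, by omega, ?_, ?_⟩ <;> push_cast at h ⊢ <;> linarith
  · rintro ⟨n, ⟨h1, h2⟩, h3, h4⟩
    have h1' : ((min a b : ℤ) : ℝ) ≤ n := by exact_mod_cast h1
    have h2' : (n : ℝ) + 1 ≤ ((max a b : ℤ) : ℝ) := by exact_mod_cast h2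
    constructor <;> linarith

theorem mem_rectangle_iff {e : LatticePoint × LatticePoint} (h1 : e.1.1 ≠ e.2.1)
    (h2 : e.1.2 ≠ e.2.2) {p : ℂ} :
    p ∈ rectangle e ↔ ∃ z, signedCell e z ≠ 0 ∧ p ∈ closedCell z := by
  rw [rectangle, Complex.mem_reProdIm, mem_uIcc_iff_exists h1, mem_uIcc_iff_exists h2]
  simp only [signedCell_ne_zero_iff, mem_closedCell]
  constructor
  · rintro ⟨⟨x, hx, hx'⟩, y, hy, hy'⟩
    exact ⟨(x, y), ⟨hx, hy⟩, hx', hy'⟩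
  · rintro ⟨z, ⟨hx, hy⟩, hx', hy'⟩
    exact ⟨⟨z.1, hx, hx'⟩, z.2, hy, hy'⟩

theorem interior_rectangle (e : LatticePoint × LatticePoint) :
    interior (rectangle e) =
      Set.Ioo ((min e.1.1 e.2.1 : ℤ) : ℝ) ((max e.1.1 e.2.1 : ℤ) : ℝ) ×ℂ
        Set.Ioo ((min e.1.2 e.2.2 : ℤ) : ℝ) ((max e.1.2 e.2.2 : ℤ) : ℝ) := by
  rw [rectangle, Complex.interior_reProdIm, Set.uIcc, Set.uIcc, interior_Icc, interior_Icc]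
  push_cast
  rfl

theorem signedCell_ne_zero_of_mem_interior {e : LatticePoint × LatticePoint} {p : ℂ}
    (hp : p ∈ interior (rectangle e)) : signedCell e (cellOf p) ≠ 0 := by
  rw [interior_rectangle] at hp
  rw [signedCell_ne_zero_iff]
  exact ⟨⟨Int.le_floor.2 hp.1.1.le, Int.floor_lt.2 hp.1.2⟩,
    Int.le_floor.2 hp.2.1.le, Int.floor_lt.2 hp.2.2⟩

theorem center_mem_interior {e : LatticePoint × LatticePoint} {z : LatticePoint}
    (hz : signedCell e z ≠ 0) : (⟨z.1 + 1 / 2, z.2 + 1 / 2⟩ : ℂ) ∈ interior (rectangle e) := by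
  rw [signedCell_ne_zero_iff] at hz
  rw [interior_rectangle]
  obtain ⟨⟨h1, h2⟩, h3, h4⟩ := hz
  have h1' : ((min e.1.1 e.2.1 : ℤ) : ℝ) ≤ z.1 := by exact_mod_cast h1
  have h2' : (z.1 : ℝ) + 1 ≤ ((max e.1.1 e.2.1 : ℤ) : ℝ) := by exact_mod_cast h2
  have h3' : ((min e.1.2 e.2.2 : ℤ) : ℝ) ≤ z.2 := by exact_mod_cast h3
  have h4' : (z.2 : ℝ) + 1 ≤ ((max e.1.2 e.2.2 : ℤ) : ℝ) := by exact_mod_cast h4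
  refine ⟨⟨?_, ?_⟩, ?_, ?_⟩ <;> simp only <;> linarith

theorem pairwise_disjoint_of_coverCount_le {l : List (LatticePoint × LatticePoint)}
    (h : ∀ z, coverCount l z ≤ 1) :
    l.Pairwise (fun e f => Disjoint (interior (rectangle e)) (interior (rectangle f))) := by
  induction l with
  | nil => exact List.Pairwise.nil
  | cons e l ih =>
    refine List.pairwise_cons.2 ⟨fun f hf => ?_, ih fun z => ?_⟩
    · rw [Set.disjoint_left]
      intro p hp hp'
      have h1 := Int.one_le_abs (signedCell_ne_zero_of_mem_interior hp)
      have h2 := Int.one_le_abs (signedCell_ne_zero_of_mem_interior hp')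
      have h3 := abs_signedCell_le_coverCount hf (cellOf p)
      have h4 := h (cellOf p)
      rw [coverCount_cons] at h4
      omega
    · have h1 := h z
      have h2 := abs_nonneg (signedCell e z)
      rw [coverCount_cons] at h1
      omega

/-- At most one rectangle contains a given cell, so there is no cancellation. Hence every division
inducing a transformation has cover count equal to the absolute winding. -/
theorem coverCount_eq_abs_sum {l : List (LatticePoint × LatticePoint)}
    (h : l.Pairwise (fun e f => Disjoint (interior (rectangle e)) (interior (rectangle f))))
    (z : LatticePoint) : coverCount l z = |(l.map (fun e => signedCell e z)).sum| := by
  induction l with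
  | nil => rfl
  | cons e l ih =>
    obtain ⟨h1, h2⟩ := List.pairwise_cons.1 h
    have ih := ih h2
    rw [coverCount_cons, List.map_cons, List.sum_cons]
    by_cases he : signedCell e z = 0
    · rw [he, ih, abs_zero, zero_add, zero_add]
    · have : ∀ f ∈ l, signedCell f z = 0 := by
        intro f hf
        by_contra hfz
        exact Set.disjoint_left.1 (h1 f hf) (center_mem_interior he) (center_mem_interior hfz)
      have h0 : (l.map (fun e => signedCell e z)).sum = 0 :=
        List.sum_eq_zero fun x hx => by
          obtain ⟨f, hf, rfl⟩ := List.mem_map.1 hx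
          exact this f hf
      rw [ih, h0, abs_zero, add_zero, add_zero]

theorem coverCount_ne_zero_iff {l : List (LatticePoint × LatticePoint)} {z : LatticePoint} :
    coverCount l z ≠ 0 ↔ ∃ e ∈ l, signedCell e z ≠ 0 := by
  constructor
  · intro h
    by_contra hn
    push Not at hn
    refine h (List.sum_eq_zero fun x hx => ?_)
    obtain ⟨f, hf, rfl⟩ := List.mem_map.1 hx
    rw [hn f hf, abs_zero]
  · rintro ⟨e, he, hz⟩
    have := abs_signedCell_le_coverCount he z
    have := Int.one_le_abs hz
    omega

theorem LatticePolytope.isDivision_of_coverCount_eq (P : LatticePolytope)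
    {l : List (LatticePoint × LatticePoint)} (hl : ∀ e ∈ l, e.1.1 ≠ e.2.1 ∧ e.1.2 ≠ e.2.2)
    (hw : ∀ z, |winding P.ver0 P.ver1 z| ≤ 1)
    (h : ∀ z, coverCount l z = |winding P.ver0 P.ver1 z|) : P.IsDivision l := by
  refine ⟨?_, pairwise_disjoint_of_coverCount_le fun z => (h z).trans_le (hw z)⟩
  rw [P.face_eq]
  ext p
  simp only [Set.mem_iUnion, exists_prop, Set.mem_ofPred_eq]
  constructor
  · rintro ⟨e, he, hp⟩
    obtain ⟨z, hz, hp⟩ := (mem_rectangle_iff (hl e he).1 (hl e he).2).1 hp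
    refine ⟨z, ?_, hp⟩
    rw [← abs_ne_zero, ← h, coverCount_ne_zero_iff]
    exact ⟨e, he, hz⟩
  · rintro ⟨z, hz, hp⟩
    rw [← abs_ne_zero, ← h, coverCount_ne_zero_iff] at hz
    obtain ⟨e, he, hz⟩ := hz
    exact ⟨e, he, (mem_rectangle_iff (hl e he).1 (hl e he).2).2 ⟨z, hz, hp⟩⟩

/-- Simple lattice polygons are polygons in the combinatorial sense. -/
theorem LatticePolytope.IsSimplePolygon.isPolygon {P : LatticePolytope} (h : P.IsSimplePolygon) :
    IsPolygon P.ver0 P.ver1 := by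
  obtain ⟨⟨⟨x, hx⟩, hc⟩, ⟨ε, hε, hrot⟩, -⟩ := h
  have hp := P.isGridPair
  have hw : ∀ z, (winding P.ver0 P.ver1 z : ℝ) = 0 ∨ (winding P.ver0 P.ver1 z : ℝ) = ε := by
    intro z
    obtain ⟨g, hg⟩ := generic_of_mem_Ioo (z := z) (p := (⟨z.1 + 1 / 2, z.2 + 1 / 2⟩ : ℂ))
      (by constructor <;> simp only <;> linarith) (by constructor <;> simp only <;> linarith)
    have := hrot _ (P.notMem_boundary g)
    rwa [P.rotationNumber_eq_winding g, hg] at this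
  have mem0 : ∀ u ∈ P.ver0 \ P.ver1, u ∈ P.nonIsolated := by
    intro u hu
    simp only [nonIsolated, isolated, Finset.mem_sdiff, Finset.mem_union, Finset.mem_inter] at hu ⊢
    tauto
  have mem1 : ∀ u ∈ P.ver1 \ P.ver0, u ∈ P.nonIsolated := by
    intro u hu
    simp only [nonIsolated, isolated, Finset.mem_sdiff, Finset.mem_union, Finset.mem_inter] at hu ⊢
    tauto
  have hx' : x ∈ P.ver0 \ P.ver1 ∨ x ∈ P.ver1 \ P.ver0 := by
    simp only [nonIsolated, isolated, Finset.mem_sdiff, Finset.mem_union, Finset.mem_inter] at hx ⊢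
    tauto
  have hcard := hp.sdiff.card_eq
  have edge : ∀ u v, (u, v) ∈ P.edges →
      EdgeRel (P.ver0 \ P.ver1) (P.ver1 \ P.ver0) u v := by
    intro u v he
    simp only [edges, Finset.mem_union, Finset.mem_filter, Finset.mem_product] at he
    rcases he with ⟨⟨hu, hv⟩, e, hne⟩ | ⟨⟨hu, hv⟩, e, hne⟩
    · refine Or.inl ⟨Finset.mem_sdiff.2 ⟨hu, fun h => hne ?_⟩,
        Finset.mem_sdiff.2 ⟨hv, fun h => hne ?_⟩, e⟩
      exacts [hp.symm.eq_of_snd h hv e, hp.eq_of_snd hu h e]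
    · refine Or.inr ⟨Finset.mem_sdiff.2 ⟨hu, fun h => hne ?_⟩,
        Finset.mem_sdiff.2 ⟨hv, fun h => hne ?_⟩, e⟩
      exacts [hp.eq_of_fst h hv e, hp.symm.eq_of_fst hu h e]
  rcases hε with rfl | rfl
  · refine Or.inl ⟨hp, ?_, ?_, fun z => by exact_mod_cast hw z⟩
    · rcases hx' with hx' | hx'
      · exact ⟨x, hx'⟩
      · rw [← Finset.card_pos, hcard, Finset.card_pos]
        exact ⟨x, hx'⟩
    · exact fun u hu v hv => (hc u (mem0 u hu) v (mem0 v hv)).lift id edge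
  -- For `ε = -1`, exchanging initial and terminal vertices reverses the path and the sign of the
  -- winding.
  · refine Or.inr ⟨hp.symm, ?_, ?_, fun z => ?_⟩
    · rcases hx' with hx' | hx'
      · rw [← Finset.card_pos, ← hcard, Finset.card_pos]
        exact ⟨x, hx'⟩
      · exact ⟨x, hx'⟩
    · intro u hu v hv
      rw [← Relation.reflTransGen_swap]
      refine (hc v (mem1 v hv) u (mem1 u hu)).lift id fun a b hab => ?_
      rcases edge a b hab with ⟨h1, h2, e⟩ | ⟨h1, h2, e⟩
      exacts [Or.inl ⟨h2, h1, e.symm⟩, Or.inr ⟨h2, h1, e.symm⟩]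
    · rw [winding_symm P.ver0 P.ver1]
      rcases hw z with e | e
      · left
        have : winding P.ver0 P.ver1 z = 0 := by exact_mod_cast e
        omega
      · right
        have : winding P.ver0 P.ver1 z = -1 := by exact_mod_cast e
        omega

/-! Transformations of lattice presentations -/

namespace LatticePoint

@[simp] theorem star_star (v : LatticePoint) : v.star.star = v := rfl

@[simp] theorem star_fst (v : LatticePoint) : v.star.1 = v.2 := rfl

@[simp] theorem star_snd (v : LatticePoint) : v.star.2 = v.1 := rfl

theorem star_injective : Function.Injective star := fun u v h => by
  rw [← star_star u, h, star_star]

theorem star_eq_iff {u v : LatticePoint} : u.star = v ↔ u = v.star :=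
  ⟨fun h => by rw [← h, star_star], fun h => by rw [h, star_star]⟩

end LatticePoint

/-- The mirror image of a pair of points. -/
def starPair (e : LatticePoint × LatticePoint) : LatticePoint × LatticePoint :=
  (e.1.star, e.2.star)

/-- Reflection in `x = y` preserves lower left and upper right corners, hence the sign. -/
theorem signedCell_starPair (e : LatticePoint × LatticePoint) (z : LatticePoint) :
    signedCell (starPair e) z = signedCell e z.star := by
  simp only [signedCell, starPair, LatticePoint.star]
  ring

/-- Lattice presentations of partial matchings, up to the range of the coordinates. -/
structure IsMatchingSet (Δ : Finset LatticePoint) : Prop where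
  fst_injOn : ∀ u ∈ Δ, ∀ v ∈ Δ, u.1 = v.1 → u = v
  star_mem : ∀ u ∈ Δ, u.star ∈ Δ
  fst_ne_snd : ∀ u ∈ Δ, u.1 ≠ u.2

namespace IsMatchingSet

variable {Δ : Finset LatticePoint}

theorem snd_injOn (h : IsMatchingSet Δ) : ∀ u ∈ Δ, ∀ v ∈ Δ, u.2 = v.2 → u = v :=
  fun u hu v hv e =>
    LatticePoint.star_injective (h.fst_injOn _ (h.star_mem u hu) _ (h.star_mem v hv) e)

theorem isGridPair (h : IsMatchingSet Δ) : IsGridPair Δ Δ :=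
  ⟨fun u hu v hv => h.fst_injOn u hu v hv, fun u hu v hv => h.fst_injOn u hu v hv,
    fun u hu v hv => h.snd_injOn u hu v hv, fun u hu v hv => h.snd_injOn u hu v hv, rfl, rfl⟩

theorem fst_ne_snd_of_ne (h : IsMatchingSet Δ) {u v : LatticePoint} (hu : u ∈ Δ) (hv : v ∈ Δ)
    (huv : u.star ≠ v) : v.1 ≠ u.2 := fun e =>
  huv (h.fst_injOn _ (h.star_mem u hu) v hv e.symm)

end IsMatchingSet

theorem mem_matchingTransform {Δ : Finset LatticePoint} {u v w : LatticePoint} :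
    u ∈ matchingTransform Δ v w ↔ (u ∈ Δ ∧ u ≠ v ∧ u ≠ w ∧ u ≠ v.star ∧ u ≠ w.star) ∨
      u = corner v w ∨ u = corner w v ∨ u = (corner v w).star ∨ u = (corner w v).star := by
  simp only [matchingTransform, Finset.mem_union, Finset.mem_sdiff, Finset.mem_insert,
    Finset.mem_singleton, not_or]

theorem matchingTransform_eq {Δ : Finset LatticePoint} {v w : LatticePoint} (h : IsMatchingSet Δ)
    (hv : v ∈ Δ) (hw : w ∈ Δ) (hvw : v ≠ w) :
    matchingTransform Δ v w = rectTransform (rectTransform Δ v w) v.star w.star := by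
  have a1 : w.1 ≠ v.1 := fst_ne h.isGridPair hw hv hvw.symm
  have a2 : w.2 ≠ v.2 := snd_ne h.isGridPair hw hv hvw.symm
  have a3 := h.fst_ne_snd v hv
  have a4 := h.fst_ne_snd w hw
  have c1 : corner v w ≠ v.star := fun e => a3 (congrArg Prod.snd e : v.2 = v.1).symm
  have c2 : corner v w ≠ w.star := fun e => a4 (congrArg Prod.fst e : w.1 = w.2)
  have c3 : corner w v ≠ v.star := fun e => a3 (congrArg Prod.fst e : v.1 = v.2)
  have c4 : corner w v ≠ w.star := fun e => a4 (congrArg Prod.snd e : w.2 = w.1).symm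
  have c5 : corner v.star w.star = (corner w v).star := rfl
  have c6 : corner w.star v.star = (corner v w).star := rfl
  ext u
  simp only [mem_matchingTransform, mem_rectTransform, c5, c6]
  grind

theorem IsMatchingSet.matchingTransform {Δ : Finset LatticePoint} {v w : LatticePoint}
    (h : IsMatchingSet Δ) (hv : v ∈ Δ) (hw : w ∈ Δ) (hvw : v ≠ w) (hvw' : v.star ≠ w) :
    v.star ∈ rectTransform Δ v w ∧ w.star ∈ rectTransform Δ v w ∧
      IsMatchingSet (matchingTransform Δ v w) := by
  have hv' : v.star ∈ rectTransform Δ v w :=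
    mem_rectTransform.2 (Or.inl ⟨h.star_mem v hv,
      fun e => h.fst_ne_snd v hv (congrArg Prod.snd e), hvw'⟩)
  have hw' : w.star ∈ rectTransform Δ v w :=
    mem_rectTransform.2 (Or.inl ⟨h.star_mem w hw,
      fun e => hvw' (LatticePoint.star_eq_iff.2 e.symm),
      fun e => h.fst_ne_snd w hw (congrArg Prod.snd e)⟩)
  have hne : v.star ≠ w.star := fun e => hvw (LatticePoint.star_injective e)
  have g1 := isGridPair_rectTransform h.isGridPair hv hw hvw
  have g2 := (isGridPair_rectTransform g1.symm.left hv' hw' hne).symm.left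
  rw [← matchingTransform_eq h hv hw hvw] at g2
  refine ⟨hv', hw', fun a ha b hb e => g2.eq_of_fst ha hb e, fun u hu => ?_, fun u hu => ?_⟩
  · rw [mem_matchingTransform] at hu ⊢
    rcases hu with ⟨hu, h1, h2, h3, h4⟩ | rfl | rfl | rfl | rfl
    · refine Or.inl ⟨h.star_mem u hu, fun e => h3 ?_, fun e => h4 ?_, fun e => h1 ?_,
        fun e => h2 ?_⟩
      exacts [LatticePoint.star_eq_iff.1 e, LatticePoint.star_eq_iff.1 e,
        LatticePoint.star_injective e, LatticePoint.star_injective e]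
    all_goals simp
  · have k1 := h.fst_ne_snd_of_ne hv hw hvw'
    have k2 := h.fst_ne_snd_of_ne hw hv (fun e => hvw' (LatticePoint.star_eq_iff.2 e.symm))
    rcases mem_matchingTransform.1 hu with ⟨hu, -⟩ | rfl | rfl | rfl | rfl
    exacts [h.fst_ne_snd u hu, k1, k2, k1.symm, k2.symm]

/-- The list of all rectangles of a transformation of lattice presentations, together with their
mirror images. -/
def doubled (l : List (LatticePoint × LatticePoint)) : List (LatticePoint × LatticePoint) :=
  l.flatMap (fun e => [e, starPair e])

theorem doubled_cons (e : LatticePoint × LatticePoint) (l : List (LatticePoint × LatticePoint)) :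
    doubled (e :: l) = e :: starPair e :: doubled l := rfl

theorem mem_doubled {e : LatticePoint × LatticePoint} {l : List (LatticePoint × LatticePoint)}
    (he : e ∈ l) : e ∈ doubled l :=
  List.mem_flatMap.2 ⟨e, he, List.mem_cons_self⟩

theorem coverCount_doubled (l : List (LatticePoint × LatticePoint)) (z : LatticePoint) :
    coverCount (doubled l) z = coverCount l z + coverCount l z.star := by
  induction l with
  | nil => rfl
  | cons e l ih =>
    rw [doubled_cons, coverCount_cons, coverCount_cons, coverCount_cons, coverCount_cons, ih,
      signedCell_starPair]
    ring

/-- A step by a rectangle and its mirror image is two successive rectangle moves, so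
`winding_eq_sum` applies to transformations of matchings. -/
theorem isRectTransformation_doubled {Δ Δ' : Finset LatticePoint}
    {l : List (LatticePoint × LatticePoint)} (h : IsMatchingSet Δ)
    (hl : IsMatchingTransformation Δ l Δ') : IsRectTransformation Δ (doubled l) Δ' := by
  induction l generalizing Δ with
  | nil => exact hl
  | cons e l ih =>
    obtain ⟨v, w⟩ := e
    obtain ⟨hv, hw, hvw, hvw', hl⟩ := hl
    obtain ⟨hv', hw', h'⟩ := h.matchingTransform hv hw hvw hvw'
    have := ih h' hl
    rw [matchingTransform_eq h hv hw hvw] at this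
    exact ⟨hv, hw, hvw, hv', hw', fun e => hvw (LatticePoint.star_injective e), this⟩

theorem abs_sum_le_coverCount (l : List (LatticePoint × LatticePoint)) (z : LatticePoint) :
    |(l.map (fun e => signedCell e z)).sum| ≤ coverCount l z := by
  induction l with
  | nil => exact le_rfl
  | cons e l ih =>
    rw [coverCount_cons, List.map_cons, List.sum_cons]
    exact (abs_add_le _ _).trans (by omega)

/-! ### Symmetrization of a vertex set. -/

/-- The union of `V` and its mirror image. -/
def symmetrization (V : Finset LatticePoint) : Finset LatticePoint :=
  V ∪ V.image LatticePoint.star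

theorem mem_symmetrization {V : Finset LatticePoint} {u : LatticePoint} :
    u ∈ symmetrization V ↔ u ∈ V ∨ u.star ∈ V := by
  rw [symmetrization, Finset.mem_union, Finset.mem_image]
  refine or_congr_right ⟨?_, fun h => ⟨u.star, h, rfl⟩⟩
  rintro ⟨v, hv, rfl⟩
  exact hv

/-- The first and second coordinates of the points are different. -/
def HasDisjointCoordinates (V : Finset LatticePoint) : Prop := ∀ u ∈ V, ∀ v ∈ V, u.1 ≠ v.2

theorem HasDisjointCoordinates.of_isGridPair {V V' : Finset LatticePoint}
    (h : HasDisjointCoordinates V) (hp : IsGridPair V V') : HasDisjointCoordinates V' := by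
  intro u hu v hv e
  obtain ⟨u', hu', e1⟩ := hp.symm.exists_fst hu
  obtain ⟨v', hv', e2⟩ := hp.symm.exists_snd hv
  exact h u' hu' v' hv' (by rw [e1, e2, e])

theorem HasDisjointCoordinates.star_notMem {V : Finset LatticePoint}
    (h : HasDisjointCoordinates V) {u : LatticePoint} (hu : u ∈ V) : u.star ∉ V :=
  fun hu' => h u hu u.star hu' rfl

/-- Disjoint coordinates keep `V` apart from its mirror image, so that removing `v`, `w` and their
mirror images takes only `v` and `w` from `V`. -/
theorem matchingTransform_symmetrization {V : Finset LatticePoint} {v w : LatticePoint}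
    (h : HasDisjointCoordinates V) (hv : v ∈ V) (hw : w ∈ V) :
    matchingTransform (symmetrization V) v w = symmetrization (rectTransform V v w) := by
  have hv' := h.star_notMem hv
  have hw' := h.star_notMem hw
  ext u
  have hu := h.star_notMem (u := u)
  have q : ∀ x : LatticePoint, u.star = x ↔ u = x.star := fun x => LatticePoint.star_eq_iff
  simp only [mem_matchingTransform, mem_symmetrization, mem_rectTransform, Ne, q]
  have n1 : u = v → u.star ∉ V := by rintro rfl; exact hv'
  have n2 : u = w → u.star ∉ V := by rintro rfl; exact hw'
  have n3 : u = v.star → u ∉ V := by rintro rfl; exact hv'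
  have n4 : u = w.star → u ∉ V := by rintro rfl; exact hw'
  constructor
  · rintro (⟨h | h, a, b, c, d⟩ | e | e | e | e)
    exacts [Or.inl (Or.inl ⟨h, a, b⟩), Or.inr (Or.inl ⟨h, c, d⟩), Or.inl (Or.inr (Or.inl e)),
      Or.inl (Or.inr (Or.inr e)), Or.inr (Or.inr (Or.inl e)), Or.inr (Or.inr (Or.inr e))]
  · rintro ((⟨h, a, b⟩ | e | e) | (⟨h, a, b⟩ | e | e))
    exacts [Or.inl ⟨Or.inl h, a, b, fun e => n3 e h, fun e => n4 e h⟩, Or.inr (Or.inl e),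
      Or.inr (Or.inr (Or.inl e)), Or.inl ⟨Or.inr h, fun e => n1 e h, fun e => n2 e h, a, b⟩,
      Or.inr (Or.inr (Or.inr (Or.inl e))), Or.inr (Or.inr (Or.inr (Or.inr e)))]

theorem isMatchingTransformation_symmetrization {V V' : Finset LatticePoint}
    {l : List (LatticePoint × LatticePoint)} (hV : IsGridPair V V) (h : HasDisjointCoordinates V)
    (hl : IsRectTransformation V l V') :
    IsMatchingTransformation (symmetrization V) l (symmetrization V') := by
  induction l generalizing V with
  | nil => exact congrArg symmetrization hl
  | cons e l ih =>
    obtain ⟨v, w⟩ := e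
    obtain ⟨hv, hw, hvw, hl⟩ := hl
    have hp := isGridPair_rectTransform hV hv hw hvw
    refine ⟨mem_symmetrization.2 (Or.inl hv), mem_symmetrization.2 (Or.inl hw), hvw,
      fun e => h.star_notMem hv (e ▸ hw), ?_⟩
    rw [matchingTransform_symmetrization h hv hw]
    exact ih hp.symm.left (h.of_isGridPair hp) hl

theorem quadrantCount_image_star (V : Finset LatticePoint) (z : LatticePoint) :
    quadrantCount (V.image LatticePoint.star) z = quadrantCount V z.star := by
  rw [quadrantCount, Finset.sum_image LatticePoint.star_injective.injOn, quadrantCount]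
  exact Finset.sum_congr rfl fun v _ => mul_comm _ _

theorem HasDisjointCoordinates.quadrantCount_symmetrization {V : Finset LatticePoint}
    (h : HasDisjointCoordinates V) (z : LatticePoint) :
    quadrantCount (symmetrization V) z = quadrantCount V z + quadrantCount V z.star := by
  rw [← quadrantCount_image_star, quadrantCount, symmetrization, Finset.sum_union]
  · rfl
  · rw [Finset.disjoint_right]
    intro u hu
    obtain ⟨v, hv, rfl⟩ := Finset.mem_image.1 hu
    exact h.star_notMem hv

/-! Areas -/

/-- The cells with coordinates in `{1, …, m}`. -/
noncomputable def cellBox (m : ℕ) : Finset LatticePoint :=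
  Finset.Icc 1 (m : ℤ) ×ˢ Finset.Icc 1 (m : ℤ)

theorem sum_cellBox_star (m : ℕ) (g : LatticePoint → ℤ) :
    ∑ z ∈ cellBox m, g z.star = ∑ z ∈ cellBox m, g z := by
  rw [cellBox, Finset.sum_product, Finset.sum_product_right]
  rfl

theorem sum_abs_step_sub_step {m : ℕ} {a b : ℤ} (ha : a ∈ Finset.Icc 1 (m : ℤ))
    (hb : b ∈ Finset.Icc 1 (m : ℤ)) :
    ∑ n ∈ Finset.Icc 1 (m : ℤ), |step a n - step b n| = |b - a| := by
  wlog hab : a ≤ b generalizing a b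
  · rw [abs_sub_comm, ← this hb ha (by omega)]
    exact Finset.sum_congr rfl fun n _ => abs_sub_comm _ _
  rw [Finset.mem_Icc] at ha hb
  have e : ∀ n, |step a n - step b n| = if n ∈ Finset.Ico a b then 1 else 0 := by
    intro n
    simp only [step, Finset.mem_Ico]
    split_ifs <;> first | rfl | omega
  simp only [e]
  rw [← Finset.sum_filter, Finset.filter_mem_eq_inter, Finset.inter_eq_right.2]
  · rw [Finset.sum_const, Int.card_Ico, abs_of_nonneg (by omega)]
    simp only [nsmul_eq_mul, mul_one]
    omega
  · intro n hn
    rw [Finset.mem_Ico] at hn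
    rw [Finset.mem_Icc]
    omega

/-- All coordinates of the diagonal vertices are in `{1, …, m}`. -/
def IsInBox (m : ℕ) (e : LatticePoint × LatticePoint) : Prop :=
  (e.1.1 ∈ Finset.Icc 1 (m : ℤ) ∧ e.2.1 ∈ Finset.Icc 1 (m : ℤ)) ∧
    e.1.2 ∈ Finset.Icc 1 (m : ℤ) ∧ e.2.2 ∈ Finset.Icc 1 (m : ℤ)

theorem rectangleArea_eq {m : ℕ} {e : LatticePoint × LatticePoint} (he : IsInBox m e) :
    rectangleArea e = ((∑ z ∈ cellBox m, |signedCell e z| : ℤ) : ℝ) := by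
  have : ∑ z ∈ cellBox m, |signedCell e z| = |e.2.1 - e.1.1| * |e.2.2 - e.1.2| := by
    rw [← sum_abs_step_sub_step he.1.1 he.1.2, ← sum_abs_step_sub_step he.2.1 he.2.2,
      Finset.sum_mul_sum, cellBox, Finset.sum_product]
    simp only [signedCell, abs_mul]
  rw [this, rectangleArea]
  push_cast
  rfl

theorem transformationArea_eq {m : ℕ} {l : List (LatticePoint × LatticePoint)}
    (hl : ∀ e ∈ l, IsInBox m e) :
    transformationArea l = ((∑ z ∈ cellBox m, coverCount l z : ℤ) : ℝ) := by
  induction l with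
  | nil => simp [transformationArea, coverCount]
  | cons e l ih =>
    have := ih fun f hf => hl f (List.mem_cons_of_mem _ hf)
    simp only [coverCount_cons, Finset.sum_add_distrib]
    rw [Int.cast_add, ← this, ← rectangleArea_eq (hl e List.mem_cons_self)]
    simp [transformationArea]

theorem coverCount_eq_zero_of_notMem {m : ℕ} {l : List (LatticePoint × LatticePoint)}
    (hl : ∀ e ∈ l, IsInBox m e) {z : LatticePoint} (hz : z ∉ cellBox m) : coverCount l z = 0 := by
  by_contra h
  obtain ⟨e, he, h⟩ := coverCount_ne_zero_iff.1 h
  obtain ⟨⟨h1, h2⟩, h3, h4⟩ := hl e he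
  rw [signedCell_ne_zero_iff] at h
  rw [cellBox, Finset.mem_product, Finset.mem_Icc, Finset.mem_Icc] at hz
  rw [Finset.mem_Icc] at h1 h2 h3 h4
  omega

theorem isMatchingSet_latticePresentation {m : ℕ} (δ : PartialMatching m) :
    IsMatchingSet δ.latticePresentation ∧
      ∀ u ∈ δ.latticePresentation, u.1 ∈ Finset.Icc 1 (m : ℤ) ∧ u.2 ∈ Finset.Icc 1 (m : ℤ) := by
  classical
  have mem : ∀ u, u ∈ δ.latticePresentation ↔ ∃ a b : Finset.Icc 1 m, δ.graph.Adj a b ∧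
      (((a : ℕ) : ℤ), ((b : ℕ) : ℤ)) = u := by
    intro u
    simp [PartialMatching.latticePresentation]
  refine ⟨⟨?_, ?_, ?_⟩, ?_⟩
  · intro u hu v hv e
    obtain ⟨a, b, hab, rfl⟩ := (mem u).1 hu
    obtain ⟨c, d, hcd, rfl⟩ := (mem v).1 hv
    have e' : (a : ℕ) = c := by simpa using e
    obtain rfl : a = c := Subtype.ext e'
    rw [δ.degree_le_one a b d hab hcd]
  · intro u hu
    obtain ⟨a, b, hab, rfl⟩ := (mem u).1 hu
    exact (mem _).2 ⟨b, a, hab.symm, rfl⟩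
  · intro u hu
    obtain ⟨a, b, hab, rfl⟩ := (mem u).1 hu
    intro e
    have e' : (a : ℕ) = b := by simpa using e
    exact hab.ne (Subtype.ext e')
  · intro u hu
    obtain ⟨a, b, hab, rfl⟩ := (mem u).1 hu
    have ha := Finset.mem_Icc.1 a.2
    have hb := Finset.mem_Icc.1 b.2
    simp only [Finset.mem_Icc]
    omega

/-! Transformations of minimal area -/

theorem forall_of_adjacent {p : ℤ → Prop} {a b : ℤ}
    (h : ∀ n, a ≤ n → n + 1 < b → (p n ↔ p (n + 1))) {i j : ℤ} (hi : a ≤ i) (hi' : i < b)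
    (hj : a ≤ j) (hj' : j < b) (hp : p i) : p j := by
  have key : ∀ n, a ≤ n → n < b → (p a ↔ p n) := by
    intro n hn
    induction n, hn using Int.leInduction with
    | base => exact fun _ => Iff.rfl
    | succ n hn ih => exact fun hb => (ih (by omega)).trans (h n hn hb)
  exact (key j hj hj').1 ((key i hi hi').2 hp)

/-- A property of cells which is inherited by neighbouring cells holds on all of a rectangle. -/
theorem forall_signedCell_ne_zero {p : LatticePoint → Prop} {e : LatticePoint × LatticePoint}
    (h1 : ∀ x y, signedCell e (x, y) ≠ 0 → signedCell e (x + 1, y) ≠ 0 →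
      (p (x, y) ↔ p (x + 1, y)))
    (h2 : ∀ x y, signedCell e (x, y) ≠ 0 → signedCell e (x, y + 1) ≠ 0 →
      (p (x, y) ↔ p (x, y + 1))) {z z' : LatticePoint} (hz : signedCell e z ≠ 0)
    (hz' : signedCell e z' ≠ 0) (hp : p z) : p z' := by
  simp only [signedCell_ne_zero_iff] at h1 h2 hz hz'
  have s1 : p (z'.1, z.2) := forall_of_adjacent (p := fun x => p (x, z.2))
    (fun n hn hn' => h1 n z.2 ⟨⟨hn, by omega⟩, hz.2⟩ ⟨⟨by omega, hn'⟩, hz.2⟩)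
    hz.1.1 hz.1.2 hz'.1.1 hz'.1.2 hp
  exact forall_of_adjacent (p := fun y => p (z'.1, y))
    (fun n hn hn' => h2 z'.1 n ⟨hz'.1, hn, by omega⟩ ⟨hz'.1, by omega, hn'⟩)
    hz.2.1 hz.2.2 hz'.2.1 hz'.2.2 s1

/-- `v` is a vertex of the unit cell with lower left corner `z`. -/
def IsCellVertex (z v : LatticePoint) : Prop :=
  (z.1 = v.1 ∨ z.1 + 1 = v.1) ∧ (z.2 = v.2 ∨ z.2 + 1 = v.2)

theorem IsCellVertex.star {z v : LatticePoint} (h : IsCellVertex z v) :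
    IsCellVertex z.star v.star := ⟨h.2, h.1⟩

theorem IsCellVertex.mem_closedCell {z v : LatticePoint} (h : IsCellVertex z v) :
    v.toPlane ∈ closedCell z := by
  have key : ∀ a b : ℤ, (a = b ∨ a + 1 = b) → (a : ℝ) ≤ b ∧ (b : ℝ) ≤ a + 1 := by
    rintro a b (rfl | rfl) <;> constructor <;> push_cast <;> linarith
  exact ⟨key _ _ h.1, key _ _ h.2⟩

theorem exists_cell_of_mem {e : LatticePoint × LatticePoint} (h1 : e.1.1 ≠ e.2.1)
    (h2 : e.1.2 ≠ e.2.2) {v : LatticePoint}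
    (hv1 : min e.1.1 e.2.1 ≤ v.1 ∧ v.1 ≤ max e.1.1 e.2.1)
    (hv2 : min e.1.2 e.2.2 ≤ v.2 ∧ v.2 ≤ max e.1.2 e.2.2) :
    ∃ z, signedCell e z ≠ 0 ∧ IsCellVertex z v := by
  have key : ∀ a b x : ℤ, a ≠ b → min a b ≤ x ∧ x ≤ max a b →
      ∃ n, (min a b ≤ n ∧ n < max a b) ∧ (n = x ∨ n + 1 = x) := by
    intro a b x hab hx
    by_cases h : x < max a b
    · exact ⟨x, ⟨hx.1, h⟩, Or.inl rfl⟩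
    · exact ⟨x - 1, by omega, Or.inr (by omega)⟩
  obtain ⟨x, hx, hx'⟩ := key _ _ _ h1 hv1
  obtain ⟨y, hy, hy'⟩ := key _ _ _ h2 hv2
  exact ⟨(x, y), signedCell_ne_zero_iff.2 ⟨hx, hy⟩, hx', hy'⟩

/-- The lattice points which are vertices of the polytope or of cells of non-zero winding. -/
def IsPointOf (V V' : Finset LatticePoint) (v : LatticePoint) : Prop :=
  v ∈ V ∨ v ∈ V' ∨ ∃ z, winding V V' z ≠ 0 ∧ IsCellVertex z v

theorem LatticePolytope.mem_carrier (P : LatticePolytope) {v : LatticePoint}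
    (h : IsPointOf P.ver0 P.ver1 v) : v.toPlane ∈ P.carrier := by
  rcases h with h | h | ⟨z, hz, h⟩
  · exact Or.inr ⟨v, by simp [h], rfl⟩
  · exact Or.inr ⟨v, by simp [h], rfl⟩
  · exact Or.inl (Or.inl (P.closedCell_subset_face hz h.mem_closedCell))

theorem LatticePolytope.isPointOf_mirror (P : LatticePolytope) {v : LatticePoint}
    (h : IsPointOf P.ver0 P.ver1 v) : IsPointOf P.mirror.ver0 P.mirror.ver1 v.star := by
  rcases h with h | h | ⟨z, hz, h⟩
  · exact Or.inl (Finset.mem_image_of_mem _ h)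
  · exact Or.inr (Or.inl (Finset.mem_image_of_mem _ h))
  · refine Or.inr (Or.inr ⟨z.star, ?_, h.star⟩)
    simp only [mirror, winding, quadrantCount_image_star, LatticePoint.star_star]
    exact hz

/-- The only form in which the disjointness of `P` and `-P*` is used. Lattice points suffice, since
adjacent cells share one. -/
theorem LatticePolytope.not_isPointOf_star (P : LatticePolytope)
    (hd : Disjoint P.carrier P.mirror.carrier) (v : LatticePoint)
    (h : IsPointOf P.ver0 P.ver1 v) : ¬ IsPointOf P.ver0 P.ver1 v.star := fun h' =>
  Set.disjoint_left.1 hd (P.mem_carrier h) (P.mirror.mem_carrier (P.isPointOf_mirror h'))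

theorem SameStep.abs_add {e f : LatticePoint × LatticePoint} (h : SameStep e f)
    (z : LatticePoint) :
    |signedCell f z| + |signedCell f z.star| = |signedCell e z| + |signedCell e z.star| := by
  rcases h with rfl | rfl
  · rfl
  · change |signedCell (starPair e) z| + |signedCell (starPair e) z.star| = _
    rw [signedCell_starPair, signedCell_starPair, LatticePoint.star_star, add_comm]

theorem coverCount_add_star_of_forall₂ {l l' : List (LatticePoint × LatticePoint)}
    (h : List.Forall₂ SameStep l l') (z : LatticePoint) :
    coverCount l' z + coverCount l' z.star = coverCount l z + coverCount l z.star := by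
  induction h with
  | nil => rfl
  | cons h _ ih =>
    simp only [coverCount_cons]
    have := h.abs_add z
    omega

theorem forall_exists_of_forall₂ {l l' : List (LatticePoint × LatticePoint)}
    (h : List.Forall₂ SameStep l l') : ∀ e ∈ l, ∃ f ∈ l', SameStep e f := by
  induction h with
  | nil => simp
  | cons h _ ih =>
    intro e he
    rcases List.mem_cons.1 he with rfl | he
    · exact ⟨_, List.mem_cons_self, h⟩
    · obtain ⟨f, hf, hef⟩ := ih e he
      exact ⟨f, List.mem_cons_of_mem _ hf, hef⟩

theorem exists_forall₂ {q : LatticePoint × LatticePoint → Prop}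
    {l : List (LatticePoint × LatticePoint)} (h : ∀ e ∈ l, ∃ f, SameStep e f ∧ q f) :
    ∃ l', List.Forall₂ SameStep l l' ∧ ∀ f ∈ l', q f := by
  induction l with
  | nil => exact ⟨[], List.Forall₂.nil, by simp⟩
  | cons e l ih =>
    obtain ⟨f, hf, hq⟩ := h e List.mem_cons_self
    obtain ⟨l', hl', hq'⟩ := ih fun e he => h e (List.mem_cons_of_mem _ he)
    refine ⟨f :: l', List.Forall₂.cons hf hl', List.forall_mem_cons.2 ⟨hq, hq'⟩⟩

theorem matchingTransform_star (Δ : Finset LatticePoint) (v w : LatticePoint) :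
    matchingTransform Δ v.star w.star = matchingTransform Δ v w := by
  have c1 : corner v.star w.star = (corner w v).star := rfl
  have c2 : corner w.star v.star = (corner v w).star := rfl
  ext u
  simp only [mem_matchingTransform, c1, c2, LatticePoint.star_star]
  tauto

/-- The vertices of a sequence of transformations stay within the set `q` which does not meet
its mirror image. -/
theorem exists_isRectTransformation {q : LatticePoint → Prop} (hq : ∀ v, q v → ¬ q v.star)
    {l l' : List (LatticePoint × LatticePoint)} (hll : List.Forall₂ SameStep l l')
    (hl' : ∀ f ∈ l', q f.1 ∧ q f.2 ∧ q (corner f.1 f.2) ∧ q (corner f.2 f.1))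
    {V Δ' : Finset LatticePoint} (hV : IsGridPair V V) (hc : HasDisjointCoordinates V)
    (hVq : ∀ v ∈ V, q v) (hl : IsMatchingTransformation (symmetrization V) l Δ') :
    ∃ V', IsRectTransformation V l' V' ∧ symmetrization V' = Δ' ∧ ∀ v ∈ V', q v := by
  induction hll generalizing V with
  | nil => exact ⟨V, rfl, hl, hVq⟩
  | @cons e f l l' hef _ ih =>
    obtain ⟨v, w⟩ := e
    obtain ⟨hv, hw, hvw, -, hl⟩ := hl
    obtain ⟨q1, q2, q3, q4⟩ := hl' f List.mem_cons_self
    -- The half of the symmetrization inside `q` is `V` itself, so a rectangle with vertices in `q`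
    -- acts on `V` alone.
    have mem : ∀ u ∈ symmetrization V, q u → u ∈ V := by
      intro u hu hqu
      rcases mem_symmetrization.1 hu with h | h
      · exact h
      · exact absurd (hVq _ h) (hq u hqu)
    have mem_star : ∀ u ∈ symmetrization V, u.star ∈ symmetrization V := fun u hu =>
      mem_symmetrization.2 (mem_symmetrization.1 hu).symm
    obtain ⟨h1, h2, h3, h4⟩ : f.1 ∈ V ∧ f.2 ∈ V ∧ f.1 ≠ f.2 ∧
        matchingTransform (symmetrization V) v w = symmetrization (rectTransform V f.1 f.2) := by
      rcases hef with rfl | rfl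
      · have h1 := mem _ hv q1
        have h2 := mem _ hw q2
        exact ⟨h1, h2, hvw, matchingTransform_symmetrization hc h1 h2⟩
      · have h1 := mem _ (mem_star _ hv) q1
        have h2 := mem _ (mem_star _ hw) q2
        refine ⟨h1, h2, fun e => hvw (LatticePoint.star_injective e), ?_⟩
        rw [← matchingTransform_symmetrization hc h1 h2, matchingTransform_star]
    have hp := isGridPair_rectTransform hV h1 h2 h3
    rw [h4] at hl
    obtain ⟨V', k1, k2, k3⟩ := ih (fun g hg => hl' g (List.mem_cons_of_mem _ hg)) hp.symm.left
      (hc.of_isGridPair hp) (by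
        intro u hu
        rcases mem_rectTransform.1 hu with ⟨hu, -⟩ | rfl | rfl
        exacts [hVq u hu, q3, q4]) hl
    exact ⟨V', ⟨h1, h2, h3, k1⟩, k2, k3⟩

theorem swapsNestingCrossing_of_disjoint {e : LatticePoint × LatticePoint} (h1 : e.1.1 ≠ e.2.1)
    (h2 : e.1.2 ≠ e.2.2)
    (h : max e.1.1 e.2.1 < min e.1.2 e.2.2 ∨ max e.1.2 e.2.2 < min e.1.1 e.2.1) :
    SwapsNestingCrossing e := by
  simp only [SwapsNestingCrossing, NestingArcs, CrossingArcs, LatticePoint.left,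
    LatticePoint.right, corner]
  rcases lt_or_gt_of_ne h1 with h1 | h1 <;> rcases lt_or_gt_of_ne h2 with h2 | h2 <;>
    rcases h with h | h
  · right; omega
  · right; omega
  · left; omega
  · left; omega
  · left; omega
  · left; omega
  · right; omega
  · right; omega

/-! ### Area bound and minimal transformations for an associated polygon. -/

/-- The combinatorial data given by a simple lattice polygon associated with `Δ` and `Δ'`. -/
structure IsAssociatedPolygon (m : ℕ) (Δ Δ' : Finset LatticePoint) (V V' : Finset LatticePoint) :
    Prop where
  polygon : IsPolygon V V'
  matching : IsMatchingSet Δ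
  initial : Δ = symmetrization V
  terminal : Δ' = symmetrization V'
  disjoint : HasDisjointCoordinates V
  mem_box : ∀ u ∈ Δ, u.1 ∈ Finset.Icc 1 (m : ℤ) ∧ u.2 ∈ Finset.Icc 1 (m : ℤ)

namespace IsAssociatedPolygon

variable {m : ℕ} {Δ Δ' V V' : Finset LatticePoint} {l : List (LatticePoint × LatticePoint)}

theorem isInBox (h : IsAssociatedPolygon m Δ Δ' V V') (hl : IsMatchingTransformation Δ l Δ') :
    ∀ e ∈ l, (e.1.1 ≠ e.2.1 ∧ e.1.2 ≠ e.2.2) ∧ IsInBox m e := by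
  intro e he
  obtain ⟨h1, h2, ⟨h3, h4⟩, h5, h6⟩ := mem_coordinates_of_isRectTransformation
    h.matching.isGridPair (isRectTransformation_doubled h.matching hl) (mem_doubled he)
  have k1 : ∀ x ∈ Δ.image Prod.fst, x ∈ Finset.Icc 1 (m : ℤ) := by
    intro x hx
    obtain ⟨u, hu, rfl⟩ := Finset.mem_image.1 hx
    exact (h.mem_box u hu).1
  have k2 : ∀ x ∈ Δ.image Prod.snd, x ∈ Finset.Icc 1 (m : ℤ) := by
    intro x hx
    obtain ⟨u, hu, rfl⟩ := Finset.mem_image.1 hx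
    exact (h.mem_box u hu).2
  exact ⟨⟨h1, h2⟩, ⟨k1 _ h3, k1 _ h4⟩, k2 _ h5, k2 _ h6⟩

/-- The winding from `Δ` to `Δ'` at `z` is the sum of those of `P` at `z` and at `z.star`. They have
the same sign, so its absolute value splits, and the doubled list covers `z` at least that often. -/
theorem abs_winding_add_le (h : IsAssociatedPolygon m Δ Δ' V V')
    (hl : IsMatchingTransformation Δ l Δ') (z : LatticePoint) :
    |winding V V' z| + |winding V V' z.star| ≤ coverCount l z + coverCount l z.star := by
  have h1 := winding_eq_sum h.matching.isGridPair
    (isRectTransformation_doubled h.matching hl) z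
  have h2 := abs_sum_le_coverCount (doubled l) z
  have h3 : winding Δ Δ' z = winding V V' z + winding V V' z.star := by
    rw [h.initial, h.terminal, winding, h.disjoint.quadrantCount_symmetrization,
      (h.disjoint.of_isGridPair h.polygon.pair).quadrantCount_symmetrization, winding, winding]
    ring
  rwa [← h1, h3, h.polygon.abs_winding_add, coverCount_doubled] at h2

theorem two_mul_area (h : IsAssociatedPolygon m Δ Δ' V V')
    (hl : IsMatchingTransformation Δ l Δ') :
    2 * transformationArea l =
      ((∑ z ∈ cellBox m, (coverCount l z + coverCount l z.star) : ℤ) : ℝ) := by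
  rw [Finset.sum_add_distrib, sum_cellBox_star m (coverCount l),
    transformationArea_eq fun e he => (h.isInBox hl e he).2]
  push_cast
  ring

theorem area_ge (h : IsAssociatedPolygon m Δ Δ' V V') (hl : IsMatchingTransformation Δ l Δ') :
    ((∑ z ∈ cellBox m, |winding V V' z| : ℤ) : ℝ) ≤ transformationArea l := by
  have h1 := h.two_mul_area hl
  have h2 : ∑ z ∈ cellBox m, (|winding V V' z| + |winding V V' z.star|) ≤
      ∑ z ∈ cellBox m, (coverCount l z + coverCount l z.star) :=
    Finset.sum_le_sum fun z _ => h.abs_winding_add_le hl z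
  rw [Finset.sum_add_distrib, sum_cellBox_star m (fun z => |winding V V' z|)] at h2
  have h3 : ((∑ z ∈ cellBox m, |winding V V' z| + ∑ z ∈ cellBox m, |winding V V' z| : ℤ) : ℝ) ≤
      ((∑ z ∈ cellBox m, (coverCount l z + coverCount l z.star) : ℤ) : ℝ) := by exact_mod_cast h2
  rw [← h1, Int.cast_add] at h3
  linarith

theorem isMatchingTransformation (h : IsAssociatedPolygon m Δ Δ' V V')
    (hl : IsRectTransformation V l V') : IsMatchingTransformation Δ l Δ' := by
  rw [h.initial, h.terminal]
  exact isMatchingTransformation_symmetrization h.polygon.pair.left h.disjoint hl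

theorem area_eq (h : IsAssociatedPolygon m Δ Δ' V V') (hl : IsRectTransformation V l V')
    (hcov : ∀ z, coverCount l z = |winding V V' z|) :
    transformationArea l = ((∑ z ∈ cellBox m, |winding V V' z| : ℤ) : ℝ) := by
  rw [transformationArea_eq fun e he => (h.isInBox (h.isMatchingTransformation hl) e he).2]
  simp only [hcov]

theorem isMinimal (h : IsAssociatedPolygon m Δ Δ' V V') (hl : IsRectTransformation V l V')
    (hcov : ∀ z, coverCount l z = |winding V V' z|) : IsMinimalTransformation Δ l Δ' :=
  ⟨h.isMatchingTransformation hl, fun l' hl' => by rw [h.area_eq hl hcov]; exact h.area_ge hl'⟩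

/-- Transformations of minimal area cover no cell more often than necessary. -/
theorem coverCount_add_star (h : IsAssociatedPolygon m Δ Δ' V V')
    (hl : IsMinimalTransformation Δ l Δ') (z : LatticePoint) :
    coverCount l z + coverCount l z.star = |winding V V' z| + |winding V V' z.star| := by
  -- A transformation attaining the lower bound shows that the minimal area equals it. The cellwise
  -- inequalities then have equal sums, so each is an equality.
  obtain ⟨l₀, -, h₀, hcov⟩ := h.polygon.exists_transformation
  have hle := hl.2 l₀ (h.isMatchingTransformation h₀)
  rw [h.area_eq h₀ hcov] at hle
  have hbox := fun e he => (h.isInBox hl.1 e he).2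
  have hpt := h.abs_winding_add_le hl.1
  by_cases hz : z ∈ cellBox m
  · have h1 := h.two_mul_area hl.1
    have h2 : ∑ z ∈ cellBox m, (|winding V V' z| + |winding V V' z.star|) =
        ∑ z ∈ cellBox m, (coverCount l z + coverCount l z.star) := by
      refine le_antisymm (Finset.sum_le_sum fun z _ => hpt z) ?_
      rw [Finset.sum_add_distrib (f := fun z => |winding V V' z|),
        sum_cellBox_star m (fun z => |winding V V' z|), ← two_mul]
      have : 2 * transformationArea l ≤
          2 * ((∑ z ∈ cellBox m, |winding V V' z| : ℤ) : ℝ) := by linarith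
      rw [h1] at this
      exact_mod_cast this
    exact ((Finset.sum_eq_sum_iff_of_le fun z _ => hpt z).1 h2 z hz).symm
  · have hz' : z.star ∉ cellBox m := by
      simp only [cellBox, Finset.mem_product, LatticePoint.star_fst, LatticePoint.star_snd] at hz ⊢
      tauto
    have h1 := hpt z
    rw [coverCount_eq_zero_of_notMem hbox hz, coverCount_eq_zero_of_notMem hbox hz'] at h1 ⊢
    have := abs_nonneg (winding V V' z)
    have := abs_nonneg (winding V V' z.star)
    omega

/-- The cells of a rectangle of a minimal transformation all belong to `P` or all to `-P*`. -/
theorem exists_sameStep (h : IsAssociatedPolygon m Δ Δ' V V')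
    (hd : ∀ v, IsPointOf V V' v → ¬ IsPointOf V V' v.star)
    (hl : IsMinimalTransformation Δ l Δ') {e : LatticePoint × LatticePoint} (he : e ∈ l) :
    ∃ f, SameStep e f ∧ ∀ z, signedCell f z ≠ 0 → winding V V' z ≠ 0 := by
  have hor : ∀ z, signedCell e z ≠ 0 → winding V V' z ≠ 0 ∨ winding V V' z.star ≠ 0 := by
    intro z hz
    by_contra hn
    push Not at hn
    have h1 := h.coverCount_add_star hl z
    rw [hn.1, hn.2, abs_zero] at h1
    have h2 := abs_signedCell_le_coverCount he z
    have h3 := coverCount_nonneg l z.star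
    have h4 := Int.one_le_abs hz
    omega
  have hnot : ∀ z z' v, winding V V' z ≠ 0 → winding V V' z'.star ≠ 0 → IsCellVertex z v →
      IsCellVertex z' v → False := fun z z' v hz hz' hv hv' =>
    hd v (Or.inr (Or.inr ⟨z, hz, hv⟩)) (Or.inr (Or.inr ⟨z'.star, hz', hv'.star⟩))
  -- Two cells of the rectangle with a common vertex cannot belong one to `P` and the other to
  -- `-P*`, so membership propagates through the whole rectangle.
  have prop : ∀ z z' v, signedCell e z ≠ 0 → signedCell e z' ≠ 0 → IsCellVertex z v →
      IsCellVertex z' v → (winding V V' z ≠ 0 ↔ winding V V' z' ≠ 0) := by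
    intro z z' v hz hz' hv hv'
    exact ⟨fun hw => (hor z' hz').resolve_right fun hw' => hnot z z' v hw hw' hv hv',
      fun hw => (hor z hz).resolve_right fun hw' => hnot z' z v hw hw' hv' hv⟩
  by_cases hex : ∃ z, signedCell e z ≠ 0 ∧ winding V V' z ≠ 0
  · obtain ⟨z, hz, hw⟩ := hex
    refine ⟨e, Or.inl rfl, fun z' hz' => ?_⟩
    refine forall_signedCell_ne_zero (p := fun z => winding V V' z ≠ 0) (e := e) ?_ ?_ hz hz' hw
    · exact fun x y h1 h2 => prop _ _ (x + 1, y) h1 h2 ⟨Or.inr rfl, Or.inl rfl⟩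
        ⟨Or.inl rfl, Or.inl rfl⟩
    · exact fun x y h1 h2 => prop _ _ (x, y + 1) h1 h2 ⟨Or.inl rfl, Or.inr rfl⟩
        ⟨Or.inl rfl, Or.inl rfl⟩
  · push Not at hex
    refine ⟨starPair e, Or.inr rfl, fun z hz => ?_⟩
    rw [signedCell_starPair] at hz
    exact (hor _ hz).resolve_left (not_not.2 (hex _ hz))

/-- After reflecting rectangles into `P`, only one of `z` and `z.star` can be covered, which turns
the symmetrized equality of cover counts into one for `P`. All current vertices stay among the
points of `P`, so the moves act on `V` alone. -/
theorem of_minimal (h : IsAssociatedPolygon m Δ Δ' V V')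
    (hd : ∀ v, IsPointOf V V' v → ¬ IsPointOf V V' v.star)
    (hl : IsMinimalTransformation Δ l Δ') :
    ∃ l', List.Forall₂ SameStep l l' ∧ IsRectTransformation V l' V' ∧
      (∀ z, coverCount l' z = |winding V V' z|) ∧
      ∀ f ∈ l', ∀ v : LatticePoint, min f.1.1 f.2.1 ≤ v.1 ∧ v.1 ≤ max f.1.1 f.2.1 →
        min f.1.2 f.2.2 ≤ v.2 ∧ v.2 ≤ max f.1.2 f.2.2 → IsPointOf V V' v := by
  obtain ⟨l', hll, hcell⟩ := exists_forall₂ (q := fun f => (f.1.1 ≠ f.2.1 ∧ f.1.2 ≠ f.2.2) ∧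
      ∀ z, signedCell f z ≠ 0 → winding V V' z ≠ 0) fun e he => by
    obtain ⟨f, hef, hf⟩ := h.exists_sameStep hd hl he
    refine ⟨f, hef, ?_, hf⟩
    have := (h.isInBox hl.1 e he).1
    rcases hef with rfl | rfl
    exacts [this, this.symm]
  have hpoint : ∀ f ∈ l', ∀ v : LatticePoint, min f.1.1 f.2.1 ≤ v.1 ∧ v.1 ≤ max f.1.1 f.2.1 →
      min f.1.2 f.2.2 ≤ v.2 ∧ v.2 ≤ max f.1.2 f.2.2 → IsPointOf V V' v := by
    intro f hf v h1 h2
    obtain ⟨⟨n1, n2⟩, hc⟩ := hcell f hf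
    obtain ⟨z, hz, hv⟩ := exists_cell_of_mem n1 n2 h1 h2
    exact Or.inr (Or.inr ⟨z, hc z hz, hv⟩)
  have hcov : ∀ z, coverCount l' z = |winding V V' z| := by
    intro z
    have hzero : ∀ z, winding V V' z = 0 → coverCount l' z = 0 := by
      intro z hz
      by_contra hn
      obtain ⟨f, hf, hfz⟩ := coverCount_ne_zero_iff.1 hn
      exact (hcell f hf).2 z hfz hz
    by_cases hz : winding V V' z = 0
    · rw [hz, hzero z hz, abs_zero]
    · have hz' : winding V V' z.star = 0 := by
        by_contra hn
        exact hd z (Or.inr (Or.inr ⟨z, hz, Or.inl rfl, Or.inl rfl⟩))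
          (Or.inr (Or.inr ⟨z.star, hn, Or.inl rfl, Or.inl rfl⟩))
      have h1 := coverCount_add_star_of_forall₂ hll z
      rw [h.coverCount_add_star hl z, hzero _ hz', hz', abs_zero] at h1
      omega
  have hmatch := hl.1
  rw [h.initial] at hmatch
  obtain ⟨U, hU, hsym, hUq⟩ := exists_isRectTransformation hd hll (fun f hf =>
    ⟨hpoint f hf _ (by omega) (by omega), hpoint f hf _ (by omega) (by omega),
      hpoint f hf _ (by simp only [corner]; omega) (by simp only [corner]; omega),
      hpoint f hf _ (by simp only [corner]; omega) (by simp only [corner]; omega)⟩)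
    h.polygon.pair.left h.disjoint (fun v hv => Or.inl hv) hmatch
  -- Both sets have the symmetrization `Δ'` and consist of points of `P`, whose mirror images are
  -- not points of `P`.
  have hUV : U = V' := by
    have hsym' : ∀ u, (u ∈ U ∨ u.star ∈ U) ↔ (u ∈ V' ∨ u.star ∈ V') := by
      intro u
      rw [← mem_symmetrization, ← mem_symmetrization, hsym, h.terminal]
    ext u
    constructor
    · intro hu
      exact ((hsym' u).1 (Or.inl hu)).resolve_right fun hn =>
        hd u (hUq u hu) (Or.inr (Or.inl hn))
    · intro hu
      exact ((hsym' u).2 (Or.inl hu)).resolve_right fun hn =>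
        hd u (Or.inr (Or.inl hu)) (hUq _ hn)
  rw [hUV] at hU
  exact ⟨l', hll, hU, hcov, hpoint⟩

end IsAssociatedPolygon

theorem mainTheorem3 {m : ℕ} (δ δ' : PartialMatching m) (Δ Δ' : Finset LatticePoint)
    (hΔ : Δ = δ.latticePresentation) (hΔ' : Δ' = δ'.latticePresentation)
    (P : LatticePolytope) (hP : P.IsAssociated Δ Δ') (hsimple : P.IsSimplePolygon)
    (n : ℕ) (hn : P.nonIsolated.card = 2 * n) :
    (∃ l, l.length + 1 = n ∧ P.IsDivision l ∧ P.InducesTransformation l) ∧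
    (∀ l, l.length + 1 = n → P.IsDivision l → P.InducesTransformation l →
      IsMinimalTransformation Δ l Δ') ∧
    (Disjoint P.carrier P.mirror.carrier →
      ∀ l, IsMinimalTransformation Δ l Δ' →
        (∃ l', List.Forall₂ SameStep l l' ∧ P.IsDivision l' ∧ P.InducesTransformation l') ∧
        ((∀ u ∈ P.isolated, u.toPlane ∉ P.face) → l.length + 1 = n) ∧
        (∀ e ∈ l, SwapsNestingCrossing e)) := by
  obtain ⟨hmatch, hbox⟩ := isMatchingSet_latticePresentation δ
  rw [← hΔ] at hmatch hbox
  obtain ⟨h0, hd0, h1, -⟩ := hP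
  have hpoly := hsimple.isPolygon
  have hg := P.isGridPair
  have hA : IsAssociatedPolygon m Δ Δ' P.ver0 P.ver1 := by
    refine ⟨hpoly, hmatch, h0.symm, h1.symm, fun u hu v hv e => ?_, hbox⟩
    have hv' : v.star ∈ P.mirror.ver0 := Finset.mem_image_of_mem _ hv
    have := hmatch.fst_injOn u (h0 ▸ Finset.mem_union_left _ hu) v.star
      (h0 ▸ Finset.mem_union_right _ hv') e
    exact Finset.disjoint_left.1 hd0 hu (this ▸ hv')
  have hcard : (P.ver0 \ P.ver1).card = n := by
    have e : P.nonIsolated = P.ver0 \ P.ver1 ∪ P.ver1 \ P.ver0 := by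
      ext u
      simp only [LatticePolytope.nonIsolated, LatticePolytope.isolated, Finset.mem_sdiff,
        Finset.mem_union, Finset.mem_inter]
      tauto
    rw [e, Finset.card_union_of_disjoint disjoint_sdiff_sdiff, ← hg.sdiff.card_eq] at hn
    omega
  have hdiv : ∀ l, IsRectTransformation P.ver0 l P.ver1 →
      (∀ z, coverCount l z = |winding P.ver0 P.ver1 z|) → P.IsDivision l := fun l hl hcov =>
    P.isDivision_of_coverCount_eq (fun e he =>
      have := mem_coordinates_of_isRectTransformation hg.left hl he
      ⟨this.1, this.2.1⟩) hpoly.abs_winding_le_one hcov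
  refine ⟨?_, ?_, ?_⟩
  · obtain ⟨l, hlen, hl, hcov⟩ := hpoly.exists_transformation
    exact ⟨l, hlen.trans hcard, hdiv l hl hcov, hl⟩
  · intro l _ hdl hl
    refine hA.isMinimal hl fun z => ?_
    rw [coverCount_eq_abs_sum hdl.2, ← winding_eq_sum hg.left hl]
  · intro hdisj l hl
    have hd := P.not_isPointOf_star hdisj
    obtain ⟨l', hll, htr, hcov, hpoint⟩ := hA.of_minimal hd hl
    refine ⟨⟨l', hll, hdiv l' htr hcov, htr⟩, fun hiso => ?_, fun e he => ?_⟩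
    · rw [hll.length_eq, ← hcard]
      refine hpoly.length_add_one htr hcov fun u hu hu' => ?_
      -- An isolated vertex is a vertex of both diagonal cells, so outside the face both have
      -- winding zero.
      have hout := hiso u (Finset.mem_inter.2 ⟨hu, hu'⟩)
      constructor
      · by_contra hw
        exact hout (P.closedCell_subset_face hw
          (IsCellVertex.mem_closedCell ⟨Or.inl rfl, Or.inl rfl⟩))
      · by_contra hw
        exact hout (P.closedCell_subset_face hw
          (IsCellVertex.mem_closedCell ⟨Or.inr (by simp), Or.inr (by simp)⟩))
    · obtain ⟨n1, n2⟩ := (hA.isInBox hl.1 e he).1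
      refine swapsNestingCrossing_of_disjoint n1 n2 ?_
      by_contra hn
      -- If the coordinate intervals of the rectangle overlap, the larger of their left ends gives a
      -- point `(t, t)` of the rectangle, hence of `P`. It is its own mirror image, which is
      -- impossible.
      obtain ⟨t, ht1, ht2⟩ : ∃ t : ℤ, (min e.1.1 e.2.1 ≤ t ∧ t ≤ max e.1.1 e.2.1) ∧
          min e.1.2 e.2.2 ≤ t ∧ t ≤ max e.1.2 e.2.2 :=
        ⟨max (min e.1.1 e.2.1) (min e.1.2 e.2.2), by omega, by omega⟩
      obtain ⟨f, hf, hef⟩ := forall_exists_of_forall₂ hll e he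
      have hpt : IsPointOf P.ver0 P.ver1 (t, t) := by
        rcases hef with rfl | rfl
        exacts [hpoint _ hf (t, t) ht1 ht2, hpoint _ hf (t, t) ht2 ht1]
      exact hd (t, t) hpt hpt
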